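/- **Setting.** Let $G$ be a totally ordered abelian group with identity $0$ and positive cone $G^+=\{t\in G: t\ge 0\}$, and let $A$ be a $C^*$-algebra (not necessarily unital). A *corner system* $(A,\alpha,L)$ consists of a $*$-endomorphism $\alpha$ of $A$ and a positive linear map $L:A\to A$ such that $L(\alpha(a)b)=aL(b)$ for all $a,b\in A$ and $\alpha\circ L$ is a conditional expectation of $A$ onto $\alpha(A)$, which is a hereditary $C^*$-subalgebra of $A$. A *semigroup corner system* $(A,G^+,\alpha,L)$ consists of unital semigroup homomorphisms $\alpha:G^+\to\operatorname{End}(A)$ and $L:G^+\to\operatorname{Pos}(A)$ (so $\alpha_0=L_0=\mathrm{id}$) such that $(A,\alpha_t,L_t)$ is a corner system for each $t\in G^+$. Write $\overline{\alpha}_t(1)\in M(A)$ for the strict limit of $\alpha_t(\mu_\lambda)$, where $(\mu_\lambda)$ is an approximate unit of $A$ (the limit exists). The associated Fell bundle $\mathcal B=\{B_g\}_{g\in G}$ has the fibres $B_t=\{a\delta_t: a\in A\overline{\alpha}_t(1)\}$ and $B_{-t}=\{a\delta_{-t}:a\in\overline{\alpha}_t(1)A\}$ for $t\in G^+$, with the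 norm of $A$, the involution $(a\delta_g)^*=a^*\delta_{-g}$ and the multiplication $$ a\delta_g\cdot b\delta_h=\begin{cases} a\alpha_g(b)\,\delta_{g+h}, & g,h\ge 0,\\ L_{-g}(ab)\,\delta_{g+h}, & g<0,\ h\ge0,\ g+h\ge 0,\\ L_h(ab)\,\delta_{g+h}, & g<0,\ h\ge 0,\ g+h<0,\\ a\alpha_{g+h}(b)\,\delta_{g+h}, & h<0,\ g\ge 0,\ g+h\ge 0,\\ \alpha_{-g-h}(a)b\,\delta_{g+h}, & h<0,\ g\ge 0,\ g+h<0,\\ \alpha_{-h}(a)b\,\delta_{g+h}, & g,h<0. \end{cases} $$ The *crossed product* $A\rtimes_{\alpha,L}G^+$ is the cross sectional $C^*$-algebra $C^*(\mathcal B)$, that is, the completion of the $*$-algebra $\bigoplus_{g\in G}B_g$ in its largest $C^*$-seminorm. The *product system* of $(A,G^+,\alpha,L)$ is $X=\bigsqcup_{t\in G^+}X_t$, where $X_t$ is the Hausdorff completion of $A$, with canonical map $q_t:A\to X_t$, for the inner product $\langle q_t(a),q_t(b)\rangle=L_t(a^*b)$, with right action $q_t(b)a=q_t(b\alpha_t(a))$,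 left action $\phi_t(a)q_t(b)=q_t(ab)$, and multiplication $q_s(a)q_t(b)=q_{s+t}(a\alpha_s(b))$. Let $\mathcal T_X$ be its Toeplitz algebra, with universal representation $i_X$. Let $i_X^{(t)}:\mathcal K(X_t)\to\mathcal T_X$ be the homomorphism with $i_X^{(t)}(\Theta_{x,y})=i_X(x)i_X(y)^*$, where $\Theta_{x,y}z=x\langle y,z\rangle$, and let $\mathcal I_K$ be the closed ideal of $\mathcal T_X$ generated by the differences $i_X(a)-i_X^{(t)}(\phi_t(a))$ for $t\in G^+$ and $a\in \overline{A\alpha_t(A)A}\cap\phi_t^{-1}(\mathcal K(X_t))$, where $\overline{A\alpha_t(A)A}$ is the closed linear span. The *Exel–Larsen crossed product* is $\mathcal T_X/\mathcal I_K$. A *covariant pair* $(\pi,U)$ on a Hilbert space $H$ consists of a non-degenerate representation $\pi:A\to B(H)$ and a unital semigroup homomorphism $U:G^+\to B(H)$ such that $U_t\pi(a)U_t^*=\pi(\alpha_t(a))$ and $U_t^*\pi(a)U_t=\pi(L_t(a))$ for all $a\in A$, $t\in G^+$. **Theorem.** Let $(A,G^+,\alpha,L)$ be a semigroup corner system. The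 canonical maps $B_g\to A\rtimes_{\alpha,L}G^+$ are isometric; in particular, $A=B_0\subseteq A\rtimes_{\alpha,L}G^+$. There is a unital semigroup homomorphism $u:G^+\to M(A\rtimes_{\alpha,L}G^+)$ with values in partial isometries such that the following hold. 1. For all $a\in A$ and $t\in G^+$, $$u_tau_t^*=\alpha_t(a),\qquad u_t^*au_t=L_t(a).$$ Moreover $a\delta_t=au_t$ for $a\in A\overline{\alpha}_t(1)$ and $a\delta_{-t}=u_t^*a$ for $a\in\overline{\alpha}_t(1)A$. The elements of the form $$\sum_{t\in F}u_t^*a_{-t}+a_0+\sum_{t\in F}a_tu_t,\qquad F\subseteq G^+\setminus\{0\}\text{ finite},\ a_0\in A,\ a_t\in A\overline{\alpha}_t(1),\ a_{-t}\in\overline{\alpha}_t(1)A,$$ form a dense $*$-subalgebra of $A\rtimes_{\alpha,L}G^+$. 2. $A\rtimes_{\alpha,L}G^+$ is universal for covariant pairs: for every covariant pair $(\pi,U)$ on a Hilbert space $H$ there is a unique non-degenerate representation $\pi\rtimes U:A\rtimes_{\alpha,L}G^+\to B(H)$ such that, for all $t\in G^+$, $(\pi\rtimes U)(a_tu_t)=\pi(a_t)U_t$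 for $a_t\in A\overline{\alpha}_t(1)$ and $(\pi\rtimes U)(u_t^*a_{-t})=U_t^*\pi(a_{-t})$ for $a_{-t}\in\overline{\alpha}_t(1)A$. Every non-degenerate representation of $A\rtimes_{\alpha,L}G^+$ on a Hilbert space is of the form $\pi\rtimes U$ for some covariant pair $(\pi,U)$. 3. $A\rtimes_{\alpha,L}G^+$ is naturally isomorphic to the Exel–Larsen crossed product: there is a $*$-isomorphism $\Psi:\mathcal T_X/\mathcal I_K\to A\rtimes_{\alpha,L}G^+$ such that $\Psi(i_X(q_t(a))+\mathcal I_K)=au_t$ for all $a\in A$, $t\in G^+$. -/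

import Mathlib

open scoped Topology MultiplierAlgebra
open Filter

set_option linter.unusedSectionVars false

noncomputable section

/-- A (not necessarily separating) `C*`-seminorm on a complex `*`-algebra. -/
structure CStarSeminorm (V : Type*) [NonUnitalRing V] [StarRing V] [Module ℂ V] extends
    Seminorm ℂ V where
  mul_le' : ∀ x y, toFun (x * y) ≤ toFun x * toFun y
  star_mul_self' : ∀ x, toFun (star x * x) = toFun x ^ 2

namespace CStarSeminorm

section Completion

variable {V : Type*} [NonUnitalRing V] [StarRing V] [Module ℂ V]

instance : CoeFun (CStarSeminorm V) fun _ => V → ℝ := ⟨fun p => p.toSeminorm⟩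

variable (p : CStarSeminorm V)

theorem mul_le (x y : V) : p (x * y) ≤ p x * p y := p.mul_le' x y

theorem star_mul_self (x : V) : p (star x * x) = p x ^ 2 := p.star_mul_self' x

theorem map_star (x : V) : p (star x) = p x := by
  have key : ∀ y : V, p y ≤ p (star y) := by
    intro y
    rcases (apply_nonneg p.toSeminorm y).eq_or_lt with h | h
    · rw [← h]; exact apply_nonneg p.toSeminorm _
    · have h1 := p.mul_le (star y) y
      rw [p.star_mul_self, sq] at h1
      exact le_of_mul_le_mul_right h1 h
  refine le_antisymm ?_ (key x)
  simpa using key (star x)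

/-- The `*`-algebra `V`, regarded as a seminormed algebra with the seminorm `p`. -/
@[nolint unusedArguments]
def Space (_p : CStarSeminorm V) : Type _ := V

instance : NonUnitalSeminormedRing p.Space :=
  { AddGroupSeminorm.toSeminormedAddCommGroup (E := V) p.toSeminorm.toAddGroupSeminorm,
    (inferInstance : NonUnitalRing V) with
    norm_mul_le := p.mul_le }

instance : StarRing p.Space where
  star := fun x : V => (star x : V)
  star_involutive := star_involutive (R := V)
  star_mul := star_mul (R := V)
  star_add := star_add (R := V)

instance : NormedSpace ℂ p.Space :=
  { (inferInstance : Module ℂ V) with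
    norm_smul_le := fun c x => (p.toSeminorm.smul' c x).le }

instance : NormedStarGroup p.Space := ⟨fun x => (p.map_star x).le⟩

/-- The Hausdorff completion of `V` with respect to the `C*`-seminorm `p`. -/
def Completion : Type _ := UniformSpace.Completion p.Space

namespace Completion

open UniformSpace

instance : NormedAddCommGroup p.Completion :=
  inferInstanceAs (NormedAddCommGroup (UniformSpace.Completion p.Space))
instance : CompleteSpace p.Completion :=
  inferInstanceAs (CompleteSpace (UniformSpace.Completion p.Space))
instance : NormedSpace ℂ p.Completion :=
  inferInstanceAs (NormedSpace ℂ (UniformSpace.Completion p.Space))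

/-- The canonical map of `V` into its completion. -/
def of (x : V) : p.Completion := ((show p.Space from x : p.Space) : UniformSpace.Completion p.Space)

theorem norm_of (x : V) : ‖of p x‖ = p x := UniformSpace.Completion.norm_coe (E := p.Space) x
theorem of_zero : of p 0 = 0 := UniformSpace.Completion.coe_zero (α := p.Space)
theorem of_add (x y : V) : of p (x + y) = of p x + of p y :=
  UniformSpace.Completion.coe_add (α := p.Space) x y
theorem of_smul (c : ℂ) (x : V) : of p (c • x) = c • of p x :=
  UniformSpace.Completion.coe_smul (X := p.Space) c x
theorem continuous_of : Continuous (fun x : p.Space => of p x) :=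
  UniformSpace.Completion.continuous_coe p.Space
theorem denseRange_of : DenseRange (of p) :=
  UniformSpace.Completion.denseRange_coe (α := p.Space)
theorem isDenseInducing_of : IsDenseInducing (fun x : p.Space => of p x) :=
  UniformSpace.Completion.isDenseInducing_coe (α := p.Space)

@[elab_as_elim]
theorem ind {q : p.Completion → Prop} (x : p.Completion) (hc : IsClosed {x | q x})
    (h : ∀ v, q (of p v)) : q x := UniformSpace.Completion.induction_on x hc h

@[elab_as_elim]
theorem ind₂ {q : p.Completion → p.Completion → Prop} (x y : p.Completion)
    (hc : IsClosed {z : p.Completion × p.Completion | q z.1 z.2})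
    (h : ∀ v w, q (of p v) (of p w)) : q x y := UniformSpace.Completion.induction_on₂ x y hc h

@[elab_as_elim]
theorem ind₃ {q : p.Completion → p.Completion → p.Completion → Prop} (x y z : p.Completion)
    (hc : IsClosed {z : p.Completion × p.Completion × p.Completion | q z.1 z.2.1 z.2.2})
    (h : ∀ v w u, q (of p v) (of p w) (of p u)) : q x y z :=
  UniformSpace.Completion.induction_on₃ x y z hc h

/-- The additive map underlying `of`. -/
def ofAddHom : p.Space →+ p.Completion where
  toFun := of p
  map_zero' := of_zero p
  map_add' := of_add p

instance : Mul p.Completion :=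
  ⟨Function.curry <| ((isDenseInducing_of p).prodMap (isDenseInducing_of p)).extend
    ((of p) ∘ Function.uncurry (fun x y : p.Space => x * y))⟩

theorem of_mul (x y : V) : of p (x * y) = of p x * of p y :=
  (((isDenseInducing_of p).prodMap (isDenseInducing_of p)).extend_eq
      ((continuous_of p).comp (continuous_mul (M := p.Space))) (x, y)).symm

instance : ContinuousMul p.Completion where
  continuous_mul := by
    let m := (AddMonoidHom.mul : p.Space →+ p.Space →+ p.Space).compr₂ (ofAddHom p)
    have : Continuous fun q : p.Space × p.Space => m q.1 q.2 :=
      (continuous_of p).comp (continuous_mul (M := p.Space))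
    have di : IsDenseInducing (ofAddHom p : p.Space → p.Completion) := isDenseInducing_of p
    exact (di.extend_Z_bilin di this :)

instance : NonUnitalRing p.Completion :=
  { (inferInstance : AddCommGroup p.Completion), (inferInstance : Mul p.Completion) with
    zero_mul := fun a => ind p a (isClosed_eq (by fun_prop) continuous_const)
      fun a => by rw [← of_zero, ← of_mul, zero_mul]
    mul_zero := fun a => ind p a (isClosed_eq (by fun_prop) continuous_const)
      fun a => by rw [← of_zero, ← of_mul, mul_zero]
    mul_assoc := fun a b c => ind₃ p a b c (isClosed_eq (by fun_prop) (by fun_prop))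
      fun a b c => by rw [← of_mul, ← of_mul, ← of_mul, ← of_mul, mul_assoc]
    left_distrib := fun a b c => ind₃ p a b c (isClosed_eq (by fun_prop) (by fun_prop))
      fun a b c => by rw [← of_add, ← of_mul, ← of_mul, ← of_mul, ← of_add, mul_add]
    right_distrib := fun a b c => ind₃ p a b c (isClosed_eq (by fun_prop) (by fun_prop))
      fun a b c => by rw [← of_add, ← of_mul, ← of_mul, ← of_mul, ← of_add, add_mul] }

instance : NonUnitalNormedRing p.Completion :=
  { (inferInstance : NormedAddCommGroup p.Completion),
    (inferInstance : NonUnitalRing p.Completion) with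
    norm_mul_le := fun x y => ind₂ p x y (isClosed_le (by fun_prop) (by fun_prop))
      fun x y => by rw [← of_mul, norm_of, norm_of, norm_of]; exact p.mul_le x y }

theorem uniformContinuous_star : UniformContinuous fun x : p.Space => star x :=
  (starNormedAddGroupHom (E := p.Space)).uniformContinuous

instance : Star p.Completion := ⟨UniformSpace.Completion.map (fun x : p.Space => star x)⟩

theorem of_star (x : V) : of p (star x) = star (of p x) :=
  (UniformSpace.Completion.map_coe (uniformContinuous_star p) x).symm

theorem continuous_star' : Continuous fun x : p.Completion => star x :=
  UniformSpace.Completion.continuous_map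

instance : StarRing p.Completion where
  star_involutive := fun x => ind p x
    (isClosed_eq ((continuous_star' p).comp (continuous_star' p)) continuous_id)
    fun x => by rw [← of_star, ← of_star, star_star]
  star_mul := fun x y => ind₂ p x y
    (isClosed_eq ((continuous_star' p).comp (by fun_prop))
      (((continuous_star' p).comp continuous_snd).mul ((continuous_star' p).comp continuous_fst)))
    fun x y => by rw [← of_mul, ← of_star, ← of_star, ← of_star, ← of_mul, star_mul]
  star_add := fun x y => ind₂ p x y
    (isClosed_eq ((continuous_star' p).comp (by fun_prop))
      (((continuous_star' p).comp continuous_fst).add ((continuous_star' p).comp continuous_snd)))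
    fun x y => by rw [← of_add, ← of_star, ← of_star, ← of_star, ← of_add, star_add]

instance : CStarRing p.Completion where
  norm_mul_self_le := fun x => le_of_eq <| by
    refine ind p x (isClosed_eq (by fun_prop)
      (((continuous_star' p).mul continuous_id).norm)) fun x => ?_
    rw [← of_star, ← of_mul, norm_of, norm_of, p.star_mul_self, sq]

theorem smul_mul' [IsScalarTower ℂ V V] (c : ℂ) (x y : p.Completion) :
    (c • x) * y = c • (x * y) :=
  ind₂ p x y (isClosed_eq ((continuous_fst.const_smul c).mul continuous_snd)
    ((continuous_fst.mul continuous_snd).const_smul c))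
    fun x y => by rw [← of_smul, ← of_mul, ← of_mul, ← of_smul, smul_mul_assoc]

theorem mul_smul' [SMulCommClass ℂ V V] (c : ℂ) (x y : p.Completion) :
    x * (c • y) = c • (x * y) :=
  ind₂ p x y (isClosed_eq (continuous_fst.mul (continuous_snd.const_smul c))
    ((continuous_fst.mul continuous_snd).const_smul c))
    fun x y => by rw [← of_smul, ← of_mul, ← of_mul, ← of_smul, mul_smul_comm]

theorem star_smul' [StarModule ℂ V] (c : ℂ) (x : p.Completion) :
    star (c • x) = star c • star x :=
  ind p x (isClosed_eq ((continuous_star' p).comp (continuous_id.const_smul c))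
    ((continuous_star' p).const_smul (star c)))
    fun x => by rw [← of_smul, ← of_star, ← of_star, ← of_smul, star_smul]

/-- The canonical `*`-homomorphism of `V` into its completion. -/
def ofHom : V →⋆ₙₐ[ℂ] p.Completion where
  toFun := of p
  map_smul' := of_smul p
  map_zero' := of_zero p
  map_add' := of_add p
  map_mul' := of_mul p
  map_star' := of_star p

theorem norm_ofHom (x : V) : ‖ofHom p x‖ = p x := norm_of p x

variable [IsScalarTower ℂ V V] [SMulCommClass ℂ V V] [StarModule ℂ V]

/-- The completion of a `*`-algebra in a `C*`-seminorm is a `C*`-algebra. -/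
instance : NonUnitalCStarAlgebra p.Completion :=
  { (inferInstance : NonUnitalNormedRing p.Completion), (inferInstance : StarRing p.Completion),
    (inferInstance : CompleteSpace p.Completion), (inferInstance : CStarRing p.Completion),
    (inferInstance : NormedSpace ℂ p.Completion) with
    smul_assoc := smul_mul' p
    smul_comm := fun c x y => (mul_smul' p c x y).symm
    star_smul := star_smul' p }

end Completion

/-- A `C*`-seminorm on a `C*`-algebra is dominated by the norm. -/
theorem le_norm {B : Type*} [NonUnitalCStarAlgebra B] (p : CStarSeminorm B) (b : B) :
    p b ≤ ‖b‖ := by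
  rw [← Completion.norm_ofHom p b]
  exact NonUnitalStarAlgHom.norm_apply_le (Completion.ofHom p) b

/-- The pull back of a `C*`-seminorm along a `*`-homomorphism. -/
def comap {W : Type*} [NonUnitalRing W] [StarRing W] [Module ℂ W] (p : CStarSeminorm V)
    (f : W →⋆ₙₐ[ℂ] V) : CStarSeminorm W where
  toSeminorm := p.toSeminorm.comp (f : W →ₗ[ℂ] V)
  mul_le' x y := by
    change p (f (x * y)) ≤ p (f x) * p (f y)
    rw [map_mul]; exact p.mul_le _ _
  star_mul_self' x := by
    change p (f (star x * x)) = p (f x) ^ 2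
    rw [map_mul, show f (star x) = star (f x) from StarHomClass.map_star f x]; exact p.star_mul_self _

end Completion

section Enveloping

variable {V : Type*} [NonUnitalRing V] [StarRing V] [Module ℂ V]

/-- The set `S` bounds the `C*`-seminorms on `V` that vanish on it: this is what is needed for the
enveloping `C*`-algebra of `V` subject to the relations `S` to exist. -/
def Bounding (S : Set V) : Prop :=
  ∀ x : V, ∃ M : ℝ, ∀ p : CStarSeminorm V, (∀ s ∈ S, p s = 0) → p x ≤ M

variable (S : Set V)

/-- The zero seminorm. -/
def zero : CStarSeminorm V where
  toSeminorm := 0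
  mul_le' _ _ := (mul_zero (0 : ℝ)).ge
  star_mul_self' _ := (zero_pow two_ne_zero).symm

instance : Nonempty {p : CStarSeminorm V // ∀ s ∈ S, p s = 0} := ⟨⟨zero, fun _ _ => rfl⟩⟩

variable {S}

/-- The largest `C*`-seminorm on `V` that vanishes on `S`. -/
def maximal (hS : Bounding S) : CStarSeminorm V where
  toFun x := ⨆ p : {p : CStarSeminorm V // ∀ s ∈ S, p s = 0}, p.1 x
  map_zero' := by simp
  add_le' x y := ciSup_le fun p => (map_add_le_add p.1.toSeminorm x y).trans <|
    add_le_add (le_ciSup (f := fun p : {p : CStarSeminorm V // ∀ s ∈ S, p s = 0} => p.1 x)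
      ((hS x).imp fun _ h => by rintro _ ⟨q, rfl⟩; exact h q.1 q.2) p)
      (le_ciSup (f := fun p : {p : CStarSeminorm V // ∀ s ∈ S, p s = 0} => p.1 y)
      ((hS y).imp fun _ h => by rintro _ ⟨q, rfl⟩; exact h q.1 q.2) p)
  neg' x := by simp
  smul' c x := by
    simp only [map_smul_eq_mul]
    rw [Real.mul_iSup_of_nonneg (norm_nonneg c)]
  mul_le' x y := ciSup_le fun p => (p.1.mul_le x y).trans <|
    mul_le_mul (le_ciSup (f := fun p : {p : CStarSeminorm V // ∀ s ∈ S, p s = 0} => p.1 x)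
      ((hS x).imp fun _ h => by rintro _ ⟨q, rfl⟩; exact h q.1 q.2) p)
      (le_ciSup (f := fun p : {p : CStarSeminorm V // ∀ s ∈ S, p s = 0} => p.1 y)
      ((hS y).imp fun _ h => by rintro _ ⟨q, rfl⟩; exact h q.1 q.2) p)
      (apply_nonneg p.1.toSeminorm y)
      (Real.iSup_nonneg fun q => apply_nonneg q.1.toSeminorm x)
  star_mul_self' x := by
    simp only [star_mul_self]
    have hb : BddAbove (Set.range fun p : {p : CStarSeminorm V // ∀ s ∈ S, p s = 0} => p.1 x) :=
      (hS x).imp fun _ h => by rintro _ ⟨q, rfl⟩; exact h q.1 q.2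
    have hb2 : BddAbove
        (Set.range fun p : {p : CStarSeminorm V // ∀ s ∈ S, p s = 0} => p.1 x ^ 2) := by
      obtain ⟨M, hM⟩ := hb
      refine ⟨M ^ 2, ?_⟩
      rintro _ ⟨q, rfl⟩
      exact pow_le_pow_left₀ (apply_nonneg q.1.toSeminorm x) (hM ⟨q, rfl⟩) 2
    have h0 : 0 ≤ ⨆ p : {p : CStarSeminorm V // ∀ s ∈ S, p s = 0}, p.1 x :=
      Real.iSup_nonneg fun q => apply_nonneg q.1.toSeminorm x
    apply le_antisymm
    · exact ciSup_le fun p => pow_le_pow_left₀ (apply_nonneg p.1.toSeminorm x) (le_ciSup hb p) 2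
    · rw [← Real.le_sqrt h0 (Real.iSup_nonneg fun q => sq_nonneg _)]
      exact ciSup_le fun p => Real.le_sqrt_of_sq_le (le_ciSup hb2 p)

theorem le_maximal (hS : Bounding S) (p : CStarSeminorm V) (hp : ∀ s ∈ S, p s = 0) (x : V) :
    p x ≤ maximal hS x :=
  le_ciSup (f := fun p : {p : CStarSeminorm V // ∀ s ∈ S, p s = 0} => p.1 x)
    ((hS x).imp fun _ h => by rintro _ ⟨q, rfl⟩; exact h q.1 q.2) ⟨p, hp⟩

end Enveloping

end CStarSeminorm

section CornerSystems

/-- A subset `B` (a `C*`-subalgebra) of `A` is hereditary. -/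
def IsHereditary {A : Type*} [NonUnitalCStarAlgebra A] [PartialOrder A] (B : Set A) : Prop :=
  ∀ a b : A, 0 ≤ a → a ≤ b → b ∈ B → a ∈ B

/-- `E` is a conditional expectation of `A` onto the `C*`-subalgebra `B`. -/
structure IsConditionalExpectation {A : Type*} [NonUnitalCStarAlgebra A] [PartialOrder A]
    (E : A → A) (B : Set A) : Prop where
  mem : ∀ a, E a ∈ B
  eq_self : ∀ b ∈ B, E b = b
  nonneg : ∀ a, 0 ≤ a → 0 ≤ E a
  norm_le : ∀ a, ‖E a‖ ≤ ‖a‖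
  mul_left : ∀ b ∈ B, ∀ a, E (b * a) = b * E a
  mul_right : ∀ b ∈ B, ∀ a, E (a * b) = E a * b

/-- `(A, α, L)` is an Exel system: `L` is a transfer operator for the endomorphism `α`. -/
def IsExelSystem {A : Type*} [NonUnitalCStarAlgebra A] [PartialOrder A]
    (α : A →⋆ₙₐ[ℂ] A) (L : A →ₚ[ℂ] A) : Prop :=
  ∀ a b, L (α a * b) = a * L b

/-- `(A, α, L)` is a corner system: an Exel system such that `α ∘ L` is a conditional expectation
onto `α(A)`, and `α(A)` is hereditary. -/
structure IsCornerSystem {A : Type*} [NonUnitalCStarAlgebra A] [PartialOrder A]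
    (α : A →⋆ₙₐ[ℂ] A) (L : A →ₚ[ℂ] A) : Prop where
  exel : IsExelSystem α L
  hereditary : IsHereditary (Set.range α)
  condExp : IsConditionalExpectation (fun a => α (L a)) (Set.range α)

/-- The positive cone `G⁺` of a totally ordered abelian group. -/
abbrev PosCone (G : Type*) [AddCommGroup G] [LinearOrder G] : Type _ := {t : G // 0 ≤ t}

/-- A semigroup corner system `(A, G⁺, α, L)`. -/
structure CornerSystem (G : Type*) [AddCommGroup G] [LinearOrder G] [IsOrderedAddMonoid G]
    (A : Type*) [NonUnitalCStarAlgebra A] [PartialOrder A] where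
  α : PosCone G → A →⋆ₙₐ[ℂ] A
  L : PosCone G → A →ₚ[ℂ] A
  α_zero : ∀ a, α 0 a = a
  α_add : ∀ s t a, α (s + t) a = α s (α t a)
  L_zero : ∀ a, L 0 a = a
  L_add : ∀ s t a, L (s + t) a = L s (L t a)
  corner : ∀ t, IsCornerSystem (α t) (L t)

end CornerSystems

section Projection

open CStarAlgebra

variable {A : Type*} [NonUnitalCStarAlgebra A] [PartialOrder A] [StarOrderedRing A]

theorem PositiveLinearMap.map_star_of_cstar (L : A →ₚ[ℂ] A) (a : A) : L (star a) = star (L a) := by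
  obtain ⟨x, hx, -, h⟩ := CStarAlgebra.exists_sum_four_nonneg a
  have h1 : ∀ i, star (x i) = x i := fun i => (IsSelfAdjoint.of_nonneg (hx i)).star_eq
  have h2 : ∀ i, star (L (x i)) = L (x i) := fun i =>
    (IsSelfAdjoint.of_nonneg (map_nonneg L (hx i))).star_eq
  rw [h]
  simp only [star_sum, star_smul, map_sum, map_smul, h1, h2]

namespace IsCornerSystem

variable {α : A →⋆ₙₐ[ℂ] A} {L : A →ₚ[ℂ] A}

theorem exel_right (h : IsCornerSystem α L) (a b : A) : L (b * α a) = L b * a := by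
  have := h.exel (star a) (star b)
  rw [← star_inj, ← PositiveLinearMap.map_star_of_cstar, star_mul, star_mul,
    ← PositiveLinearMap.map_star_of_cstar, ← this, map_star]

theorem conj_nonneg (h : IsCornerSystem α L) (d y : A) (hd : IsSelfAdjoint d) (hy : 0 ≤ y) :
    α d * y * α d = α (d * L y * d) := by
  have hd' : IsSelfAdjoint (α d) := hd.map α
  have hmem : α d * y * α d ∈ Set.range α := by
    refine h.hereditary _ (α ((‖y‖ : ℂ) • (d * d))) ?_ ?_ ⟨_, rfl⟩
    · have := star_left_conjugate_nonneg hy (α d)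
      rwa [hd'.star_eq] at this
    · have := CStarAlgebra.star_left_conjugate_le_norm_smul (a := α d) (b := y)
        (IsSelfAdjoint.of_nonneg hy)
      rw [hd'.star_eq] at this
      rw [map_smul, map_mul, Complex.coe_smul]
      exact this
  rw [← h.condExp.eq_self _ hmem, h.condExp.mul_right _ ⟨d, rfl⟩, h.condExp.mul_left _ ⟨d, rfl⟩]
  simp

theorem cauchy_left (h : IsCornerSystem α L) (x : A) :
    Cauchy (Filter.map (fun e => α e * x) (approximateUnit A)) := by
  have hl := increasingApproximateUnit A
  rw [cauchy_map_iff]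
  refine ⟨hl.neBot, ?_⟩
  rw [Metric.uniformity_basis_dist.tendsto_right_iff]
  intro ε hε
  have ht : Tendsto (fun e => e * L (x * star x)) (approximateUnit A) (𝓝 (L (x * star x))) :=
    hl.tendsto_mul_right _
  have hδ : 0 < ε ^ 2 / 4 := by positivity
  have hev : ∀ᶠ e in approximateUnit A, IsSelfAdjoint e ∧ ‖e‖ ≤ 1 ∧
      dist (e * L (x * star x)) (L (x * star x)) < ε ^ 2 / 4 :=
    hl.eventually_isSelfAdjoint.and (hl.eventually_norm.and (Metric.tendsto_nhds.1 ht _ hδ))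
  filter_upwards [hev.prod_mk hev] with ⟨e, f⟩ ⟨⟨he1, he2, he3⟩, hf1, hf2, hf3⟩
  have hd : IsSelfAdjoint (e - f) := he1.sub hf1
  have hy : 0 ≤ x * star x := mul_star_self_nonneg x
  have key : ‖α e * x - α f * x‖ ^ 2 = ‖α ((e - f) * L (x * star x) * (e - f))‖ := by
    rw [← h.conj_nonneg _ _ hd hy, sq, ← CStarRing.norm_self_mul_star, star_sub, star_mul, star_mul,
      ← map_star, ← map_star, he1.star_eq, hf1.star_eq, map_sub]
    congr 1
    noncomm_ring
  have h1 : ‖α ((e - f) * L (x * star x) * (e - f))‖ < ε ^ 2 := by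
    refine (NonUnitalStarAlgHom.norm_apply_le α _).trans_lt ?_
    refine (norm_mul_le _ _).trans_lt ?_
    have h2 : ‖(e - f) * L (x * star x)‖ < ε ^ 2 / 2 := by
      rw [sub_mul, ← dist_eq_norm]
      calc _ ≤ _ := dist_triangle_right _ _ (L (x * star x))
        _ < ε ^ 2 / 4 + ε ^ 2 / 4 := add_lt_add he3 hf3
        _ = _ := by ring
    have h3 : ‖e - f‖ ≤ 2 := (norm_sub_le _ _).trans (by linarith)
    nlinarith [norm_nonneg ((e - f) * L (x * star x)), norm_nonneg (e - f)]
  rw [dist_eq_norm]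
  rw [← key] at h1
  exact lt_of_pow_lt_pow_left₀ 2 hε.le h1

/-- `lim α(e) x` along the approximate unit. -/
theorem exists_left (h : IsCornerSystem α L) (x : A) :
    ∃ y, Tendsto (fun e => α e * x) (approximateUnit A) (𝓝 y) :=
  cauchy_map_iff_exists_tendsto.1 (h.cauchy_left x)

theorem exists_right (h : IsCornerSystem α L) (x : A) :
    ∃ y, Tendsto (fun e => x * α e) (approximateUnit A) (𝓝 y) := by
  obtain ⟨y, hy⟩ := h.exists_left (star x)
  refine ⟨star y, ((continuous_star.tendsto _).comp hy).congr' ?_⟩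
  filter_upwards [(increasingApproximateUnit A).eventually_star_eq] with e he
  simp [← map_star, he]

end IsCornerSystem

/-- `p` is the strict limit of `α(e)`, where `e` runs through the approximate unit of `A`; that is,
`p` is the value at `1` of the strictly continuous extension of `α` to the multiplier algebra. -/
def IsStrictImageOne (α : A →⋆ₙₐ[ℂ] A) (p : DoubleCentralizer ℂ A) : Prop :=
  (∀ x, Tendsto (fun e => α e * x) (approximateUnit A) (𝓝 (p.fst x))) ∧
  ∀ x, Tendsto (fun e => x * α e) (approximateUnit A) (𝓝 (p.snd x))

theorem IsCornerSystem.exists_isStrictImageOne {α : A →⋆ₙₐ[ℂ] A} {L : A →ₚ[ℂ] A}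
    (h : IsCornerSystem α L) : ∃ p, IsStrictImageOne α p := by
  have hl := increasingApproximateUnit A
  choose f hf using h.exists_left
  choose g hg using h.exists_right
  have hne := hl.neBot
  have hfl : ∀ x, ‖f x‖ ≤ 1 * ‖x‖ := fun x => by
    refine le_of_tendsto (hf x).norm ?_
    filter_upwards [hl.eventually_norm] with e he
    exact (norm_mul_le _ _).trans (mul_le_mul_of_nonneg_right
      ((NonUnitalStarAlgHom.norm_apply_le α e).trans he) (norm_nonneg x))
  have hgl : ∀ x, ‖g x‖ ≤ 1 * ‖x‖ := fun x => by
    refine le_of_tendsto (hg x).norm ?_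
    filter_upwards [hl.eventually_norm] with e he
    rw [one_mul]
    exact (norm_mul_le _ _).trans (mul_le_of_le_one_right (norm_nonneg x)
      ((NonUnitalStarAlgHom.norm_apply_le α e).trans he))
  let F : A →L[ℂ] A := LinearMap.mkContinuous
    { toFun := f
      map_add' := fun x y => tendsto_nhds_unique (hf (x + y)) (by
        simpa only [mul_add] using (hf x).add (hf y))
      map_smul' := fun c x => tendsto_nhds_unique (hf (c • x)) (by
        simpa only [mul_smul_comm, RingHom.id_apply] using (hf x).const_smul c) } 1 hfl
  let G : A →L[ℂ] A := LinearMap.mkContinuous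
    { toFun := g
      map_add' := fun x y => tendsto_nhds_unique (hg (x + y)) (by
        simpa only [add_mul] using (hg x).add (hg y))
      map_smul' := fun c x => tendsto_nhds_unique (hg (c • x)) (by
        simpa only [smul_mul_assoc, RingHom.id_apply] using (hg x).const_smul c) } 1 hgl
  refine ⟨⟨(F, G), fun x y => ?_⟩, hf, hg⟩
  refine tendsto_nhds_unique ((hg x).mul_const y) ?_
  simp only [mul_assoc]
  exact (hf y).const_mul x

end Projection

namespace CornerSystem

open CStarAlgebra

variable {G : Type*} [AddCommGroup G] [LinearOrder G] [IsOrderedAddMonoid G]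
  {A : Type*} [NonUnitalCStarAlgebra A] [PartialOrder A] [StarOrderedRing A]
  (S : CornerSystem G A)

/-- The projection `ᾱ_t(1)` of the multiplier algebra of `A`. -/
def proj (t : PosCone G) : DoubleCentralizer ℂ A := (S.corner t).exists_isStrictImageOne.choose

theorem proj_spec (t : PosCone G) : IsStrictImageOne (S.α t) (S.proj t) :=
  (S.corner t).exists_isStrictImageOne.choose_spec

/-- The positive part of an element of `G`; it is the element itself if `0 ≤ g`. -/
def pos (g : G) : PosCone G := ⟨g ⊔ 0, le_sup_right⟩

theorem pos_add {g h : G} (hg : 0 ≤ g) (hh : 0 ≤ h) : pos (g + h) = pos g + pos h := by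
  apply Subtype.ext
  simp [pos, hg, hh, add_nonneg hg hh]

theorem pos_zero : pos (0 : G) = 0 := Subtype.ext (by simp [pos])

theorem pos_coe (t : PosCone G) : pos (t : G) = t := Subtype.ext (sup_eq_left.2 t.2)

/-! Elementary rules. -/

theorem proj_mul (t : PosCone G) (x y : A) :
    (S.proj t).fst (x * y) = (S.proj t).fst x * y := by
  refine tendsto_nhds_unique ((S.proj_spec t).1 (x * y)) ?_
  simpa only [mul_assoc] using ((S.proj_spec t).1 x).mul_const y

theorem mul_proj (t : PosCone G) (x y : A) :
    (S.proj t).snd (x * y) = x * (S.proj t).snd y := by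
  refine tendsto_nhds_unique ((S.proj_spec t).2 (x * y)) ?_
  simp only [mul_assoc]
  exact ((S.proj_spec t).2 y).const_mul x

theorem mul_proj_mul (t : PosCone G) (x y : A) :
    (S.proj t).snd x * y = x * (S.proj t).fst y := (S.proj t).central x y

theorem proj_proj (t : PosCone G) (x : A) :
    (S.proj t).fst ((S.proj t).snd x) = (S.proj t).snd ((S.proj t).fst x) := by
  refine tendsto_nhds_unique ((S.proj_spec t).1 _) ?_
  simp only [← mul_proj]
  exact ((S.proj t).snd.continuous.tendsto _).comp ((S.proj_spec t).1 x)

theorem continuous_α (t : PosCone G) : Continuous (S.α t) := map_continuous (S.α t)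
theorem continuous_L (t : PosCone G) : Continuous (S.L t) := map_continuous (S.L t)

theorem proj_α (t : PosCone G) (x : A) : (S.proj t).fst (S.α t x) = S.α t x := by
  refine tendsto_nhds_unique ((S.proj_spec t).1 _) ?_
  simp only [← map_mul]
  exact ((S.continuous_α t).tendsto _).comp ((increasingApproximateUnit A).tendsto_mul_right x)

theorem α_proj (t : PosCone G) (x : A) : (S.proj t).snd (S.α t x) = S.α t x := by
  refine tendsto_nhds_unique ((S.proj_spec t).2 _) ?_
  simp only [← map_mul]
  exact ((S.continuous_α t).tendsto _).comp ((increasingApproximateUnit A).tendsto_mul_left x)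

theorem star_proj (t : PosCone G) (x : A) :
    star ((S.proj t).fst x) = (S.proj t).snd (star x) := by
  refine tendsto_nhds_unique ((continuous_star.tendsto _).comp ((S.proj_spec t).1 x))
    (((S.proj_spec t).2 (star x)).congr' ?_)
  filter_upwards [(increasingApproximateUnit A).eventually_star_eq] with e he
  simp [← map_star, he]

theorem proj_add_α (s t : PosCone G) (x : A) :
    (S.proj (s + t)).fst (S.α s x) = S.α s ((S.proj t).fst x) := by
  refine tendsto_nhds_unique ((S.proj_spec (s + t)).1 _) ?_
  simp only [S.α_add, ← map_mul]
  exact ((S.continuous_α s).tendsto _).comp ((S.proj_spec t).1 x)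

theorem α_proj_add (s t : PosCone G) (x : A) :
    (S.proj (s + t)).snd (S.α s x) = S.α s ((S.proj t).snd x) := by
  refine tendsto_nhds_unique ((S.proj_spec (s + t)).2 _) ?_
  simp only [S.α_add, ← map_mul]
  exact ((S.continuous_α s).tendsto _).comp ((S.proj_spec t).2 x)

theorem L_proj_add (s t : PosCone G) (x : A) :
    S.L s ((S.proj (s + t)).fst x) = (S.proj t).fst (S.L s x) := by
  refine tendsto_nhds_unique (((S.continuous_L s).tendsto _).comp ((S.proj_spec (s + t)).1 x)) ?_
  simp only [Function.comp_def, S.α_add, (S.corner s).exel _ _]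
  exact (S.proj_spec t).1 _

theorem L_proj_add' (s t : PosCone G) (x : A) :
    S.L s ((S.proj (s + t)).snd x) = (S.proj t).snd (S.L s x) := by
  refine tendsto_nhds_unique (((S.continuous_L s).tendsto _).comp ((S.proj_spec (s + t)).2 x)) ?_
  simp only [Function.comp_def, S.α_add, (S.corner s).exel_right _ _]
  exact (S.proj_spec t).2 _

theorem α_L (t : PosCone G) (x : A) :
    S.α t (S.L t x) = (S.proj t).fst ((S.proj t).snd x) := by
  have hl := increasingApproximateUnit A
  have hne := hl.neBot
  -- it suffices to consider positive elements
  suffices H : ∀ x, 0 ≤ x → S.α t (S.L t x) = (S.proj t).fst ((S.proj t).snd x) by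
    obtain ⟨y, hy, -, h⟩ := CStarAlgebra.exists_sum_four_nonneg x
    rw [h]
    simp only [map_sum, map_smul]
    exact Finset.sum_congr rfl fun i _ => by rw [H _ (hy i)]
  intro x hx
  have h1 : Tendsto (fun e => S.α t e * x * S.α t e) (approximateUnit A)
      (𝓝 (S.α t (S.L t x))) := by
    have : Tendsto (fun e => S.α t (e * S.L t x * e)) (approximateUnit A)
        (𝓝 (S.α t (S.L t x))) := by
      refine ((S.continuous_α t).tendsto _).comp ?_
      rw [← tendsto_sub_nhds_zero_iff]
      have e1 : Tendsto (fun e => ‖e * S.L t x - S.L t x‖ + ‖S.L t x * e - S.L t x‖)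
          (approximateUnit A) (𝓝 0) := by
        simpa using (tendsto_sub_nhds_zero_iff.2 (hl.tendsto_mul_right (S.L t x))).norm.add
          (tendsto_sub_nhds_zero_iff.2 (hl.tendsto_mul_left (S.L t x))).norm
      refine squeeze_zero_norm' ?_ e1
      filter_upwards [hl.eventually_norm] with e he
      have : e * S.L t x * e - S.L t x
          = (e * S.L t x - S.L t x) * e + (S.L t x * e - S.L t x) := by noncomm_ring
      rw [this]
      refine (norm_add_le _ _).trans (add_le_add_left ((norm_mul_le _ _).trans ?_) _)
      exact mul_le_of_le_one_right (norm_nonneg _) he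
    refine this.congr' ?_
    filter_upwards [hl.eventually_isSelfAdjoint] with e he
    exact ((S.corner t).conj_nonneg e x he hx).symm
  refine tendsto_nhds_unique h1 ?_
  rw [proj_proj, ← tendsto_sub_nhds_zero_iff]
  have e1 : Tendsto (fun e => ‖S.α t e * x - (S.proj t).fst x‖ +
      ‖(S.proj t).fst x * S.α t e - (S.proj t).snd ((S.proj t).fst x)‖)
      (approximateUnit A) (𝓝 0) := by
    simpa using (tendsto_sub_nhds_zero_iff.2 ((S.proj_spec t).1 x)).norm.add
      (tendsto_sub_nhds_zero_iff.2 ((S.proj_spec t).2 ((S.proj t).fst x))).norm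
  refine squeeze_zero_norm' ?_ e1
  filter_upwards [hl.eventually_norm] with e he
  have : S.α t e * x * S.α t e - (S.proj t).snd ((S.proj t).fst x)
      = (S.α t e * x - (S.proj t).fst x) * S.α t e
        + ((S.proj t).fst x * S.α t e - (S.proj t).snd ((S.proj t).fst x)) := by noncomm_ring
  rw [this]
  refine (norm_add_le _ _).trans (add_le_add_left ((norm_mul_le _ _).trans ?_) _)
  exact mul_le_of_le_one_right (norm_nonneg _) ((NonUnitalStarAlgHom.norm_apply_le _ e).trans he)

theorem proj_idem (t : PosCone G) (x : A) :
    (S.proj t).fst ((S.proj t).fst x) = (S.proj t).fst x := by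
  refine tendsto_nhds_unique ((S.proj_spec t).1 _) ?_
  simp only [← mul_proj_mul, α_proj]
  exact (S.proj_spec t).1 x

theorem proj_idem' (t : PosCone G) (x : A) :
    (S.proj t).snd ((S.proj t).snd x) = (S.proj t).snd x := by
  refine tendsto_nhds_unique ((S.proj_spec t).2 _) ?_
  simp only [mul_proj_mul, proj_α]
  exact (S.proj_spec t).2 x

end CornerSystem

namespace CornerSystem

open CStarAlgebra

variable {G : Type*} [AddCommGroup G] [LinearOrder G] [IsOrderedAddMonoid G]
  {A : Type*} [NonUnitalCStarAlgebra A] [PartialOrder A] [StarOrderedRing A]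
  (S : CornerSystem G A)

/-- The fibres of the Fell bundle of the corner system: `B_g` is `A ᾱ_g(1)` if `0 ≤ g`, and
`ᾱ_{-g}(1) A` if `g < 0`. -/
def fiber (g : G) : Submodule ℂ A :=
  if 0 ≤ g then LinearMap.range ((S.proj (pos g)).snd : A →ₗ[ℂ] A)
  else LinearMap.range ((S.proj (pos (-g))).fst : A →ₗ[ℂ] A)

/-- The multiplication `B_g × B_h → B_{g+h}` of the Fell bundle. -/
def mulFun (g h : G) (a b : A) : A :=
  if 0 ≤ g then
    if 0 ≤ h then a * S.α (pos g) b
    else if 0 ≤ g + h then a * S.α (pos (g + h)) b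
    else S.α (pos (-(g + h))) a * b
  else
    if 0 ≤ h then
      if 0 ≤ g + h then S.L (pos (-g)) (a * b)
      else S.L (pos h) (a * b)
    else S.α (pos (-h)) a * b

theorem mem_fiber_of_nonneg {g : G} (hg : 0 ≤ g) {a : A} :
    a ∈ S.fiber g ↔ (S.proj (pos g)).snd a = a := by
  rw [fiber, if_pos hg]
  constructor
  · rintro ⟨x, rfl⟩; exact S.proj_idem' _ x
  · intro h; exact ⟨a, h⟩

theorem mem_fiber_of_neg {g : G} (hg : ¬ 0 ≤ g) {a : A} :
    a ∈ S.fiber g ↔ (S.proj (pos (-g))).fst a = a := by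
  rw [fiber, if_neg hg]
  constructor
  · rintro ⟨x, rfl⟩; exact S.proj_idem _ x
  · intro h; exact ⟨a, h⟩

theorem proj_zero (a : A) : (S.proj 0).fst a = a := by
  have := S.proj_α 0 a
  rwa [S.α_zero] at this

theorem proj_zero' (a : A) : (S.proj 0).snd a = a := by
  have := S.α_proj 0 a
  rwa [S.α_zero] at this

theorem mem_fiber_zero (a : A) : a ∈ S.fiber 0 := by
  rw [S.mem_fiber_of_nonneg le_rfl, pos_zero]; exact S.proj_zero' a

theorem Pl_mono {s t : PosCone G} {x : A} (h : (S.proj (s + t)).fst x = x) :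
    (S.proj s).fst x = x := by
  rw [← h]
  refine tendsto_nhds_unique
    (((S.proj s).fst.continuous.tendsto _).comp ((S.proj_spec (s + t)).1 x)) ?_
  simp only [Function.comp_def, proj_mul, S.α_add, proj_α]
  simp only [← S.α_add]
  exact (S.proj_spec (s + t)).1 x

theorem Pr_mono {s t : PosCone G} {x : A} (h : (S.proj (s + t)).snd x = x) :
    (S.proj s).snd x = x := by
  rw [← h]
  refine tendsto_nhds_unique
    (((S.proj s).snd.continuous.tendsto _).comp ((S.proj_spec (s + t)).2 x)) ?_
  simp only [Function.comp_def, mul_proj, S.α_add, α_proj]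
  simp only [← S.α_add]
  exact (S.proj_spec (s + t)).2 x

theorem α_pos_add {g h : G} (hg : 0 ≤ g) (hh : 0 ≤ h) (x : A) :
    S.α (pos (g + h)) x = S.α (pos g) (S.α (pos h) x) := by rw [pos_add hg hh, S.α_add]

theorem α_pos_zero (x : A) : S.α (pos (0 : G)) x = x := by rw [pos_zero, S.α_zero]

theorem L_pos_add {g h : G} (hg : 0 ≤ g) (hh : 0 ≤ h) (x : A) :
    S.L (pos (g + h)) x = S.L (pos g) (S.L (pos h) x) := by rw [pos_add hg hh, S.L_add]

theorem L_pos_zero (x : A) : S.L (pos (0 : G)) x = x := by rw [pos_zero, S.L_zero]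

/-! To verify associativity we use formal triples `(s, a, t)`, to be thought of as `u_s^* a u_t`. -/

/-- The formal product of triples. -/
def tmul (X Y : G × A × G) : G × A × G :=
  if Y.1 ≤ X.2.2 then
    (X.1, X.2.1 * S.α (pos (X.2.2 - Y.1)) Y.2.1, X.2.2 - Y.1 + Y.2.2)
  else (X.1 + (Y.1 - X.2.2), S.α (pos (Y.1 - X.2.2)) X.2.1 * Y.2.1, Y.2.2)

/-- The reduced form of a triple. -/
def tred (X : G × A × G) : G × A × G :=
  (X.1 - min X.1 X.2.2, S.L (pos (min X.1 X.2.2)) X.2.1, X.2.2 - min X.1 X.2.2)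

/-- The triple of an element of a fibre. -/
def tri (g : G) (a : A) : G × A × G := (-g ⊔ 0, a, g ⊔ 0)

/-- The adjoint triple. -/
def tstar (X : G × A × G) : G × A × G := (X.2.2, star X.2.1, X.1)

/-- The triples that occur. -/
structure Good (X : G × A × G) : Prop where
  left_nonneg : 0 ≤ X.1
  right_nonneg : 0 ≤ X.2.2
  left : (S.proj (pos X.1)).fst X.2.1 = X.2.1
  right : (S.proj (pos X.2.2)).snd X.2.1 = X.2.1

theorem good_tri {g : G} {a : A} (ha : a ∈ S.fiber g) : S.Good (tri g a) := by
  refine ⟨le_sup_right, le_sup_right, ?_, ?_⟩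
  · change (S.proj (pos (-g ⊔ 0))).fst a = a
    by_cases hg : 0 ≤ g
    · rw [sup_eq_right.2 (by simpa using hg), pos_zero, proj_zero]
    · rw [S.mem_fiber_of_neg hg] at ha
      rw [sup_eq_left.2 (by simpa using (not_le.1 hg).le), ha]
  · change (S.proj (pos (g ⊔ 0))).snd a = a
    by_cases hg : 0 ≤ g
    · rw [S.mem_fiber_of_nonneg hg] at ha
      rw [sup_eq_left.2 hg, ha]
    · rw [sup_eq_right.2 (not_le.1 hg).le, pos_zero, proj_zero']

theorem tri_of_nonneg {g : G} (hg : 0 ≤ g) (a : A) : tri g a = (0, a, g) := by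
  rw [tri, sup_eq_left.2 hg, sup_eq_right.2 (neg_nonpos.2 hg)]

theorem tri_of_nonpos {g : G} (hg : g ≤ 0) (a : A) : tri g a = (-g, a, 0) := by
  rw [tri, sup_eq_right.2 hg, sup_eq_left.2 (neg_nonneg.2 hg)]

theorem tri_injective {g : G} {a b : A} (h : tri g a = tri g b) : a = b :=
  congrArg (fun X : G × A × G => X.2.1) h

theorem tred_zero_left {t : G} (ht : 0 ≤ t) (a : A) : S.tred (0, a, t) = (0, a, t) := by
  simp [tred, min_eq_left ht, pos_zero, S.L_zero]

theorem tred_zero_right {s : G} (hs : 0 ≤ s) (a : A) : S.tred (s, a, 0) = (s, a, 0) := by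
  simp [tred, min_eq_right hs, pos_zero, S.L_zero]

theorem tred_add {s t m : G} (hs : 0 ≤ s) (ht : 0 ≤ t) (hm : 0 ≤ m) (a : A) :
    S.tred (s + m, a, t + m) = S.tred (s, S.L (pos m) a, t) := by
  have h : min (s + m) (t + m) = min s t + m := (min_add_add_right s t m)
  simp only [tred, h, add_sub_add_right_eq_sub, S.L_pos_add (le_min hs ht) hm]

theorem tmul_of_le {s t s' t' : G} (h : s' ≤ t) (a b : A) :
    S.tmul (s, a, t) (s', b, t') = (s, a * S.α (pos (t - s')) b, t - s' + t') := if_pos h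

theorem tmul_of_ge {s t s' t' : G} (h : t ≤ s') (a b : A) :
    S.tmul (s, a, t) (s', b, t') = (s + (s' - t), S.α (pos (s' - t)) a * b, t') := by
  rcases h.eq_or_lt with rfl | h
  · rw [tmul_of_le S le_rfl]
    simp [pos_zero, S.α_zero]
  · exact if_neg (not_le.2 h)

theorem tred_tmul_tri (g h : G) (a b : A) :
    S.tred (S.tmul (tri g a) (tri h b)) = tri (g + h) (S.mulFun g h a b) := by
  rcases le_or_gt 0 g with hg | hg <;> rcases le_or_gt 0 h with hh | hh
  · rw [tri_of_nonneg hg, tri_of_nonneg hh, tmul_of_le S hg, tri_of_nonneg (add_nonneg hg hh),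
      mulFun, if_pos hg, if_pos hh, sub_zero, tred_zero_left S (add_nonneg hg hh)]
  · rw [tri_of_nonneg hg, tri_of_nonpos hh.le, mulFun, if_pos hg, if_neg (not_le.2 hh)]
    rcases le_or_gt 0 (g + h) with hk | hk
    · rw [tmul_of_le S (by rwa [← sub_nonneg, sub_neg_eq_add]), if_pos hk, tri_of_nonneg hk,
        sub_neg_eq_add, add_zero, tred_zero_left S hk]
    · have e : -h - g = -(g + h) := by abel
      rw [tmul_of_ge S (by rw [← sub_nonneg, e]; exact neg_nonneg.2 hk.le), if_neg (not_le.2 hk),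
        tri_of_nonpos hk.le, e, zero_add, tred_zero_right S (neg_nonneg.2 hk.le)]
  · rw [tri_of_nonpos hg.le, tri_of_nonneg hh, mulFun, if_neg (not_le.2 hg), if_pos hh,
      tmul_of_le S le_rfl, sub_zero, zero_add, pos_zero, S.α_zero]
    rcases le_or_gt 0 (g + h) with hk | hk
    · have e : S.tred (-g, a * b, h) = S.tred (0 + -g, a * b, g + h + -g) := by
        congr 2 <;> [skip; congr 1] <;> abel
      rw [e, S.tred_add le_rfl hk (neg_nonneg.2 hg.le), if_pos hk, tri_of_nonneg hk,
        tred_zero_left S hk]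
    · have hk' : 0 ≤ -(g + h) := neg_nonneg.2 hk.le
      have e : S.tred (-g, a * b, h) = S.tred (-(g + h) + h, a * b, 0 + h) := by
        congr 2 <;> [skip; congr 1] <;> abel
      rw [e, S.tred_add hk' le_rfl hh, if_neg (not_le.2 hk), tri_of_nonpos hk.le,
        tred_zero_right S hk']
  · have hk : g + h < 0 := add_neg hg hh
    have hh' : 0 ≤ -h := neg_nonneg.2 hh.le
    rw [tri_of_nonpos hg.le, tri_of_nonpos hh.le, mulFun, if_neg (not_le.2 hg),
      if_neg (not_le.2 hh), tmul_of_ge S hh', tri_of_nonpos hk.le, sub_zero,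
      tred_zero_right S (add_nonneg (neg_nonneg.2 hg.le) hh')]
    congr 1
    abel

theorem tmul_assoc {X Y Z : G × A × G} (hX : S.Good X) (hY : S.Good Y) (hZ : S.Good Z) :
    S.tmul (S.tmul X Y) Z = S.tmul X (S.tmul Y Z) := by
  obtain ⟨s, a, t⟩ := X
  obtain ⟨s', b, t'⟩ := Y
  obtain ⟨s'', c, t''⟩ := Z
  have ht' : 0 ≤ t' := hY.right_nonneg
  have hs' : 0 ≤ s' := hY.left_nonneg
  rcases le_total s' t with h1 | h1 <;> rcases le_total s'' t' with h2 | h2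
  · have h1' := sub_nonneg.2 h1
    have h2' := sub_nonneg.2 h2
    rw [tmul_of_le S h1, tmul_of_le S h2, tmul_of_le S h1,
      tmul_of_le S (h2.trans (le_add_of_nonneg_left h1')), map_mul, mul_assoc, add_sub_assoc,
      α_pos_add S h1' h2', add_assoc]
  · rw [tmul_of_le S h1, tmul_of_ge S h2]
    have h1' := sub_nonneg.2 h1
    have h2' := sub_nonneg.2 h2
    rcases le_total s'' (t - s' + t') with h3 | h3
    · have h4 : s' + (s'' - t') ≤ t := by
        have := sub_nonneg.2 h3
        rw [← sub_nonneg]; convert this using 1; abel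
      have e1 : t - s' = (t - (s' + (s'' - t'))) + (s'' - t') := by abel
      have e2 : t - s' + t' - s'' = t - (s' + (s'' - t')) := by abel
      rw [tmul_of_le S h3, tmul_of_le S h4, e2, map_mul, ← α_pos_add S (sub_nonneg.2 h4) h2', ← e1,
        mul_assoc]
    · have h4 : t ≤ s' + (s'' - t') := by
        have := sub_nonneg.2 h3
        rw [← sub_nonneg]; convert this using 1; abel
      have e1 : s'' - t' = (s' + (s'' - t') - t) + (t - s') := by abel
      have e2 : s'' - (t - s' + t') = s' + (s'' - t') - t := by abel
      rw [tmul_of_ge S h3, tmul_of_ge S h4, e2, map_mul,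
        ← α_pos_add S (sub_nonneg.2 h4) h1', ← e1, mul_assoc]
  · rw [tmul_of_ge S h1, tmul_of_le S h2, tmul_of_le S h2, tmul_of_ge S h1, mul_assoc]
  · have h1' := sub_nonneg.2 h1
    have h2' := sub_nonneg.2 h2
    have h3 : t ≤ s' + (s'' - t') := h1.trans (le_add_of_nonneg_right h2')
    have e : s' + (s'' - t') - t = (s'' - t') + (s' - t) := by abel
    rw [tmul_of_ge S h1, tmul_of_ge S h2, tmul_of_ge S h2, tmul_of_ge S h3, e, map_mul, mul_assoc,
      α_pos_add S h2' h1', add_comm (s'' - t'), add_assoc]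

theorem good_tmul {X Y : G × A × G} (hX : S.Good X) (hY : S.Good Y) : S.Good (S.tmul X Y) := by
  obtain ⟨s, a, t⟩ := X
  obtain ⟨s', b, t'⟩ := Y
  obtain ⟨hs, ht, hl, hr⟩ := hX
  obtain ⟨hs', ht', hl', hr'⟩ := hY
  simp only at *
  rcases le_total s' t with h1 | h1
  · have h1' := sub_nonneg.2 h1
    rw [tmul_of_le S h1]
    refine ⟨hs, add_nonneg h1' ht', ?_, ?_⟩
    · simp only [proj_mul, hl]
    · simp only [mul_proj, pos_add h1' ht', α_proj_add, hr']
  · have h1' := sub_nonneg.2 h1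
    rw [tmul_of_ge S h1]
    refine ⟨add_nonneg hs h1', ht', ?_, ?_⟩
    · simp only [proj_mul, add_comm s, pos_add h1' hs, proj_add_α, hl]
    · simp only [mul_proj, hr']

theorem tred_tmul_tred {X Y : G × A × G} (hX : S.Good X) (hY : S.Good Y) :
    S.tred (S.tmul (S.tred X) Y) = S.tred (S.tmul X Y) := by
  obtain ⟨s, a, t⟩ := X
  obtain ⟨s', b, t'⟩ := Y
  obtain ⟨hs, ht, hl, hr⟩ := hX
  obtain ⟨hs', ht', hl', hr'⟩ := hY
  have key : ∃ m s0 t0 : G, 0 ≤ m ∧ 0 ≤ s0 ∧ 0 ≤ t0 ∧ s = s0 + m ∧ t = t0 + m ∧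
      S.tred (s, a, t) = (s0, S.L (pos m) a, t0) :=
    ⟨min s t, s - min s t, t - min s t, le_min hs ht, sub_nonneg.2 (min_le_left _ _),
      sub_nonneg.2 (min_le_right _ _), by abel, by abel, rfl⟩
  obtain ⟨m, s0, t0, hm0, hs0, ht0, rfl, rfl, e0⟩ := key
  rw [e0]
  simp only at *
  rcases le_total s' t0 with h1 | h1
  · have h1' := sub_nonneg.2 h1
    have e : t0 + m - s' = m + (t0 - s') := by abel
    have e' : m + (t0 - s') + t' = (t0 - s' + t') + m := by abel
    rw [tmul_of_le S h1, tmul_of_le S (h1.trans (le_add_of_nonneg_right hm0)), e, e',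
      S.tred_add hs0 (add_nonneg h1' ht') hm0, α_pos_add S hm0 h1', (S.corner _).exel_right]
  · rw [tmul_of_ge S h1]
    have h1' := sub_nonneg.2 h1
    rcases le_total s' (t0 + m) with h2 | h2
    · have h2' := sub_nonneg.2 h2
      obtain ⟨q, rfl⟩ : ∃ q, s' = t0 + q := ⟨s' - t0, by abel⟩
      obtain ⟨r, rfl⟩ : ∃ r, m = q + r := ⟨m - q, by abel⟩
      have e1 : t0 + (q + r) - (t0 + q) = r := by abel
      have e2 : t0 + q - t0 = q := by abel
      rw [e1] at h2'
      rw [e2] at h1'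
      rw [tmul_of_le S h2, e1, e2, ← add_assoc s0, add_comm r t',
        S.tred_add (add_nonneg hs0 h1') ht' h2', (S.corner _).exel_right, L_pos_add S h1' h2',
        α_L]
      have p1 : (S.proj (pos q)).fst (S.L (pos r) a) = S.L (pos r) a := by
        have e3 : s0 + (q + r) = r + (q + s0) := by abel
        rw [e3, pos_add h2' (add_nonneg h1' hs0)] at hl
        have := S.L_proj_add (pos r) (pos (q + s0)) a
        rw [hl, pos_add h1' hs0] at this
        exact S.Pl_mono this.symm
      have p2 : (S.proj (pos q)).fst b = b := by
        rw [add_comm t0, pos_add h1' ht0] at hl'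
        exact S.Pl_mono hl'
      rw [proj_proj, p1, mul_proj_mul, p2]
    · have h2' := sub_nonneg.2 h2
      obtain ⟨r, rfl⟩ : ∃ r, s' = t0 + m + r := ⟨s' - (t0 + m), by abel⟩
      have e1 : t0 + m + r - (t0 + m) = r := by abel
      have e2 : t0 + m + r - t0 = r + m := by abel
      rw [e1] at h2'
      rw [tmul_of_ge S h2, e1, e2, α_pos_add S h2' hm0, α_L]
      have p1 : (S.proj (pos m)).fst a = a := by
        rw [add_comm s0, pos_add hm0 hs0] at hl
        exact S.Pl_mono hl
      have p2 : (S.proj (pos r + pos m)).fst b = b := by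
        rw [add_assoc t0, add_comm t0, add_comm m, pos_add (add_nonneg h2' hm0) ht0,
          pos_add h2' hm0] at hl'
        exact S.Pl_mono hl'
      rw [proj_proj, p1, ← α_proj_add, mul_proj_mul, p2, add_comm r m, add_assoc]

theorem tstar_tri (g : G) (a : A) : tstar (tri g a) = tri (-g) (star a) := by
  simp [tstar, tri]

theorem tstar_tmul (X Y : G × A × G) : tstar (S.tmul X Y) = S.tmul (tstar Y) (tstar X) := by
  obtain ⟨s, a, t⟩ := X
  obtain ⟨s', b, t'⟩ := Y
  rcases le_total s' t with h1 | h1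
  · rw [tmul_of_le S h1]
    simp only [tstar]
    rw [tmul_of_ge S h1, star_mul, map_star, add_comm]
  · rw [tmul_of_ge S h1]
    simp only [tstar]
    rw [tmul_of_le S h1, star_mul, map_star, add_comm]

theorem tstar_tred (X : G × A × G) : tstar (S.tred X) = S.tred (tstar X) := by
  simp only [tstar, tred, min_comm X.1, PositiveLinearMap.map_star_of_cstar]

theorem good_tstar {X : G × A × G} (hX : S.Good X) : S.Good (tstar X) := by
  refine ⟨hX.2, hX.1, ?_, ?_⟩
  · simp only [tstar]
    rw [← star_inj, star_proj, star_star, hX.right]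
  · simp only [tstar]
    rw [← star_proj, hX.left]

theorem tstar_injective : Function.Injective (tstar (G := G) (A := A)) := fun X Y h => by
  have := congrArg tstar h
  simpa [tstar] using this

theorem tred_tmul_tred' {X Y : G × A × G} (hX : S.Good X) (hY : S.Good Y) :
    S.tred (S.tmul X (S.tred Y)) = S.tred (S.tmul X Y) := by
  apply tstar_injective
  rw [tstar_tred, tstar_tred, tstar_tmul, tstar_tmul, tstar_tred,
    S.tred_tmul_tred (S.good_tstar hY) (S.good_tstar hX)]

theorem good_tred {X : G × A × G} (hX : S.Good X) : S.Good (S.tred X) := by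
  obtain ⟨s, a, t⟩ := X
  obtain ⟨hs, ht, hl, hr⟩ := hX
  simp only at *
  have hm : 0 ≤ min s t := le_min hs ht
  have hs' : 0 ≤ s - min s t := sub_nonneg.2 (min_le_left _ _)
  have ht' : 0 ≤ t - min s t := sub_nonneg.2 (min_le_right _ _)
  refine ⟨hs', ht', ?_, ?_⟩
  · simp only [tred]
    rw [← L_proj_add, ← pos_add hm hs', add_sub_cancel, hl]
  · simp only [tred]
    rw [← L_proj_add', ← pos_add hm ht', add_sub_cancel, hr]

theorem mem_fiber_of_good {g : G} {a : A} (h : S.Good (tri g a)) : a ∈ S.fiber g := by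
  rcases le_or_gt 0 g with hg | hg
  · have := h.right
    rwa [tri_of_nonneg hg, ← S.mem_fiber_of_nonneg hg] at this
  · have := h.left
    rwa [tri_of_nonpos hg.le, ← S.mem_fiber_of_neg (not_le.2 hg)] at this

/-- The multiplication is well defined. -/
theorem mulFun_mem {g h : G} {a b : A} (ha : a ∈ S.fiber g) (hb : b ∈ S.fiber h) :
    S.mulFun g h a b ∈ S.fiber (g + h) := by
  apply S.mem_fiber_of_good
  rw [← tred_tmul_tri]
  exact S.good_tred (S.good_tmul (S.good_tri ha) (S.good_tri hb))

/-- The involution is well defined. -/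
theorem star_mem_fiber {g : G} {a : A} (ha : a ∈ S.fiber g) : star a ∈ S.fiber (-g) := by
  apply S.mem_fiber_of_good
  rw [← tstar_tri]
  exact S.good_tstar (S.good_tri ha)

/-- The multiplication is associative. -/
theorem mulFun_assoc {g h k : G} {a b c : A} (ha : a ∈ S.fiber g) (hb : b ∈ S.fiber h)
    (hc : c ∈ S.fiber k) :
    S.mulFun (g + h) k (S.mulFun g h a b) c = S.mulFun g (h + k) a (S.mulFun h k b c) := by
  apply tri_injective (g := g + h + k)
  have ga := S.good_tri ha
  have gb := S.good_tri hb
  have gc := S.good_tri hc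
  rw [← tred_tmul_tri, ← tred_tmul_tri, S.tred_tmul_tred (S.good_tmul ga gb) gc,
    S.tmul_assoc ga gb gc, add_assoc, ← tred_tmul_tri, ← tred_tmul_tri,
    S.tred_tmul_tred' ga (S.good_tmul gb gc)]

/-- The involution is antimultiplicative. -/
theorem star_mulFun (g h : G) (a b : A) :
    star (S.mulFun g h a b) = S.mulFun (-h) (-g) (star b) (star a) := by
  apply tri_injective (g := -(g + h))
  rw [← tstar_tri, ← tred_tmul_tri, tstar_tred, tstar_tmul, tstar_tri, tstar_tri, tred_tmul_tri,
    neg_add_rev]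

theorem mulFun_add_left (g h : G) (a a' b : A) :
    S.mulFun g h (a + a') b = S.mulFun g h a b + S.mulFun g h a' b := by
  simp only [mulFun, map_add, add_mul]
  split_ifs <;> rfl

theorem mulFun_add_right (g h : G) (a b b' : A) :
    S.mulFun g h a (b + b') = S.mulFun g h a b + S.mulFun g h a b' := by
  simp only [mulFun, map_add, mul_add]
  split_ifs <;> rfl

theorem mulFun_smul_left (g h : G) (c : ℂ) (a b : A) :
    S.mulFun g h (c • a) b = c • S.mulFun g h a b := by
  simp only [mulFun, map_smul, smul_mul_assoc]
  split_ifs <;> rfl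

theorem mulFun_smul_right (g h : G) (c : ℂ) (a b : A) :
    S.mulFun g h a (c • b) = c • S.mulFun g h a b := by
  simp only [mulFun, map_smul, mul_smul_comm]
  split_ifs <;> rfl

end CornerSystem

namespace CornerSystem

open DirectSum

variable {G : Type*} [AddCommGroup G] [LinearOrder G] [IsOrderedAddMonoid G]
  {A : Type*} [NonUnitalCStarAlgebra A] [PartialOrder A] [StarOrderedRing A]
  (S : CornerSystem G A)

/-- The multiplication of the Fell bundle on its fibres. -/
instance : GNonUnitalNonAssocSemiring (fun g => S.fiber g) where
  mul {g h} a b := ⟨S.mulFun g h a b, S.mulFun_mem a.2 b.2⟩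
  mul_zero {g h} a := Subtype.ext <| by
    have := S.mulFun_add_right g h a 0 0
    simpa using this
  zero_mul {g h} b := Subtype.ext <| by
    have := S.mulFun_add_left g h 0 0 b
    simpa using this
  mul_add a b c := Subtype.ext <| S.mulFun_add_right _ _ _ _ _
  add_mul a b c := Subtype.ext <| S.mulFun_add_left _ _ _ _ _

/-- The `*`-algebra `⨁ B_g` of (finitely supported) sections of the Fell bundle. -/
def SectionAlgebra : Type _ := ⨁ g, S.fiber g

namespace SectionAlgebra

instance : AddCommGroup S.SectionAlgebra := inferInstanceAs (AddCommGroup (⨁ g, S.fiber g))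
instance : Module ℂ S.SectionAlgebra := inferInstanceAs (Module ℂ (⨁ g, S.fiber g))
instance : Mul S.SectionAlgebra := inferInstanceAs (Mul (⨁ g, S.fiber g))

/-- The element `a δ_g`, where `a ∈ B_g`. -/
def δ (g : G) : S.fiber g →ₗ[ℂ] S.SectionAlgebra := DirectSum.lof ℂ G (fun g => S.fiber g) g

@[elab_as_elim]
theorem ind {q : S.SectionAlgebra → Prop} (x : S.SectionAlgebra) (h0 : q 0)
    (h1 : ∀ g a, q (δ S g a)) (h2 : ∀ x y, q x → q y → q (x + y)) : q x :=
  DirectSum.induction_on x h0 h1 h2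

theorem mul_add' (x y z : S.SectionAlgebra) : x * (y + z) = x * y + x * z :=
  mul_add (R := ⨁ g, S.fiber g) x y z

theorem add_mul' (x y z : S.SectionAlgebra) : (x + y) * z = x * z + y * z :=
  add_mul (R := ⨁ g, S.fiber g) x y z

theorem mul_zero' (x : S.SectionAlgebra) : x * 0 = 0 := mul_zero (M₀ := ⨁ g, S.fiber g) x

theorem zero_mul' (x : S.SectionAlgebra) : 0 * x = 0 := zero_mul (M₀ := ⨁ g, S.fiber g) x

/-- The multiplication is the one of the Fell bundle. -/
theorem δ_mul_δ {g h : G} (a : S.fiber g) (b : S.fiber h) :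
    δ S g a * δ S h b = δ S (g + h) ⟨S.mulFun g h a b, S.mulFun_mem a.2 b.2⟩ :=
  DirectSum.of_mul_of (A := fun g => S.fiber g) a b

theorem δ_congr {g h : G} (e : g = h) {a b : A} (ha : a ∈ S.fiber g) (hb : b ∈ S.fiber h)
    (hab : a = b) : δ S g ⟨a, ha⟩ = δ S h ⟨b, hb⟩ := by
  subst e; subst hab; rfl

theorem mul_assoc' (x y z : S.SectionAlgebra) : x * y * z = x * (y * z) := by
  induction x using ind with
  | h0 => rw [zero_mul', zero_mul', zero_mul']
  | h2 x x' hx hx' => rw [add_mul', add_mul', add_mul', hx, hx']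
  | h1 g a =>
    induction y using ind with
    | h0 => simp only [mul_zero', zero_mul']
    | h2 y y' hy hy' => rw [add_mul', mul_add', add_mul', mul_add', hy, hy']
    | h1 h b =>
      induction z using ind with
      | h0 => simp only [mul_zero']
      | h2 z z' hz hz' => rw [mul_add', mul_add', mul_add', hz, hz']
      | h1 k c =>
        rw [δ_mul_δ, δ_mul_δ, δ_mul_δ, δ_mul_δ]
        exact δ_congr S (add_assoc g h k) _ _ (S.mulFun_assoc a.2 b.2 c.2)

instance : NonUnitalRing S.SectionAlgebra :=
  { (inferInstance : AddCommGroup S.SectionAlgebra), (inferInstance : Mul S.SectionAlgebra) with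
    zero_mul := zero_mul' S
    mul_zero := mul_zero' S
    mul_assoc := mul_assoc' S
    left_distrib := mul_add' S
    right_distrib := add_mul' S }

/-- The involution as an additive map: it takes `a δ_g` to `a^* δ_{-g}`. -/
def starHom : S.SectionAlgebra →+ S.SectionAlgebra :=
  DirectSum.toAddMonoid fun g =>
    { toFun := fun a => δ S (-g) ⟨star (a : A), S.star_mem_fiber a.2⟩
      map_zero' := by
        rw [← map_zero (δ S (-g))]; congr 1; exact Subtype.ext (star_zero A)
      map_add' := fun a b => by
        rw [← map_add]; congr 1; exact Subtype.ext (star_add _ _) }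

instance : Star S.SectionAlgebra := ⟨starHom S⟩

theorem star_δ {g : G} (a : S.fiber g) :
    star (δ S g a) = δ S (-g) ⟨star (a : A), S.star_mem_fiber a.2⟩ :=
  DirectSum.toAddMonoid_of _ _ _

theorem star_add' (x y : S.SectionAlgebra) : star (x + y) = star x + star y :=
  map_add (starHom S) x y

theorem star_zero' : star (0 : S.SectionAlgebra) = 0 := map_zero (starHom S)

theorem star_star' (x : S.SectionAlgebra) : star (star x) = x := by
  induction x using ind with
  | h0 => rw [star_zero', star_zero']
  | h2 x y hx hy => rw [star_add', star_add', hx, hy]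
  | h1 g a =>
    rw [star_δ, star_δ]
    exact δ_congr S (neg_neg g) _ a.2 (star_star _)

theorem star_mul' (x y : S.SectionAlgebra) : star (x * y) = star y * star x := by
  induction x using ind with
  | h0 => rw [zero_mul, star_zero', mul_zero]
  | h2 x x' hx hx' => rw [add_mul, star_add', star_add', mul_add, hx, hx']
  | h1 g a =>
    induction y using ind with
    | h0 => rw [mul_zero, star_zero', zero_mul]
    | h2 y y' hy hy' => rw [mul_add, star_add', star_add', add_mul, hy, hy']
    | h1 h b =>
      rw [δ_mul_δ, star_δ, star_δ, star_δ, δ_mul_δ]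
      exact δ_congr S (neg_add_rev g h) _ _ (S.star_mulFun g h a b)

instance : StarRing S.SectionAlgebra where
  star_involutive := star_star' S
  star_mul := star_mul' S
  star_add := star_add' S

theorem smul_mul' (c : ℂ) (x y : S.SectionAlgebra) : (c • x) * y = c • (x * y) := by
  induction x using ind with
  | h0 => rw [smul_zero, zero_mul, smul_zero]
  | h2 x x' hx hx' => rw [smul_add, add_mul, add_mul, smul_add, hx, hx']
  | h1 g a =>
    induction y using ind with
    | h0 => rw [mul_zero, mul_zero, smul_zero]
    | h2 y y' hy hy' => rw [mul_add, mul_add, smul_add, hy, hy']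
    | h1 h b =>
      rw [← map_smul, δ_mul_δ, δ_mul_δ, ← map_smul]
      exact δ_congr S rfl _ _ (S.mulFun_smul_left g h c a b)

theorem mul_smul' (c : ℂ) (x y : S.SectionAlgebra) : x * (c • y) = c • (x * y) := by
  induction x using ind with
  | h0 => rw [zero_mul, zero_mul, smul_zero]
  | h2 x x' hx hx' => rw [add_mul, add_mul, smul_add, hx, hx']
  | h1 g a =>
    induction y using ind with
    | h0 => rw [smul_zero, mul_zero, smul_zero]
    | h2 y y' hy hy' => rw [smul_add, mul_add, mul_add, smul_add, hy, hy']
    | h1 h b =>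
      rw [← map_smul, δ_mul_δ, δ_mul_δ, ← map_smul]
      exact δ_congr S rfl _ _ (S.mulFun_smul_right g h c a b)

instance : IsScalarTower ℂ S.SectionAlgebra S.SectionAlgebra := ⟨smul_mul' S⟩
instance : SMulCommClass ℂ S.SectionAlgebra S.SectionAlgebra :=
  ⟨fun c x y => (mul_smul' S c x y).symm⟩

instance : StarModule ℂ S.SectionAlgebra := ⟨fun c x => by
  induction x using ind with
  | h0 => rw [smul_zero, star_zero', smul_zero]
  | h2 x y hx hy => rw [smul_add, star_add', star_add', smul_add, hx, hy]
  | h1 g a =>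
    rw [← map_smul, star_δ, star_δ, ← map_smul]
    exact δ_congr S rfl _ _ (star_smul c (a : A))⟩

/-- The inclusion of `A = B_0`. -/
def incl : A →⋆ₙₐ[ℂ] S.SectionAlgebra where
  toFun a := δ S 0 ⟨a, S.mem_fiber_zero a⟩
  map_zero' := map_zero (δ S 0)
  map_add' a b := map_add (δ S 0) ⟨a, S.mem_fiber_zero a⟩ ⟨b, S.mem_fiber_zero b⟩
  map_smul' c a := map_smul (δ S 0) c ⟨a, S.mem_fiber_zero a⟩
  map_mul' a b := by
    rw [δ_mul_δ]
    refine δ_congr S (add_zero 0).symm _ _ ?_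
    simp [mulFun, pos_zero, S.α_zero]
  map_star' a := by
    rw [star_δ]
    exact δ_congr S neg_zero.symm _ _ rfl

/-- There is a largest `C*`-seminorm on the section algebra. -/
theorem bounding : CStarSeminorm.Bounding (∅ : Set S.SectionAlgebra) := by
  intro x
  induction x using ind with
  | h0 => exact ⟨0, fun p _ => (map_zero p.toSeminorm).le⟩
  | h2 x y hx hy =>
    obtain ⟨M, hM⟩ := hx
    obtain ⟨N, hN⟩ := hy
    exact ⟨M + N, fun p hp => (map_add_le_add p.toSeminorm x y).trans
      (add_le_add (hM p hp) (hN p hp))⟩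
  | h1 g a =>
    have key : star (δ S g a) * δ S g a = incl S (S.mulFun (-g) g (star (a : A)) a) := by
      rw [star_δ, δ_mul_δ]
      exact δ_congr S (neg_add_cancel g) _ _ rfl
    refine ⟨√‖S.mulFun (-g) g (star (a : A)) a‖, fun p _ => Real.le_sqrt_of_sq_le ?_⟩
    rw [← p.star_mul_self, key]
    exact (p.comap (incl S)).le_norm _

end SectionAlgebra

/-- The crossed product `A ⋊_{α,L} G⁺`, that is, the cross sectional `C*`-algebra of the Fell
bundle of the corner system: the completion of the section algebra in its largest
`C*`-seminorm. -/
def CrossedProduct : Type _ := (CStarSeminorm.maximal (SectionAlgebra.bounding S)).Completion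

namespace CrossedProduct

instance : NonUnitalCStarAlgebra S.CrossedProduct :=
  inferInstanceAs (NonUnitalCStarAlgebra
    (CStarSeminorm.maximal (SectionAlgebra.bounding S)).Completion)

/-- The canonical map of the section algebra into the crossed product. -/
def ofSection : S.SectionAlgebra →⋆ₙₐ[ℂ] S.CrossedProduct :=
  CStarSeminorm.Completion.ofHom (CStarSeminorm.maximal (SectionAlgebra.bounding S))

/-- The element `a δ_g` of the crossed product, where `a ∈ B_g`. -/
def δ (g : G) (a : S.fiber g) : S.CrossedProduct := ofSection S (SectionAlgebra.δ S g a)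

/-- The canonical map of `A = B_0` into the crossed product. -/
def ι : A →⋆ₙₐ[ℂ] S.CrossedProduct := (ofSection S).comp (SectionAlgebra.incl S)

end CrossedProduct

end CornerSystem

section FreeStarAlgebra

/-- Words in the letters `x` and `x^*`, where `x : X`; the boolean is `true` for `x^*`. -/
abbrev StarWord (X : Type*) : Type _ := FreeSemigroup (X × Bool)

namespace StarWord

/-- The adjoint of a word. -/
def adj {X : Type*} : StarWord X →ₙ* (StarWord X)ᵐᵒᵖ :=
  FreeSemigroup.lift fun y => MulOpposite.op (FreeSemigroup.of (y.1, !y.2))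

theorem adj_adj {X : Type*} (w : StarWord X) : (adj (adj w).unop).unop = w := by
  induction w using FreeSemigroup.recOnMul with
  | ih1 x => simp [adj]
  | ih2 x y hx hy => simp only [map_mul, MulOpposite.unop_mul, hx, hy]

end StarWord

/-- The free (non-unital) complex `*`-algebra on `X`. -/
def FreeStarAlgebra (X : Type*) : Type _ := MonoidAlgebra ℂ (StarWord X)

namespace FreeStarAlgebra

variable {X : Type*}

instance : NonUnitalRing (FreeStarAlgebra X) :=
  inferInstanceAs (NonUnitalRing (MonoidAlgebra ℂ (StarWord X)))
instance : Module ℂ (FreeStarAlgebra X) :=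
  inferInstanceAs (Module ℂ (MonoidAlgebra ℂ (StarWord X)))
instance : IsScalarTower ℂ (FreeStarAlgebra X) (FreeStarAlgebra X) :=
  inferInstanceAs (IsScalarTower ℂ (MonoidAlgebra ℂ (StarWord X)) (MonoidAlgebra ℂ (StarWord X)))
instance : SMulCommClass ℂ (FreeStarAlgebra X) (FreeStarAlgebra X) :=
  inferInstanceAs (SMulCommClass ℂ (MonoidAlgebra ℂ (StarWord X)) (MonoidAlgebra ℂ (StarWord X)))

/-- A scalar multiple of a word. -/
def mono (w : StarWord X) (c : ℂ) : FreeStarAlgebra X := MonoidAlgebra.single w c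

theorem mono_mul (v w : StarWord X) (c d : ℂ) : mono v c * mono w d = mono (v * w) (c * d) :=
  MonoidAlgebra.single_mul_single v w c d

theorem smul_mono (c d : ℂ) (w : StarWord X) : c • mono w d = mono w (c * d) :=
  MonoidAlgebra.smul_single c w d

@[elab_as_elim]
theorem ind {q : FreeStarAlgebra X → Prop} (x : FreeStarAlgebra X) (h0 : q 0)
    (h2 : ∀ x y, q x → q y → q (x + y)) (h1 : ∀ w c, q (mono w c)) : q x :=
  MonoidAlgebra.induction_linear x h0 (fun _ _ hx hy => h2 _ _ hx hy) h1

/-- The involution as an additive map. -/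
def starHom : FreeStarAlgebra X →+ FreeStarAlgebra X :=
  (Finsupp.liftAddHom fun w =>
    ((MonoidAlgebra.singleAddHom (StarWord.adj w).unop : ℂ →+ MonoidAlgebra ℂ (StarWord X)).comp
      (starRingEnd ℂ).toAddMonoidHom)).comp
    (MonoidAlgebra.coeffAddEquiv (R := ℂ) (M := StarWord X)).toAddMonoidHom

instance : Star (FreeStarAlgebra X) := ⟨starHom⟩

theorem star_mono (w : StarWord X) (c : ℂ) :
    star (mono w c) = mono (StarWord.adj w).unop (star c) := by
  exact Finsupp.liftAddHom_apply_single (M := ℂ) (N := MonoidAlgebra ℂ (StarWord X))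
    (fun w => (MonoidAlgebra.singleAddHom (StarWord.adj w).unop).comp
      (starRingEnd ℂ).toAddMonoidHom) w c

theorem star_add' (x y : FreeStarAlgebra X) : star (x + y) = star x + star y :=
  map_add starHom x y

theorem star_zero' : star (0 : FreeStarAlgebra X) = 0 := map_zero starHom

instance : StarRing (FreeStarAlgebra X) where
  star_add := star_add'
  star_involutive x := by
    induction x using ind with
    | h0 => rw [star_zero', star_zero']
    | h2 x y hx hy => rw [star_add', star_add', hx, hy]
    | h1 w c => rw [star_mono, star_mono, star_star, StarWord.adj_adj]
  star_mul x y := by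
    induction x using ind with
    | h0 => rw [zero_mul, star_zero', mul_zero]
    | h2 x x' hx hx' => rw [add_mul, star_add', star_add', mul_add, hx, hx']
    | h1 v c =>
      induction y using ind with
      | h0 => rw [mul_zero, star_zero', zero_mul]
      | h2 y y' hy hy' => rw [mul_add, star_add', star_add', add_mul, hy, hy']
      | h1 w d =>
        rw [mono_mul, star_mono, star_mono, star_mono, mono_mul, map_mul, MulOpposite.unop_mul,
          star_mul]

instance : StarModule ℂ (FreeStarAlgebra X) := ⟨fun c x => by
  induction x using ind with
  | h0 => rw [smul_zero, star_zero', smul_zero]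
  | h2 x y hx hy => rw [smul_add, star_add', star_add', smul_add, hx, hy]
  | h1 w d => rw [smul_mono, star_mono, star_mono, smul_mono, star_mul, mul_comm]⟩

/-- The generators of the free `*`-algebra. -/
def gen (x : X) : FreeStarAlgebra X := mono (FreeSemigroup.of (x, false)) 1

theorem star_gen (x : X) : star (gen x) = mono (FreeSemigroup.of (x, true)) 1 := by
  rw [gen, star_mono, star_one]; rfl

/-- `C*`-seminorms that are bounded on the generators are bounded everywhere. -/
theorem bounding_of_gen {R : Set (FreeStarAlgebra X)}
    (h : ∀ x : X, ∃ M : ℝ, ∀ p : CStarSeminorm (FreeStarAlgebra X), (∀ r ∈ R, p r = 0) →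
      p (gen x) ≤ M) : CStarSeminorm.Bounding R := by
  intro x
  induction x using ind with
  | h0 => exact ⟨0, fun p _ => (map_zero p.toSeminorm).le⟩
  | h2 x y hx hy =>
    obtain ⟨M, hM⟩ := hx
    obtain ⟨N, hN⟩ := hy
    exact ⟨M + N, fun p hp => (map_add_le_add p.toSeminorm x y).trans
      (add_le_add (hM p hp) (hN p hp))⟩
  | h1 w c =>
    have key : ∃ M : ℝ, ∀ p : CStarSeminorm (FreeStarAlgebra X), (∀ r ∈ R, p r = 0) →
        p (mono w 1) ≤ M := by
      induction w using FreeSemigroup.recOnMul with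
      | ih1 y =>
        obtain ⟨y, b⟩ := y
        obtain ⟨M, hM⟩ := h y
        refine ⟨M, fun p hp => ?_⟩
        cases b with
        | false => exact hM p hp
        | true => rw [← star_gen, p.map_star]; exact hM p hp
      | ih2 y w hy hw =>
        obtain ⟨M, hM⟩ := hy
        obtain ⟨N, hN⟩ := hw
        refine ⟨M * N, fun p hp => ?_⟩
        have := p.mul_le (mono (FreeSemigroup.of y) 1) (mono w 1)
        rw [mono_mul, one_mul] at this
        exact this.trans (mul_le_mul (hM p hp) (hN p hp) (apply_nonneg p.toSeminorm _)
          ((apply_nonneg p.toSeminorm _).trans (hM p hp)))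
    obtain ⟨M, hM⟩ := key
    refine ⟨‖c‖ * M, fun p hp => ?_⟩
    have : mono w c = c • mono w 1 := by rw [smul_mono, mul_one]
    rw [this, map_smul_eq_mul]
    exact mul_le_mul_of_nonneg_left (hM p hp) (norm_nonneg c)

end FreeStarAlgebra

end FreeStarAlgebra

namespace CornerSystem

variable {G : Type*} [AddCommGroup G] [LinearOrder G] [IsOrderedAddMonoid G]
  {A : Type*} [NonUnitalCStarAlgebra A] [PartialOrder A]
  (S : CornerSystem G A)

/-! The product system `X = ⨆ X_t` over `G⁺`: `X_t` is the Hausdorff completion of `A` (with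
`q_t : A → X_t`) for the inner product `⟨q_t(a), q_t(b)⟩ = L_t(a^* b)`, with the actions
`a q_t(b) = q_t(a b)` and `q_t(b) a = q_t(b α_t(a))`, and the multiplication
`q_s(a) q_t(b) = q_{s+t}(a α_s(b))`. A Toeplitz representation of `X` is determined by the
elements `i_t(a)` to which it takes `q_t(a)`, and the following are its defining relations. -/

/-- The relations of Toeplitz representations of the product system. -/
inductive ToeplitzRel : FreeStarAlgebra (PosCone G × A) → Prop
  | add (t : PosCone G) (a b : A) :
      ToeplitzRel (.gen (t, a + b) - (.gen (t, a) + .gen (t, b)))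
  | smul (t : PosCone G) (c : ℂ) (a : A) :
      ToeplitzRel (.gen (t, c • a) - c • .gen (t, a))
  | star (a : A) : ToeplitzRel (.gen (0, star a) - star (.gen (0, a)))
  | mul (s t : PosCone G) (a b : A) :
      ToeplitzRel (.gen (s, a) * .gen (t, b) - .gen (s + t, a * S.α s b))
  | inner (t : PosCone G) (a b : A) :
      ToeplitzRel (Star.star (.gen (t, a)) * .gen (t, b) - .gen (0, S.L t (Star.star a * b)))

theorem CStarSeminorm_eq_of_sub {V : Type*} [NonUnitalRing V] [StarRing V] [Module ℂ V]
    (p : CStarSeminorm V) {x y : V} (h : p (x - y) = 0) : p x = p y := by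
  have h1 := map_add_le_add p.toSeminorm (x - y) y
  have h2 := map_add_le_add p.toSeminorm (y - x) x
  rw [sub_add_cancel] at h1 h2
  rw [map_sub_rev] at h2
  exact le_antisymm (by linarith) (by linarith)

/-- The `C*`-seminorm on `A` given by a `C*`-seminorm compatible with the Toeplitz relations. -/
def toeplitzSeminorm (p : CStarSeminorm (FreeStarAlgebra (PosCone G × A)))
    (hp : ∀ r ∈ {r | S.ToeplitzRel r}, p r = 0) : CStarSeminorm A where
  toFun a := p (.gen (0, a))
  map_zero' := by
    have := CStarSeminorm_eq_of_sub p (hp _ (ToeplitzRel.smul 0 0 0))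
    simpa using this
  add_le' a b := by
    rw [CStarSeminorm_eq_of_sub p (hp _ (ToeplitzRel.add 0 a b))]
    exact map_add_le_add p.toSeminorm _ _
  neg' a := by
    have := CStarSeminorm_eq_of_sub p (hp _ (ToeplitzRel.smul 0 (-1) a))
    rw [map_smul_eq_mul] at this
    simpa using this
  smul' c a := by
    rw [CStarSeminorm_eq_of_sub p (hp _ (ToeplitzRel.smul 0 c a)), map_smul_eq_mul]
  mul_le' a b := by
    have := CStarSeminorm_eq_of_sub p (hp _ (ToeplitzRel.mul 0 0 a b))
    rw [add_zero, S.α_zero] at this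
    change p (.gen (0, a * b)) ≤ p (.gen (0, a)) * p (.gen (0, b))
    rw [← this]
    exact p.mul_le _ _
  star_mul_self' a := by
    have := CStarSeminorm_eq_of_sub p (hp _ (ToeplitzRel.inner 0 a a))
    rw [S.L_zero, p.star_mul_self] at this
    exact this.symm

theorem toeplitz_bounding : CStarSeminorm.Bounding {r | S.ToeplitzRel r} := by
  refine FreeStarAlgebra.bounding_of_gen fun ⟨t, a⟩ => ⟨√‖S.L t (star a * a)‖, fun p hp => ?_⟩
  refine Real.le_sqrt_of_sq_le ?_
  rw [← p.star_mul_self, CStarSeminorm_eq_of_sub p (hp _ (ToeplitzRel.inner t a a))]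
  exact (S.toeplitzSeminorm p hp).le_norm _

/-- The Toeplitz algebra `𝒯_X` of the product system `X` of the corner system: the universal
`C*`-algebra for Toeplitz representations of `X`. -/
def ToeplitzAlgebra : Type _ := (CStarSeminorm.maximal S.toeplitz_bounding).Completion

namespace ToeplitzAlgebra

instance : NonUnitalCStarAlgebra S.ToeplitzAlgebra :=
  inferInstanceAs (NonUnitalCStarAlgebra (CStarSeminorm.maximal S.toeplitz_bounding).Completion)

/-- The universal representation `i_t(a) = i_X(q_t(a))`. -/
def i (t : PosCone G) (a : A) : S.ToeplitzAlgebra :=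
  CStarSeminorm.Completion.ofHom (CStarSeminorm.maximal S.toeplitz_bounding) (.gen (t, a))

/-- `(a, k)` is a redundancy of degree `t`: `a` is in the closed ideal `A α_t(A) A`, and `k` is
in the closed span of the elements `i_t(b) i_t(c)^*`, which is the image of the compact operators
on `X_t`, and `k` acts on `X_t` as the left multiplication by `a`. In other words,
`a ∈ A α_t(A) A ∩ φ_t⁻¹(𝒦(X_t))` and `k = i_X^{(t)}(φ_t(a))`. -/
structure IsRedundancy (t : PosCone G) (a : A) (k : S.ToeplitzAlgebra) : Prop where
  mem_ideal : a ∈ closure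
    (Submodule.span ℂ {x : A | ∃ b c d : A, x = b * S.α t c * d} : Set A)
  mem_compact : k ∈ closure
    (Submodule.span ℂ {x : S.ToeplitzAlgebra | ∃ b c : A, x = i S t b * star (i S t c)} :
      Set S.ToeplitzAlgebra)
  mul_eq : ∀ b : A, k * i S t b = i S 0 a * i S t b

/-- The differences `i_0(a) - k`, for all redundancies `(a, k)`. -/
def redundancies : Set S.ToeplitzAlgebra :=
  {x | ∃ t a k, IsRedundancy S t a k ∧ x = i S 0 a - k}

end ToeplitzAlgebra

theorem exelLarsen_bounding : CStarSeminorm.Bounding (ToeplitzAlgebra.redundancies S) :=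
  fun x => ⟨‖x‖, fun p _ => p.le_norm x⟩

/-- The Exel-Larsen crossed product: the quotient of the Toeplitz algebra `𝒯_X` by the closed
ideal generated by the differences `i_0(a) - k` for redundancies `(a, k)`. The quotient norm is
the largest `C*`-seminorm that vanishes on these differences. -/
def ExelLarsen : Type _ := (CStarSeminorm.maximal S.exelLarsen_bounding).Completion

namespace ExelLarsen

instance : NonUnitalCStarAlgebra S.ExelLarsen :=
  inferInstanceAs (NonUnitalCStarAlgebra (CStarSeminorm.maximal S.exelLarsen_bounding).Completion)

/-- The class of `i_t(a)`. -/
def i (t : PosCone G) (a : A) : S.ExelLarsen :=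
  CStarSeminorm.Completion.ofHom (CStarSeminorm.maximal S.exelLarsen_bounding)
    (ToeplitzAlgebra.i S t a)

end ExelLarsen

section Representations

variable {H : Type*} [NormedAddCommGroup H] [InnerProductSpace ℂ H] [CompleteSpace H]

/-- A representation of a `C*`-algebra on a Hilbert space is non-degenerate. -/
def IsNondegenerate {B : Type*} [NonUnitalCStarAlgebra B] (π : B →⋆ₙₐ[ℂ] (H →L[ℂ] H)) : Prop :=
  Dense (Submodule.span ℂ {η : H | ∃ b ξ, η = π b ξ} : Set H)

/-- `(π, U)` is a covariant pair: `π` is a non-degenerate representation of `A`, `U` is a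
semigroup homomorphism, `U_t π(a) U_t^* = π(α_t(a))` and `U_t^* π(a) U_t = π(L_t(a))`. -/
structure IsCovariantPair (π : A →⋆ₙₐ[ℂ] (H →L[ℂ] H)) (U : PosCone G → (H →L[ℂ] H)) : Prop where
  nondegenerate : IsNondegenerate π
  map_zero : U 0 = 1
  map_add : ∀ s t, U (s + t) = U s * U t
  conj : ∀ t a, U t * π a * star (U t) = π (S.α t a)
  conj_star : ∀ t a, star (U t) * π a * U t = π (S.L t a)

/-- `σ` is the representation `π ⋊ U` of the crossed product: it is non-degenerate and takes
`a δ_t` to `π(a) U_t` and `a δ_{-t}` to `U_t^* π(a)`. -/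
structure IsIntegratedForm [StarOrderedRing A] {S : CornerSystem G A} (π : A →⋆ₙₐ[ℂ] (H →L[ℂ] H))
    (U : PosCone G → (H →L[ℂ] H)) (σ : S.CrossedProduct →⋆ₙₐ[ℂ] (H →L[ℂ] H)) : Prop where
  nondegenerate : IsNondegenerate σ
  map_pos : ∀ (t : PosCone G) (a : S.fiber (t : G)),
    σ (CrossedProduct.δ S (t : G) a) = π a * U t
  map_neg : ∀ (t : PosCone G) (a : S.fiber (-(t : G))),
    σ (CrossedProduct.δ S (-(t : G)) a) = star (U t) * π a

end Representations

end CornerSystem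

end

/-! Write p_t for the projection ᾱ_t(1).

Isometry. The coefficient at 0 makes the section algebra a pre-Hilbert A-module with inner product
⟨x, y⟩ = coeff(y x^*). For x = ∑ a_g δ_g the element coeff(x x^*) is the sum of a_g a_g^* over g ≥ 0
and of L_{-g}(a_g a_g^*) over g < 0, so it is positive; it vanishes only for x = 0, because α_t ∘
L_t is the compression by p_t. The inequality `coeff_conj_le` shows that right multiplications are
bounded, and they are adjointable, so they define a C*-seminorm (`regularSeminorm`) that dominates
the norm on A. The largest C*-seminorm is thus isometric on A, and the C*-identity carries this to
every fibre (`norm_δ`).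

Universal property. A representation of the Fell bundle is determined by its values D_t(a) = "a u_t"
in degrees t ≥ 0, and four relations suffice (`IsFellRep`): compatibility of D_0 with adjoints, the
product D_s(a) D_t(b), and the two products D_t(a)^* D_t(b) and D_t(a) D_t(b)^* of equal degree.
Products of unequal degree follow by splitting the larger degree along an approximate unit, since
D_t(a) = lim D_t(a α_t(e)); the order being total, one degree always exceeds the other by an element
of G⁺. Each such family integrates to the crossed product (`crossedProductHom`).

The multipliers. The family Δ_t(a) = (a p_t) δ_t in the crossed product satisfies the relations. The
nets Δ_t(α_t(e)) converge strictly, and their limits are the u_t. As the approximate unit of A is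
one for the crossed product, identities between multipliers can be tested against A (`eq_of_mul_ι`,
`eq_of_ι_mul`).

Covariant pairs. For a covariant pair, U_t is automatically a partial isometry and U_t^* U_t
commutes with π(A), whence U_t π(a) = π(α_t(a)) U_t, and π(a) U_t is a family as above. Conversely a
non-degenerate representation extends to multipliers, and the u_t give U.

Exel–Larsen. Since α_t ∘ L_t is compression by p_t, the operator Θ_{q_t(a),q_t(b)} on X_t is left
multiplication by a p_t b^*. Hence dividing by the redundancies imposes exactly the missing relation
D_t(a) D_t(b)^* = D_0(a p_t b^*); conversely all redundancies vanish in the crossed product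
(`toCrossedProduct_redundancy`). The two universal properties give mutually inverse homomorphisms.
-/

noncomputable section

/-! ### Pointwise limits of bounded nets of operators. -/

section Limits

variable {ι X Y : Type*} [NormedAddCommGroup X] [NormedSpace ℂ X] [NormedAddCommGroup Y]
  [NormedSpace ℂ Y] [CompleteSpace Y]

/-- A bounded net of operators that converges pointwise on a set with dense span converges
pointwise to an operator. -/
theorem exists_tendsto_of_dense_span {l : Filter ι} [l.NeBot] {T : ι → X →L[ℂ] Y} {C : ℝ}
    (hC : ∀ᶠ i in l, ‖T i‖ ≤ C) {s : Set X} (hs : Dense (Submodule.span ℂ s : Set X))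
    (h : ∀ x ∈ s, ∃ y, Tendsto (fun i => T i x) l (𝓝 y)) :
    ∃ R : X →L[ℂ] Y, ∀ x, Tendsto (fun i => T i x) l (𝓝 (R x)) := by
  have hspan : ∀ x ∈ Submodule.span ℂ s, ∃ y, Tendsto (fun i => T i x) l (𝓝 y) := by
    intro x hx
    induction hx using Submodule.span_induction with
    | mem x hx => exact h x hx
    | zero => exact ⟨0, by simp⟩
    | add x y _ _ hx hy =>
      obtain ⟨a, ha⟩ := hx
      obtain ⟨b, hb⟩ := hy
      exact ⟨a + b, by simpa only [map_add] using ha.add hb⟩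
    | smul c x _ hx =>
      obtain ⟨a, ha⟩ := hx
      exact ⟨c • a, by simpa only [map_smul] using ha.const_smul c⟩
  have hC0 : 0 ≤ C := by
    obtain ⟨i, hi⟩ := hC.exists
    exact (norm_nonneg _).trans hi
  have hall : ∀ x, ∃ y, Tendsto (fun i => T i x) l (𝓝 y) := by
    intro x
    apply cauchy_map_iff_exists_tendsto.1
    rw [cauchy_map_iff]
    refine ⟨inferInstance, ?_⟩
    rw [Metric.uniformity_basis_dist.tendsto_right_iff]
    intro ε hε
    -- Four errors of size ε/4: two from replacing x by z under T_i and T_j, two from comparing T_i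
    -- z and T_j z with their limit. The summand 1 covers the case C = 0.
    have hδ : 0 < ε / (4 * (C + 1)) := by positivity
    obtain ⟨z, hz, hzx⟩ := Metric.mem_closure_iff.1 (hs x) _ hδ
    obtain ⟨y, hy⟩ := hspan z hz
    have hev := hC.and (Metric.tendsto_nhds.1 hy (ε / 4) (by positivity))
    filter_upwards [hev.prod_mk hev] with ⟨i, j⟩ ⟨⟨hi1, hi2⟩, hj1, hj2⟩
    have key : ∀ k, ‖T k‖ ≤ C → dist (T k x) (T k z) ≤ ε / 4 := by
      intro k hk
      rw [dist_eq_norm, ← map_sub]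
      refine ((T k).le_opNorm _).trans ?_
      rw [← dist_eq_norm]
      calc ‖T k‖ * dist x z ≤ (C + 1) * (ε / (4 * (C + 1))) := by
            gcongr
            linarith
        _ = ε / 4 := by field_simp
    change dist (T i x) (T j x) < ε
    have h1 := key i hi1
    have h2 := key j hj1
    have h3 := dist_triangle (T i x) (T i z) (T j x)
    have h4 := dist_triangle_right (T i z) (T j z) y
    have h5 := dist_triangle (T i z) (T j z) (T j x)
    rw [dist_comm (T j z)] at h5
    linarith
  choose f hf using hall
  refine ⟨LinearMap.mkContinuous
    { toFun := f
      map_add' := fun x y => tendsto_nhds_unique (hf (x + y)) (by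
        simpa only [map_add] using (hf x).add (hf y))
      map_smul' := fun c x => tendsto_nhds_unique (hf (c • x)) (by
        simpa only [map_smul, RingHom.id_apply] using (hf x).const_smul c) } C fun x => ?_, hf⟩
  refine le_of_tendsto (hf x).norm ?_
  filter_upwards [hC] with i hi
  exact ((T i).le_opNorm x).trans (mul_le_mul_of_nonneg_right hi (norm_nonneg x))

end Limits

/-! ### C*-seminorms from Hilbert modules, and the universal property of enveloping C*-algebras. -/

namespace CStarSeminorm

section Adjointable

variable {A : Type*} [NonUnitalCStarAlgebra A] [PartialOrder A] [StarOrderedRing A]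
  {E : Type*} [SMul A E] [NormedAddCommGroup E] [NormedSpace ℂ E] [CStarModule A E]
  {V : Type*} [NonUnitalRing V] [StarRing V] [Module ℂ V]

/-- The `C*`-seminorm of an antirepresentation by adjointable operators on a Hilbert module. -/
def ofAdjointable (R : V →ₗ[ℂ] (E →L[ℂ] E)) (hmul : ∀ x y, R (x * y) = R y * R x)
    (hadj : ∀ x (z y : E), inner A (R x z) y = inner A z (R (star x) y)) : CStarSeminorm V where
  toSeminorm := (normSeminorm ℂ (E →L[ℂ] E)).comp R
  mul_le' x y := by
    change ‖R (x * y)‖ ≤ ‖R x‖ * ‖R y‖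
    rw [hmul, mul_comm]
    exact norm_mul_le _ _
  star_mul_self' x := by
    change ‖R (star x * x)‖ = ‖R x‖ ^ 2
    -- Cauchy–Schwarz for ‖R(x^*)z‖² = ‖⟨z, R(x)R(x^*)z⟩‖, where R(x)R(x^*) = R(x^* x) because R
    -- reverses products. Only the inner product is used, so the module need not be complete.
    have h1 : ∀ x, ‖R (star x)‖ ^ 2 ≤ ‖R (star x * x)‖ := by
      intro x
      rw [← Real.le_sqrt (norm_nonneg _) (norm_nonneg _)]
      refine ContinuousLinearMap.opNorm_le_bound _ (Real.sqrt_nonneg _) fun z => ?_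
      refine abs_le_of_sq_le_sq' ?_ (by positivity) |>.2
      rw [mul_pow, Real.sq_sqrt (norm_nonneg _), CStarModule.norm_sq_eq A, hadj, star_star,
        ← mul_apply_eq_comp, ← hmul]
      refine (CStarModule.norm_inner_le E).trans ?_
      have := (R (star x * x)).le_opNorm z
      nlinarith [norm_nonneg z]
    have h2 : ∀ x, ‖R (star x)‖ ≤ ‖R x‖ := by
      intro x
      have h3 : ‖R (star x)‖ ^ 2 ≤ ‖R x‖ * ‖R (star x)‖ :=
        (h1 x).trans (by rw [hmul]; exact norm_mul_le (R x) (R (star x)))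
      rcases (norm_nonneg (R (star x))).eq_or_lt with h | h
      · rw [← h]; exact norm_nonneg _
      · rw [sq] at h3
        exact le_of_mul_le_mul_right h3 h
    have h4 : ‖R (star x)‖ = ‖R x‖ := le_antisymm (h2 x) (by simpa using h2 (star x))
    refine le_antisymm ?_ (by rw [← h4]; exact h1 x)
    rw [hmul, sq]
    exact (norm_mul_le _ _).trans_eq (by rw [h4])

end Adjointable

section Lift

variable {V : Type*} [NonUnitalRing V] [StarRing V] [Module ℂ V]
  {C : Type*} [NonUnitalCStarAlgebra C]

/-- The norm of a `C*`-algebra as a `C*`-seminorm. -/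
def norm (C : Type*) [NonUnitalCStarAlgebra C] : CStarSeminorm C where
  toSeminorm := normSeminorm ℂ C
  mul_le' := norm_mul_le
  star_mul_self' x := by
    change ‖star x * x‖ = ‖x‖ ^ 2
    rw [CStarRing.norm_star_mul_self, sq]

variable {S : Set V} (hS : Bounding S) (f : V →⋆ₙₐ[ℂ] C) (hf : ∀ s ∈ S, f s = 0)

/-- The norm pulled back along f is one of the seminorms in the supremum that defines the maximal
one; this bound is what lets f extend to the completion. -/
theorem norm_le_maximal (hf : ∀ s ∈ S, f s = 0) (x : V) : ‖f x‖ ≤ maximal hS x :=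
  le_maximal hS ((norm C).comap f)
    (fun s hs => by change ‖f s‖ = 0; rw [hf s hs, norm_zero]) x

/-- The linear map of the seminormed space underlying `f`. -/
def liftAux : (maximal hS).Space →L[ℂ] C :=
  LinearMap.mkContinuous
    { toFun := fun x : V => f x
      map_add' := fun x y : V => map_add f x y
      map_smul' := fun c (x : V) => map_smul f c x } 1
    fun x => by rw [one_mul]; exact norm_le_maximal hS f hf x

/-- A `*`-homomorphism to a `C*`-algebra that vanishes on `S` extends to the enveloping
`C*`-algebra for the relations `S`. -/
def lift : (maximal hS).Completion →⋆ₙₐ[ℂ] C :=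
  have key : ∀ x : V, UniformSpace.Completion.extension (liftAux hS f hf)
      (Completion.of (maximal hS) x) = f x := fun x =>
    UniformSpace.Completion.extension_coe (liftAux hS f hf).uniformContinuous x
  have cont : Continuous fun x : (maximal hS).Completion =>
      UniformSpace.Completion.extension (liftAux hS f hf) x :=
    UniformSpace.Completion.continuous_extension
  { toFun := UniformSpace.Completion.extension (liftAux hS f hf)
    map_smul' := fun c x => Completion.ind _ x
      (isClosed_eq (cont.comp (continuous_const_smul c)) (cont.const_smul c))
      fun v => by rw [← Completion.of_smul, key, key]; exact map_smul f c v
    map_zero' := by rw [← Completion.of_zero (maximal hS), key]; exact map_zero f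
    map_add' := fun x y => Completion.ind₂ _ x y
      (isClosed_eq (cont.comp continuous_add)
        ((cont.comp continuous_fst).add (cont.comp continuous_snd)))
      fun v w => by rw [← Completion.of_add, key, key, key]; exact map_add f v w
    map_mul' := fun x y => Completion.ind₂ _ x y
      (isClosed_eq (cont.comp continuous_mul)
        ((cont.comp continuous_fst).mul (cont.comp continuous_snd)))
      fun v w => by rw [← Completion.of_mul, key, key, key]; exact map_mul f v w
    map_star' := fun x => Completion.ind _ x
      (isClosed_eq (cont.comp (Completion.continuous_star' _)) cont.star)
      fun v => by rw [← Completion.of_star, key, key]; exact StarHomClass.map_star f v }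

theorem lift_ofHom (x : V) : lift hS f hf (Completion.ofHom _ x) = f x :=
  UniformSpace.Completion.extension_coe (liftAux hS f hf).uniformContinuous x

theorem denseRange_ofHom (p : CStarSeminorm V) : DenseRange (Completion.ofHom p) :=
  Completion.denseRange_of p

end Lift

end CStarSeminorm

/-! ### Multipliers: rules of calculation, strict limits, extension of representations. -/

namespace DoubleCentralizer

variable {C : Type*} [NonUnitalCStarAlgebra C]

/-- Take z = (x - y)^* and apply the C*-identity. -/
theorem eq_of_mul_right {x y : C} (h : ∀ z, x * z = y * z) : x = y := by
  have h1 : (x - y) * star (x - y) = 0 := by rw [sub_mul, h, sub_self]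
  exact sub_eq_zero.1 ((CStarRing.mul_star_self_eq_zero_iff _).1 h1)

/-- Centrality (xm)y = x(my) lets the left multiplication determine the right one. -/
theorem eq_of_fst {m n : 𝓜(ℂ, C)} (h : ∀ x, m.fst x = n.fst x) : m = n := by
  have h1 : m.fst = n.fst := ContinuousLinearMap.ext h
  refine DoubleCentralizer.ext ℂ C m n (Prod.ext h1 ?_)
  refine ContinuousLinearMap.ext fun x => eq_of_mul_right fun y => ?_
  exact (m.central x y).trans ((congrArg (x * ·) (h y)).trans (n.central x y).symm)

theorem eq_of_mul_left {x y : C} (h : ∀ z, z * x = z * y) : x = y := by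
  rw [← star_inj]
  refine eq_of_mul_right fun z => ?_
  rw [← star_inj, star_mul, star_mul, star_star, star_star, h]

/-- After multiplication by z on the left, centrality moves m onto z, where associativity in C
applies. -/
theorem fst_mul (m : 𝓜(ℂ, C)) (x y : C) : m.fst (x * y) = m.fst x * y := by
  refine eq_of_mul_left fun z => ?_
  have h1 : m.snd z * (x * y) = z * m.fst (x * y) := m.central z (x * y)
  have h2 : m.snd z * x = z * m.fst x := m.central z x
  rw [← h1, ← mul_assoc, h2, mul_assoc]

theorem mul_coe (m : 𝓜(ℂ, C)) (x : C) : m * (x : 𝓜(ℂ, C)) = (m.fst x : C) :=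
  eq_of_fst fun y => by
    rw [mul_fst, coe_fst, coe_fst]
    exact fst_mul m x y

theorem coe_mul (x : C) (m : 𝓜(ℂ, C)) : (x : 𝓜(ℂ, C)) * m = (m.snd x : C) :=
  eq_of_fst fun y => by
    rw [mul_fst, coe_fst, coe_fst]
    exact (m.central x y).symm

theorem coe_mul_coe_eq (x y : C) : (x : 𝓜(ℂ, C)) * (y : 𝓜(ℂ, C)) = ((x * y : C) : 𝓜(ℂ, C)) :=
  (map_mul (coeHom (𝕜 := ℂ) (A := C)) x y).symm

theorem coe_star (x : C) : ((star x : C) : 𝓜(ℂ, C)) = star (x : 𝓜(ℂ, C)) :=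
  map_star (coeHom (𝕜 := ℂ) (A := C)) x

theorem coe_inj {x y : C} : (x : 𝓜(ℂ, C)) = (y : 𝓜(ℂ, C)) ↔ x = y := by
  refine ⟨fun h => eq_of_mul_right fun z => ?_, fun h => by rw [h]⟩
  have := congrArg (fun m : 𝓜(ℂ, C) => m.fst z) h
  simpa only [coe_fst, ContinuousLinearMap.mul_apply'] using this

/-- A bounded net that converges strictly on a set with dense span converges strictly to a
multiplier. -/
theorem exists_tendsto {ι : Type*} {l : Filter ι} [l.NeBot] {m : ι → C}
    (hm : ∀ᶠ i in l, ‖m i‖ ≤ 1) {s : Set C} (hs : Dense (Submodule.span ℂ s : Set C))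
    (hl : ∀ x ∈ s, ∃ y, Tendsto (fun i => m i * x) l (𝓝 y))
    (hr : ∀ x ∈ s, ∃ y, Tendsto (fun i => x * m i) l (𝓝 y)) :
    ∃ M : 𝓜(ℂ, C), (∀ x, Tendsto (fun i => m i * x) l (𝓝 (M.fst x))) ∧
      ∀ x, Tendsto (fun i => x * m i) l (𝓝 (M.snd x)) := by
  obtain ⟨L, hL⟩ := exists_tendsto_of_dense_span (T := fun i => ContinuousLinearMap.mul ℂ C (m i))
    (C := 1) (hm.mono fun i hi => (ContinuousLinearMap.opNorm_mul_apply_le ℂ C _).trans hi) hs hl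
  obtain ⟨R, hR⟩ := exists_tendsto_of_dense_span
    (T := fun i => (ContinuousLinearMap.mul ℂ C).flip (m i))
    (C := 1) (hm.mono fun i hi => ContinuousLinearMap.opNorm_le_bound _ zero_le_one fun x => by
      rw [one_mul, ContinuousLinearMap.flip_apply, ContinuousLinearMap.mul_apply']
      exact (norm_mul_le _ _).trans (mul_le_of_le_one_right (norm_nonneg x) hi)) hs hr
  refine ⟨⟨(L, R), fun x y => ?_⟩, hL, hR⟩
  refine tendsto_nhds_unique ((hR x).mul_const y) ?_
  simpa only [ContinuousLinearMap.flip_apply, ContinuousLinearMap.mul_apply', mul_assoc] using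
    (hL y).const_mul x

section Representations

variable {H : Type*} [NormedAddCommGroup H] [InnerProductSpace ℂ H] [CompleteSpace H]
  {σ : C →⋆ₙₐ[ℂ] (H →L[ℂ] H)}

theorem continuous_rep (σ : C →⋆ₙₐ[ℂ] (H →L[ℂ] H)) : Continuous σ :=
  AddMonoidHomClass.continuous_of_bound σ 1 fun x => by
    rw [one_mul]; exact NonUnitalStarAlgHom.norm_apply_le σ x

/-- The vectors σ(x)ξ span a dense subspace, and both operators are continuous. -/
theorem eq_of_nondegenerate (hσ : CornerSystem.IsNondegenerate σ) {S T : H →L[ℂ] H}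
    (h : ∀ x, S * σ x = T * σ x) : S = T := by
  refine ContinuousLinearMap.ext_on hσ ?_
  rintro _ ⟨x, ξ, rfl⟩
  exact congrArg (fun R : H →L[ℂ] H => R ξ) (h x)

/-- T is the strong limit of the bounded net σ(m e_i): on σ(x)ξ it gives σ(m e_i x)ξ, which tends to
σ(m x)ξ. -/
theorem exists_extension (hσ : CornerSystem.IsNondegenerate σ) {ι : Type*} {l : Filter ι} [l.NeBot]
    {e : ι → C} (he : ∀ᶠ i in l, ‖e i‖ ≤ 1) (h : ∀ x, Tendsto (fun i => e i * x) l (𝓝 x))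
    (m : 𝓜(ℂ, C)) : ∃ T : H →L[ℂ] H, ∀ x, T * σ x = σ (m.fst x) := by
  have lim : ∀ x ξ, Tendsto (fun i => σ (m.fst (e i)) (σ x ξ)) l (𝓝 (σ (m.fst x) ξ)) := by
    intro x ξ
    have h1 : Continuous fun y => σ (m.fst y) ξ :=
      (ContinuousLinearMap.apply ℂ H ξ).continuous.comp ((continuous_rep σ).comp m.fst.continuous)
    refine ((h1.tendsto x).comp (h x)).congr fun i => ?_
    rw [Function.comp_apply, fst_mul, map_mul]
    rfl
  obtain ⟨T, hT⟩ := exists_tendsto_of_dense_span (T := fun i => σ (m.fst (e i))) (C := ‖m.fst‖)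
    (l := l) (he.mono fun i hi => (NonUnitalStarAlgHom.norm_apply_le σ _).trans
      ((m.fst.le_opNorm _).trans (mul_le_of_le_one_right (norm_nonneg _) hi))) hσ
    (by rintro _ ⟨x, ξ, rfl⟩; exact ⟨_, lim x ξ⟩)
  exact ⟨T, fun x => ContinuousLinearMap.ext fun ξ => tendsto_nhds_unique (hT _) (lim x ξ)⟩

/-- A non-degenerate representation extends to the multiplier algebra. -/
theorem exists_starHom (hσ : CornerSystem.IsNondegenerate σ) {ι : Type*} {l : Filter ι} [l.NeBot]
    {e : ι → C} (he : ∀ᶠ i in l, ‖e i‖ ≤ 1) (h : ∀ x, Tendsto (fun i => e i * x) l (𝓝 x)) :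
    ∃ τ : 𝓜(ℂ, C) → (H →L[ℂ] H), τ 1 = 1 ∧ (∀ m n, τ (m * n) = τ m * τ n) ∧
      (∀ m, τ (star m) = star (τ m)) ∧ ∀ x : C, τ (x : 𝓜(ℂ, C)) = σ x := by
  choose τ hτ using exists_extension hσ he h
  refine ⟨τ, ?_, fun m n => ?_, fun m => ?_, fun y => ?_⟩
  · refine eq_of_nondegenerate hσ fun x => ?_
    rw [hτ, one_mul, one_fst]; rfl
  · refine eq_of_nondegenerate hσ fun x => ?_
    rw [hτ, mul_assoc, hτ, hτ, mul_fst]; rfl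
  -- With σ(x)^* on the left and σ(y) on the right the claim becomes x^*(m^* y) = (m x)^* y in C,
  -- which is centrality.
  · rw [← star_inj, star_star]
    refine eq_of_nondegenerate hσ fun x => ?_
    rw [← star_inj]
    refine eq_of_nondegenerate hσ fun y => ?_
    rw [hτ, star_mul, star_star, mul_assoc, hτ, star_fst, ← StarHomClass.map_star σ x,
      ← StarHomClass.map_star σ (m.fst x), ← map_mul, ← map_mul, ← star_mul, m.central, star_mul,
      star_star]
  · refine eq_of_nondegenerate hσ fun x => ?_
    rw [hτ, coe_fst, ContinuousLinearMap.mul_apply', map_mul]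

end Representations

end DoubleCentralizer

/-! ### Positivity of the Fell bundle, its regular representation, and isometry of the fibres. -/

namespace CornerSystem

variable {G : Type*} [AddCommGroup G] [LinearOrder G] [IsOrderedAddMonoid G]
  {A : Type*} [NonUnitalCStarAlgebra A] [PartialOrder A] [StarOrderedRing A]
  (S : CornerSystem G A)

theorem mulFun_zero_right_of_nonneg {g : G} (hg : 0 ≤ g) (b c : A) :
    S.mulFun g 0 b c = b * S.α (pos g) c := by
  rw [mulFun, if_pos hg, if_pos le_rfl]

theorem mulFun_zero_right_of_neg {g : G} (hg : g < 0) (b c : A) :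
    S.mulFun g 0 b c = b * c := by
  rw [mulFun, if_neg (not_le.2 hg), if_pos le_rfl, add_zero, if_neg (not_le.2 hg), pos_zero,
    S.L_zero]

theorem mulFun_neg_right_of_nonneg {g : G} (hg : 0 ≤ g) (b c : A) :
    S.mulFun g (-g) b c = b * c := by
  rw [mulFun, if_pos hg]
  rcases hg.eq_or_lt with rfl | h
  · rw [if_pos (by simp), pos_zero, S.α_zero]
  · rw [if_neg (by simpa using h), if_pos (by simp), add_neg_cancel, pos_zero, S.α_zero]

theorem mulFun_neg_right_of_neg {g : G} (hg : g < 0) (b c : A) :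
    S.mulFun g (-g) b c = S.L (pos (-g)) (b * c) := by
  rw [mulFun, if_neg (not_le.2 hg), if_pos (by simpa using hg.le), if_pos (by simp)]

/-- The product is b b^* in degree g ≥ 0 and L_{-g}(b b^*) in degree g < 0, and L is positive. -/
theorem mulFun_star_self_nonneg (g : G) (b : A) : 0 ≤ S.mulFun g (-g) b (star b) := by
  rcases le_or_gt 0 g with hg | hg
  · rw [S.mulFun_neg_right_of_nonneg hg]
    exact mul_star_self_nonneg b
  · rw [S.mulFun_neg_right_of_neg hg]
    exact map_nonneg _ (mul_star_self_nonneg b)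

/-- In negative degree L need not be faithful on A, but it is so on such elements: α ∘ L compresses
by the projection that fixes b on the left, so α(L(b b^*)) = b b^*. -/
theorem eq_zero_of_mulFun_star_self {g : G} {b : A} (hb : b ∈ S.fiber g)
    (h : S.mulFun g (-g) b (star b) = 0) : b = 0 := by
  rw [← CStarRing.mul_star_self_eq_zero_iff]
  rcases le_or_gt 0 g with hg | hg
  · rwa [S.mulFun_neg_right_of_nonneg hg] at h
  · rw [S.mulFun_neg_right_of_neg hg] at h
    have h1 := S.α_L (pos (-g)) (b * star b)
    rw [S.mem_fiber_of_neg (not_le.2 hg)] at hb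
    rwa [h, map_zero, mul_proj, ← star_proj, proj_mul, hb, eq_comm] at h1

/-- The homogeneous case of the estimate behind the boundedness of the regular representation. Both
signs rest on b c b^* ≤ ‖c‖ b b^*, with c replaced by α_g(c) for g ≥ 0, and with L applied for g <
0. -/
theorem mulFun_conj_le (g : G) (b : A) {c : A} (hc : IsSelfAdjoint c) :
    S.mulFun g (-g) (S.mulFun g 0 b c) (star b) ≤ ‖c‖ • S.mulFun g (-g) b (star b) := by
  rcases le_or_gt 0 g with hg | hg
  · rw [S.mulFun_neg_right_of_nonneg hg, S.mulFun_neg_right_of_nonneg hg,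
      S.mulFun_zero_right_of_nonneg hg]
    refine (CStarAlgebra.star_right_conjugate_le_norm_smul (hc.map (S.α (pos g)))).trans ?_
    exact smul_le_smul_of_nonneg_right (NonUnitalStarAlgHom.norm_apply_le _ _)
      (mul_star_self_nonneg b)
  · rw [S.mulFun_neg_right_of_neg hg, S.mulFun_neg_right_of_neg hg,
      S.mulFun_zero_right_of_neg hg, ← Complex.coe_smul, ← map_smul, Complex.coe_smul]
    exact OrderHomClass.mono _ (CStarAlgebra.star_right_conjugate_le_norm_smul hc)

namespace SectionAlgebra

open DirectSum

/-- The coefficient at `0` of a section. -/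
def coeff : S.SectionAlgebra →ₗ[ℂ] A :=
  (S.fiber 0).subtype ∘ₗ DirectSum.component ℂ G (fun g => S.fiber g) 0

theorem coeff_δ_of_ne {g : G} (hg : g ≠ 0) (a : S.fiber g) : coeff S (δ S g a) = 0 := by
  have : DirectSum.component ℂ G (fun g => S.fiber g) 0 (δ S g a) = 0 :=
    DirectSum.of_eq_of_ne (β := fun g => S.fiber g) g 0 a hg.symm
  exact congrArg Subtype.val this

theorem coeff_δ_zero {g : G} (hg : g = 0) (a : S.fiber g) : coeff S (δ S g a) = a := by
  subst hg
  have : DirectSum.component ℂ G (fun g => S.fiber g) 0 (δ S 0 a) = a :=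
    DirectSum.of_eq_same (β := fun g => S.fiber g) 0 a
  exact congrArg Subtype.val this

theorem eq_sum (x : S.SectionAlgebra) :
    ∃ (s : Finset G) (a : ∀ g, S.fiber g), x = ∑ g ∈ s, δ S g (a g) := by
  classical
  exact ⟨DFinsupp.support (show ⨁ g, S.fiber g from x), fun g => (show ⨁ g, S.fiber g from x) g,
    (DirectSum.sum_support_of (β := fun g => S.fiber g) x).symm⟩

/-- The product of the terms of index g and h has degree g - h, so only the diagonal reaches degree
0. -/
theorem coeff_conj (s : Finset G) (a : ∀ g, S.fiber g) (c : A) :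
    coeff S ((∑ g ∈ s, δ S g (a g)) * incl S c * star (∑ g ∈ s, δ S g (a g))) =
      ∑ g ∈ s, S.mulFun g (-g) (S.mulFun g 0 (a g) c) (star (a g : A)) := by
  classical
  rw [star_sum, Finset.sum_mul, Finset.sum_mul, map_sum]
  refine Finset.sum_congr rfl fun g hg => ?_
  rw [Finset.mul_sum, map_sum, Finset.sum_eq_single_of_mem g hg]
  · rw [star_δ, incl]
    change coeff S (δ S g (a g) * δ S 0 _ * _) = _
    rw [δ_mul_δ, δ_mul_δ, coeff_δ_zero S (by abel)]
    simp only [add_zero]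
  · intro h _ hne
    rw [star_δ, incl]
    change coeff S (δ S g (a g) * δ S 0 _ * _) = _
    rw [δ_mul_δ, δ_mul_δ, coeff_δ_of_ne]
    rw [add_zero, ← sub_eq_add_neg, sub_ne_zero]
    exact hne.symm

theorem coeff_mul_star (s : Finset G) (a : ∀ g, S.fiber g) :
    coeff S ((∑ g ∈ s, δ S g (a g)) * star (∑ g ∈ s, δ S g (a g))) =
      ∑ g ∈ s, S.mulFun g (-g) (a g) (star (a g : A)) := by
  classical
  rw [star_sum, Finset.sum_mul, map_sum]
  refine Finset.sum_congr rfl fun g hg => ?_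
  rw [Finset.mul_sum, map_sum, Finset.sum_eq_single_of_mem g hg]
  · rw [star_δ, δ_mul_δ, coeff_δ_zero S (by abel)]
  · intro h _ hne
    rw [star_δ, δ_mul_δ, coeff_δ_of_ne]
    rw [← sub_eq_add_neg, sub_ne_zero]
    exact hne.symm

theorem coeff_mul_star_nonneg (x : S.SectionAlgebra) : 0 ≤ coeff S (x * star x) := by
  obtain ⟨s, a, rfl⟩ := eq_sum S x
  rw [coeff_mul_star]
  exact Finset.sum_nonneg fun g _ => S.mulFun_star_self_nonneg g _

theorem eq_zero_of_coeff_mul_star {x : S.SectionAlgebra} (h : coeff S (x * star x) = 0) :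
    x = 0 := by
  obtain ⟨s, a, rfl⟩ := eq_sum S x
  rw [coeff_mul_star, Finset.sum_eq_zero_iff_of_nonneg
    fun g _ => S.mulFun_star_self_nonneg g _] at h
  refine Finset.sum_eq_zero fun g hg => ?_
  have : a g = 0 := Subtype.ext (S.eq_zero_of_mulFun_star_self (a g).2 (h g hg))
  rw [this, map_zero]

/-- No cross terms occur in degree 0, so the homogeneous estimates add up. -/
theorem coeff_conj_le (x : S.SectionAlgebra) {c : A} (hc : IsSelfAdjoint c) :
    coeff S (x * incl S c * star x) ≤ ‖c‖ • coeff S (x * star x) := by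
  obtain ⟨s, a, rfl⟩ := eq_sum S x
  rw [coeff_mul_star, coeff_conj, Finset.smul_sum]
  exact Finset.sum_le_sum fun g _ => S.mulFun_conj_le g _ hc

theorem coeff_incl (a : A) : coeff S (incl S a) = a := coeff_δ_zero S rfl _

/-- This makes the form coeff(y x^*) linear over the left action of A. -/
theorem coeff_incl_mul (a : A) (x : S.SectionAlgebra) : coeff S (incl S a * x) = a * coeff S x := by
  induction x using ind with
  | h0 => simp
  | h2 x y hx hy => rw [mul_add, map_add, map_add, mul_add, hx, hy]
  | h1 g b =>
    change coeff S (δ S 0 _ * _) = _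
    rw [δ_mul_δ]
    by_cases hg : g = 0
    · subst hg
      rw [coeff_δ_zero S (add_zero 0), coeff_δ_zero S rfl]
      change S.mulFun 0 0 a b = _
      rw [S.mulFun_zero_right_of_nonneg le_rfl, pos_zero, S.α_zero]
    · rw [coeff_δ_of_ne S hg, coeff_δ_of_ne S (by rwa [zero_add]), mul_zero]

theorem coeff_star (x : S.SectionAlgebra) : coeff S (star x) = star (coeff S x) := by
  induction x using ind with
  | h0 => simp
  | h2 x y hx hy => rw [star_add, map_add, map_add, star_add, hx, hy]
  | h1 g b =>
    rw [star_δ]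
    by_cases hg : g = 0
    · subst hg
      rw [coeff_δ_zero S neg_zero, coeff_δ_zero S rfl]
    · rw [coeff_δ_of_ne S hg, coeff_δ_of_ne S (neg_ne_zero.2 hg), star_zero]

/-- Homogeneous elements have x x^* and x^* x in A, which reduces norm questions about a fibre to A.
-/
theorem mul_star_δ {g : G} (a : S.fiber g) :
    δ S g a * star (δ S g a) = incl S (S.mulFun g (-g) a (star (a : A))) := by
  rw [star_δ, δ_mul_δ]
  exact δ_congr S (add_neg_cancel g) _ _ rfl

theorem star_δ_mul {g : G} (a : S.fiber g) :
    star (δ S g a) * δ S g a = incl S (S.mulFun (-g) g (star (a : A)) a) := by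
  rw [star_δ, δ_mul_δ]
  exact δ_congr S (neg_add_cancel g) _ _ rfl

section RegularRepresentation

/-- The action of `A` on sections. -/
@[reducible]
def regularSMul : SMul A S.SectionAlgebra := ⟨fun a x => incl S a * x⟩

/-- The `A`-valued inner product on sections. -/
@[reducible]
def regularInner : Inner A S.SectionAlgebra := ⟨fun x y => coeff S (y * star x)⟩

attribute [local instance] regularSMul regularInner

/-- The norm of the inner product on sections. -/
@[reducible]
def regularNorm : Norm S.SectionAlgebra := CStarModule.norm A

attribute [local instance] regularNorm

/-- The sections as a pre-Hilbert module. -/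
@[reducible]
def regularModule : CStarModule A S.SectionAlgebra where
  inner_add_right {x y z} := by
    change coeff S ((y + z) * star x) = coeff S (y * star x) + coeff S (z * star x)
    rw [add_mul, map_add]
  inner_self_nonneg {x} := coeff_mul_star_nonneg S x
  inner_self {x} := ⟨eq_zero_of_coeff_mul_star S, by
    rintro rfl
    change coeff S (0 * star 0) = 0
    rw [zero_mul, map_zero]⟩
  inner_op_smul_right {a x y} := by
    change coeff S (incl S a * y * star x) = a * coeff S (y * star x)
    rw [mul_assoc, coeff_incl_mul]
  inner_smul_right_complex {z x y} := by
    change coeff S ((z • y) * star x) = z • coeff S (y * star x)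
    rw [smul_mul_assoc, map_smul]
  star_inner x y := by
    change star (coeff S (y * star x)) = coeff S (x * star y)
    rw [← coeff_star, star_mul, star_star]
  norm_eq_sqrt_norm_inner_self _ := rfl

attribute [local instance] regularModule

/-- The sections as a normed group. -/
@[reducible]
def regularNormedAddCommGroup : NormedAddCommGroup S.SectionAlgebra :=
  CStarModule.normedAddCommGroup A

attribute [local instance] regularNormedAddCommGroup

/-- The sections as a normed space. -/
@[reducible]
def regularNormedSpace : NormedSpace ℂ S.SectionAlgebra :=
  NormedSpace.ofCore (CStarModule.normedSpaceCore A)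

attribute [local instance] regularNormedSpace

theorem regular_norm_sq (x : S.SectionAlgebra) : ‖x‖ ^ 2 = ‖coeff S (x * star x)‖ :=
  CStarModule.norm_sq_eq A

/-- For homogeneous x the element c = x x^* lies in A, and ‖y x‖² = ‖coeff(y c y^*)‖ ≤ ‖c‖ ‖y‖².
Sums are handled by the triangle inequality. -/
theorem exists_regular_bound (x : S.SectionAlgebra) :
    ∃ M : ℝ, ∀ y : S.SectionAlgebra, ‖y * x‖ ≤ M * ‖y‖ := by
  induction x using ind with
  | h0 => exact ⟨0, fun y => by rw [mul_zero, norm_zero, zero_mul]⟩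
  | h2 x z hx hz =>
    obtain ⟨M, hM⟩ := hx
    obtain ⟨N, hN⟩ := hz
    refine ⟨M + N, fun y => ?_⟩
    rw [mul_add, add_mul]
    exact (norm_add_le _ _).trans (add_le_add (hM y) (hN y))
  | h1 g a =>
    -- The constant is the square root of the norm of x x^* for x = a δ_g.
    refine ⟨√‖S.mulFun g (-g) a (star (a : A))‖, fun y => ?_⟩
    refine abs_le_of_sq_le_sq' ?_ (by positivity) |>.2
    have hsa : IsSelfAdjoint (S.mulFun g (-g) (a : A) (star (a : A))) :=
      IsSelfAdjoint.of_nonneg (S.mulFun_star_self_nonneg g _)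
    rw [mul_pow, Real.sq_sqrt (norm_nonneg _), regular_norm_sq, regular_norm_sq, star_mul,
      mul_assoc, ← mul_assoc (δ S g a), mul_star_δ, ← mul_assoc]
    refine (CStarAlgebra.norm_le_norm_of_nonneg_of_le ?_ (coeff_conj_le S y hsa)).trans_eq ?_
    · rw [← mul_star_δ, mul_assoc, mul_assoc, ← mul_assoc, ← star_mul]
      exact coeff_mul_star_nonneg S _
    · rw [norm_smul, norm_norm]

/-- The right regular representation. -/
def regular : S.SectionAlgebra →ₗ[ℂ] (S.SectionAlgebra →L[ℂ] S.SectionAlgebra) where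
  toFun x := LinearMap.mkContinuousOfExistsBound
    (LinearMap.mulRight ℂ x) (exists_regular_bound S x)
  map_add' x y := ContinuousLinearMap.ext fun z => mul_add z x y
  map_smul' c x := ContinuousLinearMap.ext fun z => mul_smul_comm c z x

/-- The `C*`-seminorm of the right regular representation. -/
def regularSeminorm : CStarSeminorm S.SectionAlgebra :=
  CStarSeminorm.ofAdjointable (A := A) (regular S)
    (fun x y => ContinuousLinearMap.ext fun z => (mul_assoc z x y).symm) fun x z y => by
      change coeff S (y * star (z * x)) = coeff S (y * star x * star z)
      rw [star_mul, mul_assoc]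

theorem norm_le_regularSeminorm (a : A) : ‖a‖ ≤ regularSeminorm S (incl S a) := by
  have norm_incl : ∀ b : A, ‖incl S b‖ = ‖b‖ := by
    intro b
    rw [← sq_eq_sq₀ (norm_nonneg _) (norm_nonneg _), regular_norm_sq, ← StarHomClass.map_star,
      ← map_mul, coeff_incl, CStarRing.norm_self_mul_star, sq]
  -- Right multiplication by a is tested on the vector a^*; since A sits isometrically in the
  -- module, this reads ‖a‖² ≤ p(a) ‖a‖.
  have h : ‖incl S (star a * a)‖ ≤ regularSeminorm S (incl S a) * ‖incl S (star a)‖ := by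
    rw [map_mul]
    exact (regular S (incl S a)).le_opNorm (incl S (star a))
  rw [norm_incl, norm_incl, CStarRing.norm_star_mul_self, norm_star] at h
  rcases (norm_nonneg a).eq_or_lt with h0 | h0
  · rw [← h0]; exact apply_nonneg _ _
  · exact le_of_mul_le_mul_right h h0

end RegularRepresentation

end SectionAlgebra

namespace CrossedProduct

open SectionAlgebra

/-- One inequality holds for every *-homomorphism of C*-algebras; the other because the maximal
seminorm dominates the regular one. -/
theorem norm_ι (a : A) : ‖ι S a‖ = ‖a‖ := by
  refine le_antisymm (NonUnitalStarAlgHom.norm_apply_le (ι S) a)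
    ((norm_le_regularSeminorm S a).trans ?_)
  refine (CStarSeminorm.le_maximal (SectionAlgebra.bounding S) (regularSeminorm S) (by simp)
    _).trans_eq ?_
  exact (CStarSeminorm.Completion.norm_ofHom _ _).symm

/-- By the C*-identity it suffices to compute x x^* or x^* x in A. The order is chosen so that
neither α nor L enters: x x^* = a a^* for g ≥ 0, and x^* x = a^* a for g < 0. -/
theorem norm_δ (g : G) (a : S.fiber g) : ‖δ S g a‖ = ‖(a : A)‖ := by
  rw [← sq_eq_sq₀ (norm_nonneg _) (norm_nonneg _), sq, sq]
  rcases le_or_gt 0 g with hg | hg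
  · rw [← CStarRing.norm_self_mul_star, ← CStarRing.norm_self_mul_star,
      ← S.mulFun_neg_right_of_nonneg hg, ← norm_ι S, ι, NonUnitalStarAlgHom.comp_apply,
      ← mul_star_δ, map_mul, StarHomClass.map_star]
    rfl
  · rw [← CStarRing.norm_star_mul_self, ← CStarRing.norm_star_mul_self (x := (a : A))]
    have h := S.mulFun_neg_right_of_nonneg (neg_nonneg.2 hg.le) (star (a : A)) a
    rw [neg_neg] at h
    rw [← h, ← norm_ι S, ι, NonUnitalStarAlgHom.comp_apply, ← star_δ_mul, map_mul,
      StarHomClass.map_star]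
    rfl

end CrossedProduct

end CornerSystem

/-! ### Representations of the Fell bundle from their values in non-negative degrees. -/

namespace CornerSystem

open CStarAlgebra

variable {G : Type*} [AddCommGroup G] [LinearOrder G] [IsOrderedAddMonoid G]
  {A : Type*} [NonUnitalCStarAlgebra A] [PartialOrder A] [StarOrderedRing A]
  (S : CornerSystem G A)

theorem pos_neg_neg_coe (t : PosCone G) : pos (- -(t : G)) = t := by rw [neg_neg, pos_coe]

theorem mem_fiber_coe {t : PosCone G} {a : A} :
    a ∈ S.fiber (t : G) ↔ (S.proj t).snd a = a := by
  rw [S.mem_fiber_of_nonneg t.2, pos_coe]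

/-- The detour through the adjoint avoids a separate case t = 0, in which -t counts as non-negative
in the definition of the fibre. -/
theorem mem_fiber_neg_coe {t : PosCone G} {a : A} :
    a ∈ S.fiber (-(t : G)) ↔ (S.proj t).fst a = a := by
  have h : a ∈ S.fiber (-(t : G)) ↔ star a ∈ S.fiber (t : G) :=
    ⟨fun h => by simpa using S.star_mem_fiber h, fun h => by simpa using S.star_mem_fiber h⟩
  rw [h, mem_fiber_coe, ← star_proj, star_inj]

theorem mulFun_coe_coe (s t : PosCone G) (a b : A) :
    S.mulFun (s : G) (t : G) a b = a * S.α s b := by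
  rw [mulFun, if_pos s.2, if_pos t.2, pos_coe]

/-- Reading the product off the formal triples u_s^* a u_t treats t = 0 together with t > 0; the
same device serves the following formulas. -/
theorem mulFun_neg_coe_coe (t : PosCone G) (a b : A) :
    S.mulFun (-(t : G)) (t : G) a b = S.L t (a * b) := by
  have h := S.tred_tmul_tri (-(t : G)) (t : G) a b
  rw [tri_of_nonpos (neg_nonpos.2 t.2), tri_of_nonneg t.2, neg_neg, tmul_of_le S le_rfl, sub_zero,
    zero_add, pos_zero, S.α_zero, tred, min_self, pos_coe] at h
  exact (congrArg (fun X : G × A × G => X.2.1) h).symm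

theorem mulFun_coe_neg_coe (t : PosCone G) (a b : A) :
    S.mulFun (t : G) (-(t : G)) a b = a * b :=
  S.mulFun_neg_right_of_nonneg t.2 a b

/-- L_t does not see p_t, because L_t(x α_t(e)) = L_t(x) e. -/
theorem L_snd (t : PosCone G) (x : A) : S.L t ((S.proj t).snd x) = S.L t x := by
  have := S.L_proj_add' t 0 x
  rwa [add_zero, proj_zero'] at this

theorem L_fst (t : PosCone G) (x : A) : S.L t ((S.proj t).fst x) = S.L t x := by
  have := S.L_proj_add t 0 x
  rwa [add_zero, proj_zero] at this

theorem star_snd (t : PosCone G) (x : A) :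
    star ((S.proj t).snd x) = (S.proj t).fst (star x) := by
  rw [← star_inj, star_star, star_proj, star_star]

theorem norm_snd_le (t : PosCone G) (a : A) : ‖(S.proj t).snd a‖ ≤ ‖a‖ := by
  refine le_of_tendsto ((S.proj_spec t).2 a).norm ?_
  filter_upwards [(increasingApproximateUnit A).eventually_norm] with e he
  exact (norm_mul_le _ _).trans (mul_le_of_le_one_right (norm_nonneg a)
    ((NonUnitalStarAlgHom.norm_apply_le _ e).trans he))

theorem mulFun_add_coe_neg_coe (r t : PosCone G) (a b : A) :
    S.mulFun ((r + t : PosCone G) : G) (-(t : G)) a b = a * S.α r b := by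
  have h := S.tred_tmul_tri ((r + t : PosCone G) : G) (-(t : G)) a b
  have e : ((r + t : PosCone G) : G) - (t : G) = (r : G) := add_sub_cancel_right _ _
  have hle : (t : G) ≤ ((r + t : PosCone G) : G) := le_add_of_nonneg_left r.2
  rw [tri_of_nonneg (r + t).2, tri_of_nonpos (neg_nonpos.2 t.2), neg_neg,
    tmul_of_le S hle, e, add_zero, pos_coe, tred_zero_left S r.2] at h
  exact (congrArg (fun X : G × A × G => X.2.1) h).symm

theorem mulFun_coe_neg_add_coe (r t : PosCone G) (a b : A) :
    S.mulFun (t : G) (-((r + t : PosCone G) : G)) a b = S.α r a * b := by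
  have h := S.star_mulFun ((r + t : PosCone G) : G) (-(t : G)) (star b) (star a)
  rw [neg_neg, star_star, star_star, mulFun_add_coe_neg_coe, star_mul, star_star, map_star,
    star_star] at h
  exact h.symm

theorem mulFun_neg_coe_add_coe (r t : PosCone G) (a b : A) :
    S.mulFun (-(t : G)) ((r + t : PosCone G) : G) a b = S.L t (a * b) := by
  have h := S.tred_tmul_tri (-(t : G)) ((r + t : PosCone G) : G) a b
  have e : (((0 : G), S.L t (a * b), (r : G)) : G × A × G) =
      S.tred ((t : G), a * b, ((r + t : PosCone G) : G)) := by
    have := S.tred_add le_rfl r.2 t.2 (a * b)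
    rw [zero_add, tred_zero_left S r.2, pos_coe] at this
    exact this.symm
  rw [tri_of_nonpos (neg_nonpos.2 t.2), tri_of_nonneg (r + t).2, neg_neg, tmul_of_le S le_rfl,
    sub_zero, zero_add, pos_zero, S.α_zero, ← e] at h
  exact (congrArg (fun X : G × A × G => X.2.1) h).symm

theorem mulFun_neg_add_coe_coe (r t : PosCone G) (a b : A) :
    S.mulFun (-((r + t : PosCone G) : G)) (t : G) a b = S.L t (a * b) := by
  have h := S.star_mulFun (-(t : G)) ((r + t : PosCone G) : G) (star b) (star a)
  rw [neg_neg, star_star, star_star, mulFun_neg_coe_add_coe,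
    ← PositiveLinearMap.map_star_of_cstar, star_mul, star_star, star_star] at h
  exact h.symm

theorem mulFun_neg_coe_neg_coe (s t : PosCone G) (a b : A) :
    S.mulFun (-(s : G)) (-(t : G)) a b = S.α t a * b := by
  have h := S.star_mulFun (t : G) (s : G) (star b) (star a)
  rw [star_star, star_star, mulFun_coe_coe, star_mul, star_star, map_star, star_star] at h
  exact h.symm

/-- A family of maps `D_t(a) = π(a) U_t` into a `C*`-algebra, subject to the relations of the Fell
bundle that involve at most one degree on each side. -/
structure IsFellRep {C : Type*} [NonUnitalCStarAlgebra C] (D : PosCone G → A →ₗ[ℂ] C) : Prop where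
  map_star : ∀ a, D 0 (star a) = star (D 0 a)
  mul : ∀ s t a b, D s a * D t b = D (s + t) (a * S.α s b)
  star_mul : ∀ t a b, star (D t a) * D t b = D 0 (S.L t (star a * b))
  mul_star : ∀ t a b, D t a * star (D t b) = D 0 ((S.proj t).snd a * star b)

namespace IsFellRep

variable {S} {C : Type*} [NonUnitalCStarAlgebra C] {D : PosCone G → A →ₗ[ℂ] C}

variable (D) in
/-- The maps of the fibres of the Fell bundle given by a family `D`. -/
def fiberMap (g : G) : A →ₗ[ℂ] C :=
  if 0 ≤ g then D (pos g)
  else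
    { toFun := fun a => star (D (pos (-g)) (star a))
      map_add' := fun a b => by simp
      map_smul' := fun c a => by simp }

theorem fiberMap_coe (t : PosCone G) (a : A) : fiberMap D (t : G) a = D t a := by
  rw [fiberMap, if_pos t.2, pos_coe]

theorem exists_coe (g : G) : ∃ t : PosCone G, g = t ∨ g = -(t : G) := by
  rcases le_total 0 g with h | h
  · exact ⟨⟨g, h⟩, .inl rfl⟩
  · exact ⟨⟨-g, neg_nonneg.2 h⟩, .inr (neg_neg g).symm⟩

/-- Totality of the order enters here; it reduces mixed products to the degrees r + s and s. -/
theorem exists_add (s t : PosCone G) : ∃ r, s = r + t ∨ t = r + s := by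
  rcases le_total s t with h | h
  · exact ⟨⟨t - s, sub_nonneg.2 h⟩, .inr (Subtype.ext (sub_add_cancel _ _).symm)⟩
  · exact ⟨⟨s - t, sub_nonneg.2 h⟩, .inl (Subtype.ext (sub_add_cancel _ _).symm)⟩

variable (S D) in
/-- The linear map of the section algebra given by a family `D`. -/
def sectionMap : S.SectionAlgebra →ₗ[ℂ] C :=
  DirectSum.toModule ℂ G C fun g => fiberMap D g ∘ₗ (S.fiber g).subtype

variable (S D) in
theorem sectionMap_δ (g : G) (a : S.fiber g) :
    sectionMap S D (SectionAlgebra.δ S g a) = fiberMap D g a :=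
  DirectSum.toModule_lof (M := fun g => S.fiber g) (N := C) ℂ
    (φ := fun g => fiberMap D g ∘ₗ (S.fiber g).subtype) g a

variable (hD : S.IsFellRep D)

/-- The representation of `A`. -/
def hom : A →⋆ₙₐ[ℂ] C :=
  { D 0 with
    map_zero' := _root_.map_zero (D 0)
    map_mul' := fun a b => by
      change D 0 (a * b) = D 0 a * D 0 b
      rw [hD.mul, S.α_zero, add_zero]
    map_star' := hD.map_star }

include hD

theorem norm_zero_le (a : A) : ‖D 0 a‖ ≤ ‖a‖ := NonUnitalStarAlgHom.norm_apply_le hD.hom a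

theorem norm_le (t : PosCone G) (a : A) : ‖D t a‖ ≤ ‖a‖ := by
  rw [← sq_le_sq₀ (norm_nonneg _) (norm_nonneg _), sq, ← CStarRing.norm_self_mul_star, hD.mul_star]
  refine (hD.norm_zero_le _).trans ((norm_mul_le _ _).trans ?_)
  rw [norm_star, sq]
  exact mul_le_mul_of_nonneg_right (S.norm_snd_le t a) (norm_nonneg a)

theorem continuous (t : PosCone G) : Continuous (D t) :=
  AddMonoidHomClass.continuous_of_bound (D t) 1 fun a => by rw [one_mul]; exact hD.norm_le t a

/-- The difference d satisfies d p_t = 0, so D_t(d) D_t(d)^* = D_0(d p_t d^*) = 0. -/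
theorem map_snd (t : PosCone G) (a : A) : D t ((S.proj t).snd a) = D t a := by
  rw [← sub_eq_zero, ← map_sub, ← CStarRing.mul_star_self_eq_zero_iff, hD.mul_star, map_sub,
    proj_idem', sub_self, zero_mul, _root_.map_zero]

/-- Elements a α_t(e) suffice, and for these the degree can be split: D_{s+r}(a α_{s+r}(e)) = D_s(a)
D_r(α_r(e)). -/
theorem tendsto (t : PosCone G) (a : A) :
    Tendsto (fun e => D t (a * S.α t e)) (approximateUnit A) (𝓝 (D t a)) := by
  have := ((hD.continuous t).tendsto _).comp ((S.proj_spec t).2 a)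
  rwa [hD.map_snd] at this

theorem star_mul_add (s r : PosCone G) (a b : A) :
    star (D s a) * D (r + s) b = D r (S.L s (star a * b)) := by
  refine tendsto_nhds_unique ((hD.tendsto (r + s) b).const_mul (star (D s a))) ?_
  -- The factor D_s(b) is split off on the left, where it meets D_s(a)^* in the same degree.
  have key : ∀ e, star (D s a) * D (r + s) (b * S.α (r + s) e) =
      D r (S.L s (star a * b) * S.α r e) := fun e => by
    rw [add_comm, S.α_add, ← hD.mul, ← mul_assoc, hD.star_mul, hD.mul, S.α_zero, zero_add]
  simp only [key]
  exact hD.tendsto r _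

theorem mul_star_add (r s : PosCone G) (a b : A) :
    D (r + s) a * star (D s b) = D r (a * S.α r (star ((S.proj s).snd b))) := by
  refine tendsto_nhds_unique ((hD.tendsto (r + s) a).mul_const (star (D s b))) ?_
  -- Here the factor of degree s is split off on the right, next to D_s(b)^*.
  have key : ∀ e, D (r + s) (a * S.α (r + s) e) * star (D s b) =
      D r (a * S.α r (S.α s e * star b)) := fun e => by
    rw [S.α_add, ← hD.mul, mul_assoc, hD.mul_star, hD.mul, add_zero, α_proj]
  simp only [key, star_snd]
  exact ((((hD.continuous r).comp (continuous_const_mul a)).comp (S.continuous_α r)).tendsto _).comp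
    ((S.proj_spec s).1 (star b))

theorem fiberMap_neg_coe (t : PosCone G) (a : A) :
    fiberMap D (-(t : G)) a = star (D t (star a)) := by
  by_cases ht : 0 ≤ -(t : G)
  -- In degree 0 both branches of the definition apply, and they agree since D_0 preserves adjoints.
  · have h0 : t = 0 := Subtype.ext (le_antisymm (neg_nonneg.1 ht) t.2)
    subst h0
    rw [fiberMap, if_pos ht, hD.map_star, star_star]
    simp [pos_zero]
  · rw [fiberMap, if_neg ht]
    change star (D (pos (- -(t : G))) (star a)) = _
    rw [pos_neg_neg_coe]

theorem fiberMap_star (g : G) (a : A) : fiberMap D (-g) (star a) = star (fiberMap D g a) := by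
  obtain ⟨t, rfl | rfl⟩ := exists_coe g
  · rw [hD.fiberMap_neg_coe, fiberMap_coe, star_star]
  · rw [hD.fiberMap_neg_coe, neg_neg, fiberMap_coe, star_star]

/-- The only sign pattern where membership in the fibres matters: D_s(a) D_t(b^*)^* produces p_s or
p_t between the factors, which a or b absorbs. -/
theorem fiberMap_mul_coe_neg_coe (s t : PosCone G) {a b : A} (ha : a ∈ S.fiber (s : G))
    (hb : b ∈ S.fiber (-(t : G))) :
    fiberMap D (s : G) a * fiberMap D (-(t : G)) b =
      fiberMap D ((s : G) + -(t : G)) (S.mulFun (s : G) (-(t : G)) a b) := by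
  rw [fiberMap_coe, hD.fiberMap_neg_coe]
  obtain ⟨r, rfl | rfl⟩ := exists_add s t
  · have e : ((r + t : PosCone G) : G) + -(t : G) = (r : G) := add_neg_cancel_right _ _
    rw [hD.mul_star_add, e, fiberMap_coe, mulFun_add_coe_neg_coe, star_snd, star_star,
      S.mem_fiber_neg_coe.1 hb]
  -- Taking adjoints moves the larger degree to the left, as in the other case.
  · have e : (s : G) + -((r + s : PosCone G) : G) = -(r : G) := by
      change (s : G) + -((r : G) + (s : G)) = -(r : G)
      abel
    rw [e, hD.fiberMap_neg_coe, mulFun_coe_neg_add_coe, ← star_inj, star_star, StarMul.star_mul,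
      star_star, hD.mul_star_add, S.mem_fiber_coe.1 ha, StarMul.star_mul, StarHomClass.map_star]

theorem fiberMap_mul_neg_coe_coe (s t : PosCone G) (a b : A) :
    fiberMap D (-(s : G)) a * fiberMap D (t : G) b =
      fiberMap D (-(s : G) + (t : G)) (S.mulFun (-(s : G)) (t : G) a b) := by
  rw [fiberMap_coe, hD.fiberMap_neg_coe]
  obtain ⟨r, rfl | rfl⟩ := exists_add s t
  · have e : -((r + t : PosCone G) : G) + (t : G) = -(r : G) := by
      change -((r : G) + (t : G)) + (t : G) = -(r : G)
      abel
    rw [e, hD.fiberMap_neg_coe, mulFun_neg_add_coe_coe, ← star_inj, star_star, StarMul.star_mul,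
      star_star, hD.star_mul_add, ← PositiveLinearMap.map_star_of_cstar, StarMul.star_mul]
  · have e : -(s : G) + ((r + s : PosCone G) : G) = (r : G) := by
      change -(s : G) + ((r : G) + (s : G)) = (r : G)
      abel
    rw [e, fiberMap_coe, mulFun_neg_coe_add_coe, hD.star_mul_add, star_star]

theorem fiberMap_mul {g h : G} {a b : A} (ha : a ∈ S.fiber g) (hb : b ∈ S.fiber h) :
    fiberMap D g a * fiberMap D h b = fiberMap D (g + h) (S.mulFun g h a b) := by
  obtain ⟨s, rfl | rfl⟩ := exists_coe g <;> obtain ⟨t, rfl | rfl⟩ := exists_coe h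
  · have e : (s : G) + (t : G) = ((s + t : PosCone G) : G) := rfl
    rw [e, fiberMap_coe, fiberMap_coe, fiberMap_coe, hD.mul, mulFun_coe_coe]
  · exact hD.fiberMap_mul_coe_neg_coe s t ha hb
  · exact hD.fiberMap_mul_neg_coe_coe s t a b
  · have e : -(s : G) + -(t : G) = -((t + s : PosCone G) : G) := (neg_add_rev _ _).symm
    rw [e, hD.fiberMap_neg_coe, hD.fiberMap_neg_coe, hD.fiberMap_neg_coe, ← StarMul.star_mul,
      hD.mul, mulFun_neg_coe_neg_coe, StarMul.star_mul, StarHomClass.map_star]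

/-- The `*`-homomorphism of the section algebra given by a family `D`. -/
def sectionHom : S.SectionAlgebra →⋆ₙₐ[ℂ] C :=
  let f := sectionMap S D
  have hf := sectionMap_δ S D
  { f with
    map_zero' := _root_.map_zero f
    map_mul' := fun x y => by
      change f (x * y) = f x * f y
      induction x using SectionAlgebra.ind with
      | h0 => simp only [zero_mul, _root_.map_zero]
      | h2 x x' hx hx' => simp only [add_mul, map_add, hx, hx']
      | h1 g a =>
        induction y using SectionAlgebra.ind with
        | h0 => simp only [mul_zero, _root_.map_zero]
        | h2 y y' hy hy' => simp only [mul_add, map_add, hy, hy']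
        | h1 h b => rw [SectionAlgebra.δ_mul_δ, hf, hf, hf, hD.fiberMap_mul a.2 b.2]
    map_star' := fun x => by
      change f (star x) = star (f x)
      induction x using SectionAlgebra.ind with
      | h0 => simp only [star_zero, _root_.map_zero]
      | h2 x y hx hy => simp only [star_add, map_add, hx, hy]
      | h1 g a => rw [SectionAlgebra.star_δ, hf, hf, hD.fiberMap_star] }

theorem sectionHom_δ (g : G) (a : S.fiber g) :
    hD.sectionHom (SectionAlgebra.δ S g a) = fiberMap D g a :=
  sectionMap_δ S D g a

/-- The `*`-homomorphism of the crossed product given by a family `D`. -/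
def crossedProductHom : S.CrossedProduct →⋆ₙₐ[ℂ] C :=
  CStarSeminorm.lift (SectionAlgebra.bounding S) hD.sectionHom (by simp)

theorem crossedProductHom_δ (g : G) (a : S.fiber g) :
    hD.crossedProductHom (CrossedProduct.δ S g a) = fiberMap D g a :=
  (CStarSeminorm.lift_ofHom _ _ _ _).trans (hD.sectionHom_δ g a)

end IsFellRep

/-! ### The family a ↦ a u_t inside the crossed product. -/

namespace CrossedProduct

/-- The continuous map `a ↦ a u_t` of `A` into the crossed product. -/
def Δ (t : PosCone G) : A →L[ℂ] S.CrossedProduct :=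
  LinearMap.mkContinuous
    { toFun := fun a => δ S (t : G) ⟨(S.proj t).snd a, S.mem_fiber_coe.2 (S.proj_idem' t a)⟩
      map_add' := fun a b => by
        rw [δ, δ, δ, ← map_add, ← map_add]
        congr 2
        exact Subtype.ext (map_add _ _ _)
      map_smul' := fun c a => by
        rw [δ, δ, RingHom.id_apply, ← map_smul, ← map_smul]
        congr 2
        exact Subtype.ext (map_smul _ _ _) } 1 fun a => by
    rw [one_mul]
    refine (norm_δ S _ _).trans_le ?_
    exact S.norm_snd_le t a

theorem Δ_apply (t : PosCone G) (a : A) :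
    Δ S t a = δ S (t : G) ⟨(S.proj t).snd a, S.mem_fiber_coe.2 (S.proj_idem' t a)⟩ := rfl

theorem Δ_of_mem (t : PosCone G) (a : S.fiber (t : G)) : Δ S t a = δ S (t : G) a := by
  rw [Δ_apply]
  congr 1
  exact Subtype.ext (S.mem_fiber_coe.1 a.2)

theorem Δ_snd (t : PosCone G) (a : A) : Δ S t ((S.proj t).snd a) = Δ S t a := by
  rw [Δ_apply, Δ_apply]
  congr 1
  exact Subtype.ext (S.proj_idem' t a)

theorem norm_Δ_le (t : PosCone G) (a : A) : ‖Δ S t a‖ ≤ ‖a‖ := by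
  refine ((Δ S t).le_opNorm a).trans (mul_le_of_le_one_left (norm_nonneg a) ?_)
  exact LinearMap.mkContinuous_norm_le _ zero_le_one _

theorem ι_apply (a : A) : ι S a = δ S 0 ⟨a, S.mem_fiber_zero a⟩ := rfl

theorem δ_congr {g h : G} (e : g = h) {a b : A} (ha : a ∈ S.fiber g) (hb : b ∈ S.fiber h)
    (hab : a = b) : δ S g ⟨a, ha⟩ = δ S h ⟨b, hb⟩ := by
  subst e; subst hab; rfl

theorem δ_mul_δ {g h : G} (a : S.fiber g) (b : S.fiber h) :
    δ S g a * δ S h b = δ S (g + h) ⟨S.mulFun g h a b, S.mulFun_mem a.2 b.2⟩ := by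
  rw [δ, δ, ← map_mul, SectionAlgebra.δ_mul_δ]; rfl

theorem star_δ {g : G} (a : S.fiber g) :
    star (δ S g a) = δ S (-g) ⟨star (a : A), S.star_mem_fiber a.2⟩ := by
  rw [δ, ← StarHomClass.map_star, SectionAlgebra.star_δ]; rfl

theorem Δ_zero (a : A) : Δ S 0 a = ι S a :=
  δ_congr S rfl _ _ (S.proj_zero' a)

/-- The inner projection p_s is absorbed by α_s, and α_s(b p_t) = α_s(b) p_{s+t}. -/
theorem Δ_mul_Δ (s t : PosCone G) (a b : A) :
    Δ S s a * Δ S t b = Δ S (s + t) (a * S.α s b) := by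
  rw [Δ_apply, Δ_apply, δ_mul_δ, Δ_apply]
  refine δ_congr S rfl _ _ ?_
  change S.mulFun _ _ ((S.proj s).snd a) ((S.proj t).snd b) = _
  rw [mulFun_coe_coe, mul_proj_mul, proj_α, ← α_proj_add, mul_proj]

theorem ι_mul_Δ (t : PosCone G) (a b : A) : ι S a * Δ S t b = Δ S t (a * b) := by
  rw [← Δ_zero, Δ_mul_Δ, S.α_zero, zero_add]

theorem Δ_mul_ι (t : PosCone G) (a b : A) : Δ S t a * ι S b = Δ S t (a * S.α t b) := by
  rw [← Δ_zero, Δ_mul_Δ, add_zero]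

theorem Δ_mul_star_Δ (t : PosCone G) (a b : A) :
    Δ S t a * star (Δ S t b) = ι S ((S.proj t).snd a * star b) := by
  rw [Δ_apply, Δ_apply, star_δ, δ_mul_δ, ι_apply]
  refine δ_congr S (add_neg_cancel _) _ _ ?_
  change S.mulFun _ _ ((S.proj t).snd a) (star ((S.proj t).snd b)) = _
  rw [mulFun_coe_neg_coe]
  rw [star_snd, ← mul_proj_mul, proj_idem']

theorem star_Δ_mul_Δ (t : PosCone G) (a b : A) :
    star (Δ S t a) * Δ S t b = ι S (S.L t (star a * b)) := by
  rw [Δ_apply, Δ_apply, star_δ, δ_mul_δ, ι_apply]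
  refine δ_congr S (neg_add_cancel _) _ _ ?_
  change S.mulFun _ _ (star ((S.proj t).snd a)) ((S.proj t).snd b) = _
  rw [mulFun_neg_coe_coe, ← mul_proj, L_snd, star_snd, ← proj_mul, L_fst]

theorem star_Δ_of_mem (t : PosCone G) (a : S.fiber (-(t : G))) :
    star (Δ S t (star (a : A))) = δ S (-(t : G)) a := by
  rw [Δ_apply, star_δ]
  refine δ_congr S rfl _ _ ?_
  change star ((S.proj t).snd (star (a : A))) = a
  rw [star_snd, star_star, S.mem_fiber_neg_coe.1 a.2]

theorem dense_span_δ :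
    Dense (Submodule.span ℂ {x | ∃ g a, x = δ S g a} : Set S.CrossedProduct) := by
  refine Dense.mono ?_ (CStarSeminorm.denseRange_ofHom
    (CStarSeminorm.maximal (SectionAlgebra.bounding S)))
  rintro _ ⟨x, rfl⟩
  change ofSection S x ∈ Submodule.span ℂ {x | ∃ g a, x = δ S g a}
  induction x using SectionAlgebra.ind with
  | h0 => rw [map_zero]; exact Submodule.zero_mem _
  | h2 x y hx hy => rw [map_add]; exact Submodule.add_mem _ hx hy
  | h1 g a => exact Submodule.subset_span ⟨g, a, rfl⟩

/-- Reduces statements about homogeneous elements to Δ_t(b) and its adjoint. -/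
theorem δ_eq (g : G) (a : S.fiber g) :
    (∃ (t : PosCone G) (b : A), δ S g a = Δ S t b) ∨
      ∃ (t : PosCone G) (b : A), δ S g a = star (Δ S t b) := by
  rcases le_total 0 g with hg | hg
  · exact .inl ⟨⟨g, hg⟩, a, (Δ_of_mem S ⟨g, hg⟩ a).symm⟩
  · have ha : (a : A) ∈ S.fiber (-((⟨-g, neg_nonneg.2 hg⟩ : PosCone G) : G)) := by
      simp
    exact .inr ⟨⟨-g, neg_nonneg.2 hg⟩, star (a : A),
      (δ_congr S (by simp) a.2 ha rfl).trans (star_Δ_of_mem S _ ⟨a, ha⟩).symm⟩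


/-- Makes the limit and mixed-degree formulas for abstract families available for Δ. -/
theorem isFellRep : S.IsFellRep (fun t => (Δ S t : A →ₗ[ℂ] S.CrossedProduct)) where
  map_star a := by
    change Δ S 0 (star a) = star (Δ S 0 a)
    rw [Δ_zero, Δ_zero, StarHomClass.map_star]
  mul := Δ_mul_Δ S
  star_mul t a b := (star_Δ_mul_Δ S t a b).trans (Δ_zero S _).symm
  mul_star t a b := (Δ_mul_star_Δ S t a b).trans (Δ_zero S _).symm

end CrossedProduct

end CornerSystem

/-! ### The partial isometries u_t and the dense subalgebra of polynomials in them. -/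

namespace CornerSystem

open CStarAlgebra

variable {G : Type*} [AddCommGroup G] [LinearOrder G] [IsOrderedAddMonoid G]
  {A : Type*} [NonUnitalCStarAlgebra A] [PartialOrder A] [StarOrderedRing A]
  (S : CornerSystem G A)

namespace CrossedProduct

open DoubleCentralizer

theorem tendsto_ι_mul_Δ (t : PosCone G) (b : A) :
    Tendsto (fun e => ι S e * Δ S t b) (approximateUnit A) (𝓝 (Δ S t b)) := by
  simp only [ι_mul_Δ]
  exact ((Δ S t).continuous.tendsto b).comp ((increasingApproximateUnit A).tendsto_mul_right b)

/-- This is the adjoint of Δ_t(b) ι(e) = Δ_t(b α_t(e)) → Δ_t(b). -/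
theorem tendsto_ι_mul_star_Δ (t : PosCone G) (b : A) :
    Tendsto (fun e => ι S e * star (Δ S t b)) (approximateUnit A) (𝓝 (star (Δ S t b))) := by
  refine (((isFellRep S).tendsto t b).star).congr' ?_
  filter_upwards [(increasingApproximateUnit A).eventually_star_eq] with e he
  change star (Δ S t (b * S.α t e)) = _
  rw [← Δ_mul_ι, star_mul, ← StarHomClass.map_star, he]

/-- The net is bounded and acts as a left approximate unit on the homogeneous elements, whose span
is dense. -/
theorem tendsto_ι_mul (x : S.CrossedProduct) :
    Tendsto (fun e => ι S e * x) (approximateUnit A) (𝓝 x) := by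
  have hlim : ∀ x ∈ {x | ∃ g a, x = δ S g a},
      Tendsto (fun e => ι S e * x) (approximateUnit A) (𝓝 x) := by
    rintro _ ⟨g, a, rfl⟩
    rcases δ_eq S g a with ⟨t, b, h⟩ | ⟨t, b, h⟩ <;> rw [h]
    · exact tendsto_ι_mul_Δ S t b
    · exact tendsto_ι_mul_star_Δ S t b
  obtain ⟨R, hR⟩ := exists_tendsto_of_dense_span (l := approximateUnit A)
    (T := fun e => ContinuousLinearMap.mul ℂ S.CrossedProduct (ι S e)) (C := 1)
    ((increasingApproximateUnit A).eventually_norm.mono fun e he =>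
      (ContinuousLinearMap.opNorm_mul_apply_le ℂ _ _).trans
        ((NonUnitalStarAlgHom.norm_apply_le (ι S) e).trans he))
    (dense_span_δ S) fun x hx => ⟨x, hlim x hx⟩
  have : R = ContinuousLinearMap.id ℂ _ := ContinuousLinearMap.ext_on (dense_span_δ S)
    fun x hx => tendsto_nhds_unique (hR x) (hlim x hx)
  simpa [this] using hR x

/-- A multiplier is recovered from its action on A by m x = lim (m ι(e)) x. -/
theorem eq_of_mul_ι {m n : 𝓜(ℂ, S.CrossedProduct)}
    (h : ∀ a, m * (ι S a : 𝓜(ℂ, S.CrossedProduct)) = n * (ι S a : 𝓜(ℂ, S.CrossedProduct))) :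
    m = n := by
  have h1 : ∀ a, m.fst (ι S a) = n.fst (ι S a) := fun a => by
    rw [← coe_inj, ← mul_coe, ← mul_coe, h]
  refine eq_of_fst fun x => ?_
  have key : ∀ m : 𝓜(ℂ, S.CrossedProduct),
      Tendsto (fun e => m.fst (ι S e) * x) (approximateUnit A) (𝓝 (m.fst x)) := fun m => by
    simp only [← fst_mul]
    exact (m.fst.continuous.tendsto x).comp (tendsto_ι_mul S x)
  refine tendsto_nhds_unique (key m) ?_
  simp only [h1]
  exact key n

theorem eq_of_ι_mul {m n : 𝓜(ℂ, S.CrossedProduct)}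
    (h : ∀ a, (ι S a : 𝓜(ℂ, S.CrossedProduct)) * m = (ι S a : 𝓜(ℂ, S.CrossedProduct)) * n) :
    m = n := by
  rw [← star_inj]
  refine eq_of_mul_ι S fun a => ?_
  rw [← star_inj, star_mul, star_mul, star_star, star_star, ← coe_star, ← StarHomClass.map_star, h]

/-- The net Δ_t(α_t(e)), which should be u_t e, is bounded by 1. Strict convergence is checked on
the elements Δ_s(b) and Δ_s(b)^*, where the mixed-degree formulas turn it into strict convergence of
e or of α(e) in A. -/
theorem exists_multiplier (t : PosCone G) : ∃ u : 𝓜(ℂ, S.CrossedProduct),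
    ∀ a, (ι S a : 𝓜(ℂ, S.CrossedProduct)) * u = (Δ S t a : S.CrossedProduct) ∧
      u * (ι S a : 𝓜(ℂ, S.CrossedProduct)) = (Δ S t (S.α t a) : S.CrossedProduct) := by
  have hl := increasingApproximateUnit A
  have hF := isFellRep S
  have hm : ∀ᶠ e in approximateUnit A, ‖Δ S t (S.α t e)‖ ≤ 1 := by
    filter_upwards [hl.eventually_norm] with e he
    exact (norm_Δ_le S t _).trans ((NonUnitalStarAlgHom.norm_apply_le _ e).trans he)
  have c : ∀ s, Continuous (Δ S s) := fun s => (Δ S s).continuous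
  have e1 : ∀ r s a b, Δ S (r + s) a * star (Δ S s b) =
      Δ S r (a * S.α r (star ((S.proj s).snd b))) := hF.mul_star_add
  have e2 : ∀ r s a b, star (Δ S s a) * Δ S (r + s) b = Δ S r (S.L s (star a * b)) :=
    fun r s => hF.star_mul_add s r
  obtain ⟨u, hu1, hu2⟩ := DoubleCentralizer.exists_tendsto hm (dense_span_δ S)
    (by
      rintro _ ⟨g, a, rfl⟩
      rcases δ_eq S g a with ⟨s, b, h⟩ | ⟨s, b, h⟩ <;> rw [h]
      -- The expected value of u_t (b u_s) is α_t(b) u_{t+s}.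
      · refine ⟨Δ S (t + s) (S.α t b), ?_⟩
        simp only [Δ_mul_Δ, ← map_mul]
        exact (((c _).comp (S.continuous_α t)).tendsto b).comp (hl.tendsto_mul_right b)
      · obtain ⟨r, rfl | rfl⟩ := IsFellRep.exists_add t s
        · simp only [e1, S.α_add, ← map_mul, star_snd]
          exact ⟨_, (((c _).comp (S.continuous_α r)).tendsto _).comp ((S.proj_spec s).1 _)⟩
        -- Here t is the smaller degree, and the value of u_t (b u_{r+t})^* is (b p_{r+t} u_r)^*.
        · refine ⟨star (Δ S r ((S.proj (r + t)).snd b)), ?_⟩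
          refine (((c r).tendsto _).comp ((S.proj_spec (r + t)).2 b)).star.congr' ?_
          filter_upwards [hl.eventually_star_eq] with e he
          have h1 := congrArg star (e1 r t b (S.α t e))
          rw [star_mul, star_star, α_proj, ← map_star (S.α t) e, he, ← S.α_add] at h1
          exact h1.symm)
    (by
      rintro _ ⟨g, a, rfl⟩
      rcases δ_eq S g a with ⟨s, b, h⟩ | ⟨s, b, h⟩ <;> rw [h]
      · simp only [Δ_mul_Δ, ← S.α_add]
        exact ⟨_, ((c _).tendsto _).comp ((S.proj_spec (s + t)).2 b)⟩
      · obtain ⟨r, rfl | rfl⟩ := IsFellRep.exists_add s t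
        -- The value of (b u_{r+t})^* u_t is (L_t(b) u_r)^*; the transfer rule L_t(α_t(e) b) = e
        -- L_t(b) gives the convergence.
        · refine ⟨star (Δ S r (S.L t b)), ?_⟩
          have hr : Tendsto (fun e => star (Δ S r (S.L t (S.α t (star e) * b))))
              (approximateUnit A) (𝓝 (star (Δ S r (S.L t b)))) := by
            simp only [(S.corner t).exel _ _]
            refine (((c _).tendsto _).comp ?_).star
            refine (hl.tendsto_mul_right _).congr' ?_
            filter_upwards [hl.eventually_star_eq] with e he
            rw [he]
          refine hr.congr fun e => ?_
          rw [map_star, ← e2, star_mul, star_star]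
        · simp only [e2]
          exact ⟨_, (((c _).comp (S.continuous_L s)).tendsto _).comp
            ((S.proj_spec (r + s)).2 (star b))⟩)
  refine ⟨u, fun a => ⟨?_, ?_⟩⟩
  · rw [coe_mul, coe_inj]
    refine tendsto_nhds_unique (hu2 _) ?_
    simp only [ι_mul_Δ]
    exact hF.tendsto t a
  · rw [mul_coe, coe_inj]
    refine tendsto_nhds_unique (hu1 _) ?_
    simp only [Δ_mul_ι, ← map_mul]
    exact (((c _).comp (S.continuous_α t)).tendsto a).comp (hl.tendsto_mul_right a)

/-- The partial isometries `u_t` of the multiplier algebra of the crossed product. -/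
def u (t : PosCone G) : 𝓜(ℂ, S.CrossedProduct) := (exists_multiplier S t).choose

theorem ι_mul_u (t : PosCone G) (a : A) :
    (ι S a : 𝓜(ℂ, S.CrossedProduct)) * u S t = (Δ S t a : S.CrossedProduct) :=
  ((exists_multiplier S t).choose_spec a).1

theorem u_mul_ι (t : PosCone G) (a : A) :
    u S t * (ι S a : 𝓜(ℂ, S.CrossedProduct)) = (Δ S t (S.α t a) : S.CrossedProduct) :=
  ((exists_multiplier S t).choose_spec a).2

theorem star_u_mul_ι (t : PosCone G) (a : A) :
    star (u S t) * (ι S a : 𝓜(ℂ, S.CrossedProduct)) =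
      (star (Δ S t (star a)) : S.CrossedProduct) := by
  rw [coe_star, ← ι_mul_u, star_mul, ← coe_star, ← StarHomClass.map_star, star_star]

theorem u_zero : u S 0 = 1 :=
  eq_of_ι_mul S fun a => by rw [ι_mul_u, mul_one, Δ_zero]

/-- Between ι(a) and ι(b) each u can be absorbed by its neighbour, and both sides become Δ_{s+t}(a
α_{s+t}(b)). -/
theorem u_add (s t : PosCone G) : u S (s + t) = u S s * u S t := by
  refine eq_of_ι_mul S fun a => eq_of_mul_ι S fun b => ?_
  rw [← mul_assoc, ι_mul_u, ι_mul_u, mul_assoc, u_mul_ι, coe_mul_coe_eq, coe_mul_coe_eq, Δ_mul_ι,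
    Δ_mul_Δ, S.α_add]

/-- This identifies u_t u_t^* with p_t, from which u_t is seen to be a partial isometry. -/
theorem ι_mul_u_mul_star_u (t : PosCone G) (a : A) :
    (ι S a : 𝓜(ℂ, S.CrossedProduct)) * u S t * star (u S t) =
      (ι S ((S.proj t).snd a) : S.CrossedProduct) := by
  refine eq_of_mul_ι S fun b => ?_
  rw [mul_assoc, star_u_mul_ι, ι_mul_u, coe_mul_coe_eq, coe_mul_coe_eq,
    Δ_mul_star_Δ, star_star, map_mul]

theorem u_mul_star_u_mul_u (t : PosCone G) : u S t * star (u S t) * u S t = u S t := by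
  refine eq_of_ι_mul S fun a => ?_
  rw [← mul_assoc, ← mul_assoc, ι_mul_u_mul_star_u, ι_mul_u, ι_mul_u, Δ_snd]

theorem u_conj (t : PosCone G) (a : A) :
    u S t * (ι S a : 𝓜(ℂ, S.CrossedProduct)) * star (u S t) =
      (ι S (S.α t a) : S.CrossedProduct) := by
  refine eq_of_mul_ι S fun b => ?_
  rw [mul_assoc, star_u_mul_ι, u_mul_ι, coe_mul_coe_eq, coe_mul_coe_eq,
    Δ_mul_star_Δ, star_star, α_proj, map_mul]

theorem u_conj_star (t : PosCone G) (a : A) :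
    star (u S t) * (ι S a : 𝓜(ℂ, S.CrossedProduct)) * u S t =
      (ι S (S.L t a) : S.CrossedProduct) := by
  refine eq_of_mul_ι S fun b => ?_
  rw [mul_assoc, star_u_mul_ι, u_mul_ι, coe_mul_coe_eq, coe_mul_coe_eq, star_Δ_mul_Δ, star_star,
    (S.corner t).exel_right, map_mul]

theorem δ_eq_ι_mul_u (t : PosCone G) (a : S.fiber (t : G)) :
    (δ S (t : G) a : 𝓜(ℂ, S.CrossedProduct)) = (ι S a : 𝓜(ℂ, S.CrossedProduct)) * u S t := by
  rw [ι_mul_u, Δ_of_mem]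

theorem δ_eq_star_u_mul_ι (t : PosCone G) (a : S.fiber (-(t : G))) :
    (δ S (-(t : G)) a : 𝓜(ℂ, S.CrossedProduct)) =
      star (u S t) * (ι S a : 𝓜(ℂ, S.CrossedProduct)) := by
  rw [star_u_mul_ι, star_Δ_of_mem]

/-- The elements `∑ u_t^* b_t + a₀ + ∑ a_t u_t`. -/
def IsPolynomial (x : S.CrossedProduct) : Prop :=
  ∃ (F : Finset (PosCone G)) (b a : PosCone G → A) (a₀ : A), 0 ∉ F ∧
    (∀ t ∈ F, b t ∈ S.fiber (-(t : G))) ∧ (∀ t ∈ F, a t ∈ S.fiber (t : G)) ∧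
    (x : 𝓜(ℂ, S.CrossedProduct)) =
      ∑ t ∈ F, star (u S t) * (ι S (b t) : 𝓜(ℂ, S.CrossedProduct)) +
      (ι S a₀ : 𝓜(ℂ, S.CrossedProduct)) +
      ∑ t ∈ F, (ι S (a t) : 𝓜(ℂ, S.CrossedProduct)) * u S t

theorem coe_add (x y : S.CrossedProduct) : ((x + y : S.CrossedProduct) : 𝓜(ℂ, S.CrossedProduct)) =
    (x : 𝓜(ℂ, S.CrossedProduct)) + (y : 𝓜(ℂ, S.CrossedProduct)) :=
  map_add (coeHom (𝕜 := ℂ) (A := S.CrossedProduct)) x y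

theorem coe_zero : ((0 : S.CrossedProduct) : 𝓜(ℂ, S.CrossedProduct)) = 0 :=
  map_zero (coeHom (𝕜 := ℂ) (A := S.CrossedProduct))

theorem coe_sum {ι' : Type*} (F : Finset ι') (f : ι' → S.CrossedProduct) :
    ((∑ i ∈ F, f i : S.CrossedProduct) : 𝓜(ℂ, S.CrossedProduct)) =
      ∑ i ∈ F, (f i : 𝓜(ℂ, S.CrossedProduct)) :=
  map_sum (coeHom (𝕜 := ℂ) (A := S.CrossedProduct)) f F

theorem isPolynomial_δ (g : G) (a : S.fiber g) : IsPolynomial S (δ S g a) := by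
  classical
  rcases lt_trichotomy g 0 with hg | rfl | hg
  · have hm : (a : A) ∈ S.fiber (-((⟨-g, neg_nonneg.2 hg.le⟩ : PosCone G) : G)) := by simp
    refine ⟨{⟨-g, neg_nonneg.2 hg.le⟩}, fun _ => a, 0, 0, ?_, ?_, fun _ _ => Submodule.zero_mem _,
      ?_⟩
    · rw [Finset.mem_singleton]
      intro h
      have := congrArg Subtype.val h
      exact hg.ne (neg_eq_zero.1 this.symm)
    · intro t ht
      rw [Finset.mem_singleton.1 ht]
      exact hm
    · rw [Finset.sum_singleton, Finset.sum_singleton, ← δ_eq_star_u_mul_ι S _ ⟨_, hm⟩]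
      simp only [Pi.zero_apply, map_zero, coe_zero, zero_mul, add_zero]
      rw [coe_inj]
      exact δ_congr S (by simp) _ _ rfl
  · refine ⟨∅, 0, 0, a, by simp, by simp, by simp, ?_⟩
    simp only [Finset.sum_empty, zero_add, add_zero]
    rfl
  · refine ⟨{⟨g, hg.le⟩}, 0, fun _ => a, 0, ?_, fun _ _ => Submodule.zero_mem _, ?_, ?_⟩
    · rw [Finset.mem_singleton]
      intro h
      exact hg.ne (congrArg Subtype.val h)
    · intro t ht
      rw [Finset.mem_singleton.1 ht]
      exact a.2
    · rw [Finset.sum_singleton, Finset.sum_singleton, ← δ_eq_ι_mul_u S ⟨g, hg.le⟩ a]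
      simp only [Pi.zero_apply, map_zero, coe_zero, mul_zero, zero_add]

theorem IsPolynomial.add {x y : S.CrossedProduct} (hx : IsPolynomial S x)
    (hy : IsPolynomial S y) : IsPolynomial S (x + y) := by
  classical
  obtain ⟨F, b, a, a₀, h0, hb, ha, hx⟩ := hx
  obtain ⟨F', b', a', a₀', h0', hb', ha', hy⟩ := hy
  refine ⟨F ∪ F', fun t => (if t ∈ F then b t else 0) + if t ∈ F' then b' t else 0,
    fun t => (if t ∈ F then a t else 0) + if t ∈ F' then a' t else 0, a₀ + a₀', ?_, ?_, ?_, ?_⟩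
  · simp [h0, h0']
  · intro t _
    refine Submodule.add_mem _ ?_ ?_
    · split_ifs with h
      exacts [hb t h, Submodule.zero_mem _]
    · split_ifs with h
      exacts [hb' t h, Submodule.zero_mem _]
  · intro t _
    refine Submodule.add_mem _ ?_ ?_
    · split_ifs with h
      exacts [ha t h, Submodule.zero_mem _]
    · split_ifs with h
      exacts [ha' t h, Submodule.zero_mem _]
  -- Coefficients are extended by 0 from F and F' to the union; this does not change the sums.
  · have ext : ∀ (E : Finset (PosCone G)) (f : PosCone G → A)
        (φ : PosCone G → A → 𝓜(ℂ, S.CrossedProduct)), (∀ t, φ t 0 = 0) → E ⊆ F ∪ F' →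
        ∑ t ∈ F ∪ F', φ t (if t ∈ E then f t else 0) = ∑ t ∈ E, φ t (f t) := by
      intro E f φ hφ hE
      rw [← Finset.sum_subset hE fun t _ ht => by rw [if_neg ht, hφ]]
      exact Finset.sum_congr rfl fun t ht => by rw [if_pos ht]
    have z1 : ∀ t, star (u S t) * (ι S 0 : 𝓜(ℂ, S.CrossedProduct)) = 0 := fun t => by
      rw [map_zero, coe_zero, mul_zero]
    have z2 : ∀ t, (ι S 0 : 𝓜(ℂ, S.CrossedProduct)) * u S t = 0 := fun t => by
      rw [map_zero, coe_zero, zero_mul]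
    simp only [map_add, coe_add, mul_add, add_mul, Finset.sum_add_distrib]
    rw [ext F b (fun t x => star (u S t) * (ι S x : 𝓜(ℂ, S.CrossedProduct))) z1
        Finset.subset_union_left,
      ext F' b' (fun t x => star (u S t) * (ι S x : 𝓜(ℂ, S.CrossedProduct))) z1
        Finset.subset_union_right,
      ext F a (fun t x => (ι S x : 𝓜(ℂ, S.CrossedProduct)) * u S t) z2
        Finset.subset_union_left,
      ext F' a' (fun t x => (ι S x : 𝓜(ℂ, S.CrossedProduct)) * u S t) z2
        Finset.subset_union_right, hx, hy]
    abel

/-- The polynomials are the image of the section algebra, so closure under products and adjoints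
comes for free. -/
theorem mem_range_ofSection_iff (x : S.CrossedProduct) :
    x ∈ NonUnitalStarAlgHom.range (ofSection S) ↔ IsPolynomial S x := by
  rw [NonUnitalStarAlgHom.mem_range]
  constructor
  · rintro ⟨y, rfl⟩
    induction y using SectionAlgebra.ind with
    | h0 => exact ⟨∅, 0, 0, 0, by simp, by simp, by simp, by simp [coe_zero]⟩
    | h2 y z hy hz => rw [map_add]; exact hy.add S hz
    | h1 g a => exact isPolynomial_δ S g a
  · rintro ⟨F, b, a, a₀, -, hb, ha, h⟩
    refine ⟨∑ t ∈ F.attach, SectionAlgebra.δ S (-(t : PosCone G).1) ⟨b t, hb t t.2⟩ +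
      SectionAlgebra.incl S a₀ +
      ∑ t ∈ F.attach, SectionAlgebra.δ S (t : PosCone G).1 ⟨a t, ha t t.2⟩, ?_⟩
    rw [← coe_inj, h, map_add, map_add, map_sum, map_sum, coe_add, coe_add, coe_sum, coe_sum,
      ← Finset.sum_attach F, ← Finset.sum_attach F (fun t => _ * _)]
    congr 1
    · congr 1
      exact Finset.sum_congr rfl fun t _ => δ_eq_star_u_mul_ι S t ⟨b t, hb t t.2⟩
    · exact Finset.sum_congr rfl fun t _ => δ_eq_ι_mul_u S t ⟨a t, ha t t.2⟩

end CrossedProduct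

end CornerSystem

/-! ### Covariant pairs and non-degenerate representations of the crossed product. -/

namespace CornerSystem

open CStarAlgebra DoubleCentralizer

variable {G : Type*} [AddCommGroup G] [LinearOrder G] [IsOrderedAddMonoid G]
  {A : Type*} [NonUnitalCStarAlgebra A] [PartialOrder A] [StarOrderedRing A]
  {S : CornerSystem G A}
  {H : Type*} [NormedAddCommGroup H] [InnerProductSpace ℂ H] [CompleteSpace H]

namespace IsCovariantPair

variable {π : A →⋆ₙₐ[ℂ] (H →L[ℂ] H)} {U : PosCone G → (H →L[ℂ] H)}

variable (π U) in
/-- The maps `a ↦ π(a) U_t`. -/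
def mulMap (t : PosCone G) : A →ₗ[ℂ] (H →L[ℂ] H) where
  toFun a := π a * U t
  map_add' a b := by rw [_root_.map_add, add_mul]
  map_smul' c a := by rw [map_smul, smul_mul_assoc, RingHom.id_apply]

theorem mulMap_apply (t : PosCone G) (a : A) : mulMap π U t a = π a * U t := rfl

variable (hU : S.IsCovariantPair π U)

include hU

theorem eq_of_mul_map {T R : H →L[ℂ] H} (h : ∀ a, T * π a = R * π a) : T = R :=
  eq_of_nondegenerate hU.nondegenerate h

/-- `π(e)` converges to the identity on vectors. -/
theorem tendsto_map (ξ : H) : Tendsto (fun e => π e ξ) (approximateUnit A) (𝓝 ξ) := by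
  have hlim : ∀ x ∈ {η : H | ∃ b ξ, η = π b ξ},
      Tendsto (fun e => π e x) (approximateUnit A) (𝓝 x) := by
    rintro _ ⟨b, ξ, rfl⟩
    have h : Tendsto (fun e => π (e * b)) (approximateUnit A) (𝓝 (π b)) :=
      ((continuous_rep π).tendsto b).comp ((increasingApproximateUnit A).tendsto_mul_right b)
    simp only [map_mul] at h
    exact ((ContinuousLinearMap.apply ℂ H ξ).continuous.tendsto (π b)).comp h
  obtain ⟨R, hR⟩ := exists_tendsto_of_dense_span (l := approximateUnit A)
    (T := fun e => π e) (C := 1)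
    ((increasingApproximateUnit A).eventually_norm.mono fun e he =>
      (NonUnitalStarAlgHom.norm_apply_le π e).trans he)
    hU.nondegenerate fun x hx => ⟨x, hlim x hx⟩
  have : R = ContinuousLinearMap.id ℂ _ := ContinuousLinearMap.ext_on hU.nondegenerate
    fun x hx => tendsto_nhds_unique (hR x) (hlim x hx)
  simpa [this] using hR ξ

/-- Strong limits along the approximate unit. -/
theorem eq_of_tendsto {T R Q : H →L[ℂ] H}
    (h : Tendsto (fun e => T * π e * R) (approximateUnit A) (𝓝 Q)) : T * R = Q := by
  refine ContinuousLinearMap.ext fun ξ => ?_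
  refine tendsto_nhds_unique ((T.continuous.tendsto _).comp (hU.tendsto_map (R ξ))) ?_
  exact ((ContinuousLinearMap.apply ℂ H ξ).continuous.tendsto Q).comp h

/-- Insert π(e) → 1 strongly between U_t and U_t^*: covariance turns the product into π(α_t(e) a),
which tends to π(p_t a). -/
theorem mul_star_mul_map (t : PosCone G) (a : A) :
    U t * star (U t) * π a = π ((S.proj t).fst a) := by
  rw [mul_assoc]
  refine hU.eq_of_tendsto ?_
  simp only [← mul_assoc, hU.conj, ← map_mul]
  exact ((continuous_rep π).tendsto _).comp ((S.proj_spec t).1 a)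

/-- The same insertion, with U_t^* π(e) U_t = π(L_t(e)) and L_t(e) a = L_t(e α_t(a)). -/
theorem star_mul_mul_map (t : PosCone G) (a : A) :
    star (U t) * U t * π a = π (S.L t (S.α t a)) := by
  rw [mul_assoc]
  refine hU.eq_of_tendsto ?_
  simp only [← mul_assoc, hU.conj_star, ← map_mul, ← (S.corner t).exel_right _ _]
  exact (((continuous_rep π).comp (S.continuous_L t)).tendsto _).comp
    ((increasingApproximateUnit A).tendsto_mul_right _)

/-- U_t^* U_t π(a) = π(L_t(α_t(a))); the adjoint of this identity at a^* has the same right side. -/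
theorem map_mul_star_mul (t : PosCone G) (a : A) :
    π a * (star (U t) * U t) = star (U t) * U t * π a := by
  have h := congrArg star (hU.star_mul_mul_map t (star a))
  rw [star_mul, star_mul, star_star, ← StarHomClass.map_star, ← StarHomClass.map_star, star_star,
    ← PositiveLinearMap.map_star_of_cstar, ← map_star (S.α t) (star a), star_star] at h
  rw [h, hU.star_mul_mul_map]

/-- That U_t is a partial isometry is not part of the definition. P = U_t U_t^* acts on π(A) as p_t,
so P² = P, and the defect T = U_t U_t^* U_t - U_t satisfies T T^* = P³ - 2P² + P = 0. -/
theorem mul_star_mul (t : PosCone G) : U t * (star (U t) * U t) = U t := by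
  have hP : U t * star (U t) * (U t * star (U t)) = U t * star (U t) :=
    hU.eq_of_mul_map fun a => by
      rw [mul_assoc, hU.mul_star_mul_map, hU.mul_star_mul_map, proj_idem]
  rw [← sub_eq_zero, ← CStarRing.mul_star_self_eq_zero_iff]
  have h : (U t * (star (U t) * U t) - U t) * star (U t * (star (U t) * U t) - U t) =
      U t * star (U t) * (U t * star (U t)) * (U t * star (U t)) -
        U t * star (U t) * (U t * star (U t)) - U t * star (U t) * (U t * star (U t)) +
        U t * star (U t) := by
    simp only [star_sub, star_mul, star_star]
    noncomm_ring
  rw [h, hP, hP]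
  abel

/-- Write U_t = U_t(U_t^* U_t) and move U_t^* U_t past π(a). -/
theorem mul_map (t : PosCone G) (a : A) : U t * π a = π (S.α t a) * U t := by
  rw [← hU.conj]
  nth_rw 1 [← hU.mul_star_mul t]
  rw [mul_assoc, ← hU.map_mul_star_mul]
  simp only [mul_assoc]

theorem mulMap_zero (a : A) : mulMap π U 0 a = π a := by
  rw [mulMap_apply, hU.map_zero, mul_one]

theorem isFellRep : S.IsFellRep (mulMap π U) where
  map_star a := by rw [hU.mulMap_zero, hU.mulMap_zero, StarHomClass.map_star]
  mul s t a b := by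
    rw [mulMap_apply, mulMap_apply, mulMap_apply, hU.map_add, map_mul, mul_assoc, ← mul_assoc (U s),
      hU.mul_map]
    simp only [mul_assoc]
  star_mul t a b := by
    rw [mulMap_apply, mulMap_apply, hU.mulMap_zero, star_mul, ← hU.conj_star, map_mul,
      StarHomClass.map_star]
    simp only [mul_assoc]
  mul_star t a b := by
    rw [mulMap_apply, mulMap_apply, hU.mulMap_zero, star_mul, mul_proj_mul, map_mul,
      ← hU.mul_star_mul_map, StarHomClass.map_star]
    simp only [mul_assoc]

theorem isIntegratedForm : IsIntegratedForm π U hU.isFellRep.crossedProductHom where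
  nondegenerate := by
    refine Dense.mono ?_ hU.nondegenerate
    refine Submodule.span_mono ?_
    rintro _ ⟨b, ξ, rfl⟩
    refine ⟨CrossedProduct.δ S ((0 : PosCone G) : G) ⟨b, S.mem_fiber_zero b⟩, ξ, ?_⟩
    rw [IsFellRep.crossedProductHom_δ, IsFellRep.fiberMap_coe, hU.mulMap_zero]
  map_pos t a := by
    rw [IsFellRep.crossedProductHom_δ, IsFellRep.fiberMap_coe, mulMap_apply]
  map_neg t a := by
    rw [IsFellRep.crossedProductHom_δ, hU.isFellRep.fiberMap_neg_coe, mulMap_apply, star_mul,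
      StarHomClass.map_star, star_star]

end IsCovariantPair

theorem CrossedProduct.hom_ext {C : Type*} [NonUnitalCStarAlgebra C]
    {σ τ : S.CrossedProduct →⋆ₙₐ[ℂ] C} (h : ∀ g a, σ (δ S g a) = τ (δ S g a)) : σ = τ := by
  have h1 := LinearMap.eqOn_span' (f := (σ : S.CrossedProduct →ₗ[ℂ] C))
    (g := (τ : S.CrossedProduct →ₗ[ℂ] C)) (s := {x | ∃ g a, x = δ S g a})
    (by rintro _ ⟨g, a, rfl⟩; exact h g a)
  exact DFunLike.ext' (Continuous.ext_on (dense_span_δ S) (map_continuous σ) (map_continuous τ) h1)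

theorem IsIntegratedForm.unique {π : A →⋆ₙₐ[ℂ] (H →L[ℂ] H)} {U : PosCone G → (H →L[ℂ] H)}
    {σ τ : S.CrossedProduct →⋆ₙₐ[ℂ] (H →L[ℂ] H)} (hσ : IsIntegratedForm π U σ)
    (hτ : IsIntegratedForm π U τ) : σ = τ := by
  refine CrossedProduct.hom_ext fun g a => ?_
  obtain ⟨t, rfl | rfl⟩ := IsFellRep.exists_coe g
  · rw [hσ.map_pos, hτ.map_pos]
  · rw [hσ.map_neg, hτ.map_neg]

/-- Extend σ to the multiplier algebra; π is its restriction to A and U_t the image of u_t. -/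
theorem exists_isIntegratedForm {σ : S.CrossedProduct →⋆ₙₐ[ℂ] (H →L[ℂ] H)}
    (hσ : IsNondegenerate σ) :
    ∃ (π : A →⋆ₙₐ[ℂ] (H →L[ℂ] H)) (U : PosCone G → (H →L[ℂ] H)),
      S.IsCovariantPair π U ∧ IsIntegratedForm π U σ := by
  obtain ⟨τ, h1, hmul, hstar, hσ'⟩ := exists_starHom hσ
    (l := approximateUnit A) (e := CrossedProduct.ι S)
    ((increasingApproximateUnit A).eventually_norm.mono fun e he =>
      (NonUnitalStarAlgHom.norm_apply_le _ e).trans he) (CrossedProduct.tendsto_ι_mul S)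
  refine ⟨σ.comp (CrossedProduct.ι S), fun t => τ (CrossedProduct.u S t),
    ⟨?_, ?_, fun s t => ?_, fun t a => ?_, fun t a => ?_⟩, hσ, fun t a => ?_, fun t a => ?_⟩
  -- Each σ(x)ξ is the limit of σ(ι(e)) σ(x)ξ, so the restriction to A stays non-degenerate.
  · suffices hle : Submodule.span ℂ {η : H | ∃ b ξ, η = σ b ξ} ≤
        (Submodule.span ℂ {η : H | ∃ b ξ, η = σ.comp (CrossedProduct.ι S) b ξ}).topologicalClosure
      from Dense.of_closure (hσ.mono hle)
    rw [Submodule.span_le]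
    rintro _ ⟨x, ξ, rfl⟩
    have h : Tendsto (fun e => σ (CrossedProduct.ι S e * x) ξ) (approximateUnit A)
        (𝓝 (σ x ξ)) :=
      ((ContinuousLinearMap.apply ℂ H ξ).continuous.tendsto _).comp
        (((continuous_rep σ).tendsto x).comp (CrossedProduct.tendsto_ι_mul S x))
    refine mem_closure_of_tendsto h (Eventually.of_forall fun e => ?_)
    refine Submodule.subset_span ⟨e, σ x ξ, ?_⟩
    rw [map_mul]
    rfl
  · rw [CrossedProduct.u_zero, h1]
  · rw [CrossedProduct.u_add, hmul]
  · rw [NonUnitalStarAlgHom.comp_apply, NonUnitalStarAlgHom.comp_apply, ← hσ', ← hσ', ← hstar,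
      ← hmul, ← hmul, CrossedProduct.u_conj]
  · rw [NonUnitalStarAlgHom.comp_apply, NonUnitalStarAlgHom.comp_apply, ← hσ', ← hσ', ← hstar,
      ← hmul, ← hmul, CrossedProduct.u_conj_star]
  · rw [NonUnitalStarAlgHom.comp_apply, ← hσ', ← hσ', ← hmul, CrossedProduct.δ_eq_ι_mul_u]
  · rw [NonUnitalStarAlgHom.comp_apply, ← hσ', ← hσ', ← hstar, ← hmul,
      CrossedProduct.δ_eq_star_u_mul_ι]

end CornerSystem

/-! ### Relations in enveloping algebras, and the universal property of the free *-algebra. -/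

theorem CStarSeminorm.ofHom_eq_zero {V : Type*} [NonUnitalRing V] [StarRing V] [Module ℂ V]
    {R : Set V} (hR : Bounding R) {r : V} (hr : r ∈ R) : Completion.ofHom (maximal hR) r = 0 := by
  rw [← norm_eq_zero, Completion.norm_ofHom]
  change ⨆ p : {p : CStarSeminorm V // ∀ s ∈ R, p s = 0}, p.1 r = 0
  simp only [fun p : {p : CStarSeminorm V // ∀ s ∈ R, p s = 0} => p.2 r hr, ciSup_const]

namespace FreeStarAlgebra

variable {X : Type*} {C : Type*} [NonUnitalCStarAlgebra C]

/-- The value of a word. -/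
def wordHom (f : X → C) : StarWord X →ₙ* C :=
  FreeSemigroup.lift fun y => if y.2 then star (f y.1) else f y.1

theorem wordHom_adj (f : X → C) (w : StarWord X) :
    wordHom f (StarWord.adj w).unop = star (wordHom f w) := by
  induction w using FreeSemigroup.recOnMul with
  | ih1 y =>
    obtain ⟨y, b⟩ := y
    cases b <;> simp [wordHom, StarWord.adj]
  | ih2 y w hy hw => simp only [map_mul, MulOpposite.unop_mul, star_mul, hy, hw]

/-- The algebra homomorphism of the free `*`-algebra given by the values of the generators. -/
def algHom (f : X → C) : FreeStarAlgebra X →ₙₐ[ℂ] C :=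
  (MonoidAlgebra.liftMagma ℂ (wordHom f) : MonoidAlgebra ℂ (StarWord X) →ₙₐ[ℂ] C)

theorem algHom_mono (f : X → C) (w : StarWord X) (c : ℂ) :
    algHom f (mono w c) = c • wordHom f w := by
  have h : MonoidAlgebra.liftMagma ℂ (wordHom f)
      (MonoidAlgebra.single w c : MonoidAlgebra ℂ (StarWord X)) = c • wordHom f w := by simp
  exact h

/-- The universal property of the free `*`-algebra. -/
def lift (f : X → C) : FreeStarAlgebra X →⋆ₙₐ[ℂ] C :=
  { algHom f with
    map_star' := fun x => by
      change algHom f (star x) = star (algHom f x)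
      induction x using ind with
      | h0 => rw [star_zero, map_zero, star_zero]
      | h2 x y hx hy => rw [star_add, map_add, map_add, hx, hy, star_add]
      | h1 w c => rw [star_mono, algHom_mono, algHom_mono, wordHom_adj, star_smul] }

theorem lift_gen (f : X → C) (x : X) : lift f (gen x) = f x :=
  (algHom_mono f _ 1).trans (by simp [wordHom])

theorem hom_ext {f g : FreeStarAlgebra X →⋆ₙₐ[ℂ] C} (h : ∀ x, f (gen x) = g (gen x)) : f = g := by
  refine NonUnitalStarAlgHom.ext fun x => ?_
  induction x using ind with
  | h0 => rw [map_zero, map_zero]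
  | h2 x y hx hy => rw [map_add, map_add, hx, hy]
  | h1 w c =>
    have key : f (mono w 1) = g (mono w 1) := by
      induction w using FreeSemigroup.recOnMul with
      | ih1 y =>
        obtain ⟨y, b⟩ := y
        cases b with
        | false => exact h y
        | true => rw [← star_gen, StarHomClass.map_star, StarHomClass.map_star, h]
      | ih2 y w hy hw =>
        have e := mono_mul (FreeSemigroup.of y) w 1 1
        rw [one_mul] at e
        rw [← e, map_mul, map_mul, hy, hw]
    have e := smul_mono c 1 w
    rw [mul_one] at e
    rw [← e, map_smul, map_smul, key]

end FreeStarAlgebra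

/-! ### The Toeplitz algebra, redundancies, and the Exel–Larsen crossed product. -/

namespace CornerSystem

open CStarAlgebra DoubleCentralizer

variable {G : Type*} [AddCommGroup G] [LinearOrder G] [IsOrderedAddMonoid G]
  {A : Type*} [NonUnitalCStarAlgebra A] [PartialOrder A] [StarOrderedRing A]
  (S : CornerSystem G A)

theorem L_star_mul_sub_snd (t : PosCone G) (x a : A) :
    S.L t (x * (a - (S.proj t).snd a)) = 0 := by
  rw [mul_sub, ← mul_proj, map_sub, L_snd, sub_self]

/-- From α_t ∘ L_t = p_t · p_t. With b^* in place of b it says that Θ_{q_t(a),q_t(b)} and left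
multiplication by a p_t b^* agree on q_t(c). -/
theorem mul_α_L (t : PosCone G) (a b c : A) :
    (S.proj t).snd (a * S.α t (S.L t (b * c))) = (S.proj t).snd ((S.proj t).snd a * b * c) := by
  rw [α_L, ← mul_proj_mul, ← mul_proj, mul_proj, ← mul_proj, proj_idem']
  simp only [mul_proj, mul_assoc]

namespace ToeplitzAlgebra

/-- The quotient map of the free `*`-algebra. -/
def quotientHom : FreeStarAlgebra (PosCone G × A) →⋆ₙₐ[ℂ] S.ToeplitzAlgebra :=
  CStarSeminorm.Completion.ofHom (CStarSeminorm.maximal S.toeplitz_bounding)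

theorem i_relation {r : FreeStarAlgebra (PosCone G × A)} (hr : S.ToeplitzRel r) :
    quotientHom S r = 0 :=
  CStarSeminorm.ofHom_eq_zero S.toeplitz_bounding hr

theorem i_add (t : PosCone G) (a b : A) : i S t (a + b) = i S t a + i S t b := by
  have := i_relation S (.add t a b)
  rwa [map_sub, map_add, sub_eq_zero] at this

theorem i_smul (t : PosCone G) (c : ℂ) (a : A) : i S t (c • a) = c • i S t a := by
  have := i_relation S (.smul t c a)
  rwa [map_sub, map_smul, sub_eq_zero] at this

theorem i_star (a : A) : i S 0 (star a) = star (i S 0 a) := by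
  have := i_relation S (.star a)
  rwa [map_sub, StarHomClass.map_star, sub_eq_zero] at this

theorem i_mul (s t : PosCone G) (a b : A) : i S s a * i S t b = i S (s + t) (a * S.α s b) := by
  have := i_relation S (.mul s t a b)
  rwa [map_sub, map_mul, sub_eq_zero] at this

theorem star_i_mul (t : PosCone G) (a b : A) :
    star (i S t a) * i S t b = i S 0 (S.L t (star a * b)) := by
  have := i_relation S (.inner t a b)
  rwa [map_sub, map_mul, StarHomClass.map_star, sub_eq_zero] at this

/-- The linear map `a ↦ i_t(a)`. -/
def iLinear (t : PosCone G) : A →ₗ[ℂ] S.ToeplitzAlgebra where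
  toFun := i S t
  map_add' := i_add S t
  map_smul' := i_smul S t

/-- The vector q_t(a - a p_t) has length 0 in X_t. -/
theorem i_snd (t : PosCone G) (a : A) : i S t ((S.proj t).snd a) = i S t a := by
  have h : i S t (a - (S.proj t).snd a) = 0 := by
    rw [← CStarRing.star_mul_self_eq_zero_iff, star_i_mul, L_star_mul_sub_snd]
    exact map_zero (iLinear S 0)
  have h2 := map_sub (iLinear S t) a ((S.proj t).snd a)
  exact (sub_eq_zero.1 (h2.symm.trans h)).symm

/-- In a corner system every rank-one operator on X_t is left multiplication by an element of the
ideal generated by α_t(A). This supplies the relation by which representations of the bundle differ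
from Toeplitz representations. -/
theorem isRedundancy (t : PosCone G) (a b : A) :
    IsRedundancy S t ((S.proj t).snd a * star b) (i S t a * star (i S t b)) where
  mem_ideal := by
    refine mem_closure_of_tendsto (((S.proj_spec t).2 a).mul_const (star b))
      (Eventually.of_forall fun e => Submodule.subset_span ⟨a, e, star b, rfl⟩)
  mem_compact := subset_closure (Submodule.subset_span ⟨a, b, rfl⟩)
  mul_eq c := by
    rw [mul_assoc, star_i_mul, i_mul, i_mul, S.α_zero, zero_add, add_zero, ← i_snd, mul_α_L, i_snd]

/-- The representation of the Toeplitz algebra in the crossed product. -/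
def toCrossedProduct : S.ToeplitzAlgebra →⋆ₙₐ[ℂ] S.CrossedProduct :=
  CStarSeminorm.lift S.toeplitz_bounding
    (FreeStarAlgebra.lift fun x : PosCone G × A => CrossedProduct.Δ S x.1 x.2) fun r hr => by
      have hF := CrossedProduct.isFellRep S
      cases hr with
      | add t a b =>
        rw [map_sub, map_add, FreeStarAlgebra.lift_gen, FreeStarAlgebra.lift_gen,
          FreeStarAlgebra.lift_gen, map_add, sub_self]
      | smul t c a =>
        rw [map_sub, map_smul, FreeStarAlgebra.lift_gen, FreeStarAlgebra.lift_gen, map_smul,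
          sub_self]
      | star a =>
        rw [map_sub, StarHomClass.map_star, FreeStarAlgebra.lift_gen, FreeStarAlgebra.lift_gen,
          sub_eq_zero]
        exact hF.map_star a
      | mul s t a b =>
        rw [map_sub, map_mul, FreeStarAlgebra.lift_gen, FreeStarAlgebra.lift_gen,
          FreeStarAlgebra.lift_gen, sub_eq_zero]
        exact hF.mul s t a b
      | inner t a b =>
        rw [map_sub, map_mul, StarHomClass.map_star, FreeStarAlgebra.lift_gen,
          FreeStarAlgebra.lift_gen, FreeStarAlgebra.lift_gen, sub_eq_zero]
        exact hF.star_mul t a b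

theorem toCrossedProduct_i (t : PosCone G) (a : A) :
    toCrossedProduct S (i S t a) = CrossedProduct.Δ S t a :=
  (CStarSeminorm.lift_ofHom _ _ _ _).trans (FreeStarAlgebra.lift_gen _ _)

/-- The image z of the difference lies in the closed span N of the elements Δ_t(b) Δ_t(c)^*, yet z
annihilates each Δ_t(b) from the left. So z N^* = 0, and in particular z z^* = 0. -/
theorem toCrossedProduct_redundancy {t : PosCone G} {a : A} {k : S.ToeplitzAlgebra}
    (h : IsRedundancy S t a k) : toCrossedProduct S (i S 0 a - k) = 0 := by
  set N : Submodule ℂ S.CrossedProduct := (Submodule.span ℂ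
    {x | ∃ b c, x = CrossedProduct.Δ S t b * star (CrossedProduct.Δ S t c)}).topologicalClosure
  have hN : IsClosed (N : Set S.CrossedProduct) := Submodule.isClosed_topologicalClosure _
  have hgen : ∀ b c, CrossedProduct.Δ S t b * star (CrossedProduct.Δ S t c) ∈ N := fun b c =>
    Submodule.le_topologicalClosure _ (Submodule.subset_span ⟨b, c, rfl⟩)
  have hk : toCrossedProduct S k ∈ N := by
    refine closure_minimal (t := toCrossedProduct S ⁻¹' N) ?_
      (hN.preimage (map_continuous (toCrossedProduct S))) h.mem_compact
    have : Submodule.span ℂ {x | ∃ b c, x = i S t b * star (i S t c)} ≤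
        N.comap (toCrossedProduct S : S.ToeplitzAlgebra →ₗ[ℂ] S.CrossedProduct) := by
      rw [Submodule.span_le]
      rintro _ ⟨b, c, rfl⟩
      change toCrossedProduct S (i S t b * star (i S t c)) ∈ N
      rw [map_mul, StarHomClass.map_star, toCrossedProduct_i, toCrossedProduct_i]
      exact hgen b c
    exact this
  -- The ideal condition is needed here: b α_t(c) d is the product of Δ_t(b α_t(c)) with the adjoint
  -- of Δ_t(d^*).
  have ha : CrossedProduct.ι S a ∈ N := by
    refine closure_minimal (t := CrossedProduct.ι S ⁻¹' N) ?_
      (hN.preimage (map_continuous (CrossedProduct.ι S))) h.mem_ideal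
    have : Submodule.span ℂ {x | ∃ b c d, x = b * S.α t c * d} ≤
        N.comap (CrossedProduct.ι S : A →ₗ[ℂ] S.CrossedProduct) := by
      rw [Submodule.span_le]
      rintro _ ⟨b, c, d, rfl⟩
      change CrossedProduct.ι S (b * S.α t c * d) ∈ N
      have e := CrossedProduct.Δ_mul_star_Δ S t (b * S.α t c) (star d)
      rw [star_star, mul_proj, α_proj] at e
      rw [← e]
      exact hgen _ _
    exact this
  set z := toCrossedProduct S (i S 0 a - k) with hz
  have hzN : z ∈ N := by
    rw [hz, map_sub, toCrossedProduct_i, CrossedProduct.Δ_zero]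
    exact N.sub_mem ha hk
  have hzΔ : ∀ b, z * CrossedProduct.Δ S t b = 0 := fun b => by
    rw [hz, ← toCrossedProduct_i, ← map_mul, sub_mul, h.mul_eq, sub_self, map_zero]
  -- The set of x with z x^* = 0 is a closed subspace, so the generators of N decide.
  have key : ∀ x ∈ N, z * star x = 0 := by
    intro x hx
    refine closure_minimal (t := {x | z * star x = 0}) ?_
      (isClosed_eq (continuous_const.mul continuous_star) continuous_const) hx
    intro y hy
    change z * star y = 0
    induction hy using Submodule.span_induction with
    | mem x hx =>
      obtain ⟨b, c, rfl⟩ := hx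
      rw [star_mul, star_star, ← mul_assoc, hzΔ, zero_mul]
    | zero => rw [star_zero, mul_zero]
    | add x y _ _ hx hy => rw [star_add, mul_add, hx, hy, add_zero]
    | smul c x _ hx => rw [star_smul, mul_smul_comm, hx, smul_zero]
  exact (CStarRing.mul_star_self_eq_zero_iff z).1 (key z hzN)

end ToeplitzAlgebra

namespace ExelLarsen

/-- The quotient map of the Toeplitz algebra. -/
def quotientHom : S.ToeplitzAlgebra →⋆ₙₐ[ℂ] S.ExelLarsen :=
  CStarSeminorm.Completion.ofHom (CStarSeminorm.maximal S.exelLarsen_bounding)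

theorem quotientHom_i (t : PosCone G) (a : A) :
    quotientHom S (ToeplitzAlgebra.i S t a) = i S t a := rfl

/-- The linear map `a ↦ i_t(a)`. -/
def iLinear (t : PosCone G) : A →ₗ[ℂ] S.ExelLarsen :=
  (quotientHom S : S.ToeplitzAlgebra →ₗ[ℂ] S.ExelLarsen) ∘ₗ ToeplitzAlgebra.iLinear S t

theorem iLinear_apply (t : PosCone G) (a : A) : iLinear S t a = i S t a := rfl

theorem isFellRep : S.IsFellRep (iLinear S) where
  map_star a := by
    simp only [iLinear_apply, ← quotientHom_i, ToeplitzAlgebra.i_star, StarHomClass.map_star]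
  mul s t a b := by
    simp only [iLinear_apply, ← quotientHom_i, ← ToeplitzAlgebra.i_mul, map_mul]
  star_mul t a b := by
    simp only [iLinear_apply, ← quotientHom_i, ← ToeplitzAlgebra.star_i_mul, map_mul,
      StarHomClass.map_star]
  mul_star t a b := by
    -- The one relation that fails to come from the Toeplitz algebra; the quotient by redundancies
    -- forces it.
    have h : quotientHom S (ToeplitzAlgebra.i S 0 ((S.proj t).snd a * star b) -
        ToeplitzAlgebra.i S t a * star (ToeplitzAlgebra.i S t b)) = 0 :=
      CStarSeminorm.ofHom_eq_zero S.exelLarsen_bounding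
        ⟨t, _, _, ToeplitzAlgebra.isRedundancy S t a b, rfl⟩
    rw [map_sub, sub_eq_zero, map_mul, StarHomClass.map_star] at h
    exact h.symm

/-- Agreement on generators passes to the free *-algebra, then by density to its completion 𝒯_X, and
by density again to the quotient. -/
theorem hom_ext {C : Type*} [NonUnitalCStarAlgebra C] {f g : S.ExelLarsen →⋆ₙₐ[ℂ] C}
    (h : ∀ t a, f (i S t a) = g (i S t a)) : f = g := by
  have h1 : (f.comp (quotientHom S)).comp (ToeplitzAlgebra.quotientHom S) =
      (g.comp (quotientHom S)).comp (ToeplitzAlgebra.quotientHom S) :=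
    FreeStarAlgebra.hom_ext fun x => h x.1 x.2
  have h2 : f.comp (quotientHom S) = g.comp (quotientHom S) := by
    refine DFunLike.ext' (DenseRange.equalizer (CStarSeminorm.denseRange_ofHom
      (CStarSeminorm.maximal S.toeplitz_bounding)) (map_continuous _) (map_continuous _) ?_)
    exact funext fun x => DFunLike.congr_fun h1 x
  refine DFunLike.ext' (DenseRange.equalizer (CStarSeminorm.denseRange_ofHom
    (CStarSeminorm.maximal S.exelLarsen_bounding)) (map_continuous _) (map_continuous _) ?_)
  exact funext fun x => DFunLike.congr_fun h2 x

/-- The homomorphism of the Exel-Larsen crossed product to the crossed product. -/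
def toCrossedProduct : S.ExelLarsen →⋆ₙₐ[ℂ] S.CrossedProduct :=
  CStarSeminorm.lift S.exelLarsen_bounding (ToeplitzAlgebra.toCrossedProduct S) (by
    rintro _ ⟨t, a, k, h, rfl⟩
    exact ToeplitzAlgebra.toCrossedProduct_redundancy S h)

theorem toCrossedProduct_i (t : PosCone G) (a : A) :
    toCrossedProduct S (i S t a) = CrossedProduct.Δ S t a :=
  (CStarSeminorm.lift_ofHom _ _ _ _).trans (ToeplitzAlgebra.toCrossedProduct_i S t a)

theorem crossedProductHom_Δ (t : PosCone G) (a : A) :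
    (isFellRep S).crossedProductHom (CrossedProduct.Δ S t a) = i S t a := by
  rw [CrossedProduct.Δ_apply, IsFellRep.crossedProductHom_δ, IsFellRep.fiberMap_coe,
    (isFellRep S).map_snd, iLinear_apply]

/-- The inverse comes from the universal property of the crossed product; both composites fix
generators. -/
theorem toCrossedProduct_bijective : Function.Bijective (toCrossedProduct S) := by
  have h1 : (isFellRep S).crossedProductHom.comp (toCrossedProduct S) =
      NonUnitalStarAlgHom.id ℂ S.ExelLarsen :=
    hom_ext S fun t a => by
      rw [NonUnitalStarAlgHom.comp_apply, toCrossedProduct_i, crossedProductHom_Δ]; rfl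
  have h2 : (toCrossedProduct S).comp (isFellRep S).crossedProductHom =
      NonUnitalStarAlgHom.id ℂ S.CrossedProduct := by
    refine CrossedProduct.hom_ext fun g a => ?_
    rcases CrossedProduct.δ_eq S g a with ⟨t, b, h⟩ | ⟨t, b, h⟩ <;> rw [h]
    · rw [NonUnitalStarAlgHom.comp_apply, crossedProductHom_Δ, toCrossedProduct_i]; rfl
    · rw [StarHomClass.map_star, NonUnitalStarAlgHom.comp_apply, crossedProductHom_Δ,
        toCrossedProduct_i]; rfl
  refine Function.bijective_iff_has_inverse.2 ⟨(isFellRep S).crossedProductHom, fun x => ?_,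
    fun x => ?_⟩
  · exact DFunLike.congr_fun h1 x
  · exact DFunLike.congr_fun h2 x

/-- The isomorphism of the Exel-Larsen crossed product with the crossed product. -/
def equivCrossedProduct : S.ExelLarsen ≃⋆ₐ[ℂ] S.CrossedProduct :=
  StarAlgEquiv.ofBijective (toCrossedProduct S) (toCrossedProduct_bijective S)

end ExelLarsen

end CornerSystem

end

theorem mainTheorem10 {G : Type*} [AddCommGroup G] [LinearOrder G] [IsOrderedAddMonoid G]
    {A : Type*} [NonUnitalCStarAlgebra A] [PartialOrder A] [StarOrderedRing A]
    (S : CornerSystem G A) :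
    (∀ (g : G) (a : S.fiber g), ‖CornerSystem.CrossedProduct.δ S g a‖ = ‖(a : A)‖) ∧
    ∃ u : PosCone G → 𝓜(ℂ, S.CrossedProduct),
      -- `u` is a semigroup homomorphism taking values in partial isometries
      u 0 = 1 ∧
      (∀ s t, u (s + t) = u s * u t) ∧
      (∀ t, u t * star (u t) * u t = u t) ∧
      -- the relations
      (∀ t a, u t * (CornerSystem.CrossedProduct.ι S a : 𝓜(ℂ, S.CrossedProduct)) * star (u t) =
        (CornerSystem.CrossedProduct.ι S (S.α t a) : 𝓜(ℂ, S.CrossedProduct))) ∧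
      (∀ t a, star (u t) * (CornerSystem.CrossedProduct.ι S a : 𝓜(ℂ, S.CrossedProduct)) * u t =
        (CornerSystem.CrossedProduct.ι S (S.L t a) : 𝓜(ℂ, S.CrossedProduct))) ∧
      -- the fibres of the Fell bundle are `A ᾱ_t(1) u_t` and `u_t^* ᾱ_t(1) A`
      (∀ (t : PosCone G) (a : S.fiber (t : G)),
        (CornerSystem.CrossedProduct.δ S (t : G) a : 𝓜(ℂ, S.CrossedProduct)) =
          (CornerSystem.CrossedProduct.ι S a : 𝓜(ℂ, S.CrossedProduct)) * u t) ∧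
      (∀ (t : PosCone G) (a : S.fiber (-(t : G))),
        (CornerSystem.CrossedProduct.δ S (-(t : G)) a : 𝓜(ℂ, S.CrossedProduct)) =
          star (u t) * (CornerSystem.CrossedProduct.ι S a : 𝓜(ℂ, S.CrossedProduct))) ∧
      -- the dense `*`-subalgebra
      (∃ D : NonUnitalStarSubalgebra ℂ S.CrossedProduct,
        Dense (D : Set S.CrossedProduct) ∧
        ∀ x : S.CrossedProduct, x ∈ D ↔
          ∃ (F : Finset (PosCone G)) (b a : PosCone G → A) (a₀ : A), 0 ∉ F ∧
            (∀ t ∈ F, b t ∈ S.fiber (-(t : G))) ∧ (∀ t ∈ F, a t ∈ S.fiber (t : G)) ∧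
            (x : 𝓜(ℂ, S.CrossedProduct)) =
              ∑ t ∈ F, star (u t) *
                (CornerSystem.CrossedProduct.ι S (b t) : 𝓜(ℂ, S.CrossedProduct)) +
              (CornerSystem.CrossedProduct.ι S a₀ : 𝓜(ℂ, S.CrossedProduct)) +
              ∑ t ∈ F,
                (CornerSystem.CrossedProduct.ι S (a t) : 𝓜(ℂ, S.CrossedProduct)) * u t) ∧
      -- universality for covariant pairs
      (∀ (H : Type*) [NormedAddCommGroup H] [InnerProductSpace ℂ H] [CompleteSpace H],
        (∀ (π : A →⋆ₙₐ[ℂ] (H →L[ℂ] H)) (U : PosCone G → (H →L[ℂ] H)), S.IsCovariantPair π U →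
          ∃! σ : S.CrossedProduct →⋆ₙₐ[ℂ] (H →L[ℂ] H), CornerSystem.IsIntegratedForm π U σ) ∧
        ∀ σ : S.CrossedProduct →⋆ₙₐ[ℂ] (H →L[ℂ] H), CornerSystem.IsNondegenerate σ →
          ∃ (π : A →⋆ₙₐ[ℂ] (H →L[ℂ] H)) (U : PosCone G → (H →L[ℂ] H)),
            S.IsCovariantPair π U ∧ CornerSystem.IsIntegratedForm π U σ) ∧
      -- the isomorphism with the Exel-Larsen crossed product
      ∃ Ψ : S.ExelLarsen ≃⋆ₐ[ℂ] S.CrossedProduct, ∀ (t : PosCone G) (a : A),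
        (Ψ (CornerSystem.ExelLarsen.i S t a) : 𝓜(ℂ, S.CrossedProduct)) =
          (CornerSystem.CrossedProduct.ι S a : 𝓜(ℂ, S.CrossedProduct)) * u t := by
  open CornerSystem.CrossedProduct in
  refine ⟨norm_δ S, u S, u_zero S, u_add S, u_mul_star_u_mul_u S, u_conj S, u_conj_star S,
    δ_eq_ι_mul_u S, δ_eq_star_u_mul_ι S,
    ⟨NonUnitalStarAlgHom.range (ofSection S), ?_, mem_range_ofSection_iff S⟩, ?_,
    CornerSystem.ExelLarsen.equivCrossedProduct S, fun t a => ?_⟩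
  · exact CStarSeminorm.denseRange_ofHom
      (CStarSeminorm.maximal (CornerSystem.SectionAlgebra.bounding S))
  · intro H _ _ _
    exact ⟨fun π U hU => ⟨_, hU.isIntegratedForm, fun τ hτ => hτ.unique hU.isIntegratedForm⟩,
      fun σ hσ => CornerSystem.exists_isIntegratedForm hσ⟩
  · rw [ι_mul_u]
    exact congrArg _ (CornerSystem.ExelLarsen.toCrossedProduct_i S t a)
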